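/- **Setting.** Let $m,d\in\mathbb C$ with $\operatorname{Re}(1-d/2)\ge 0$. Let $U\subset\mathbb C\setminus\{0\}$ be open and carry a holomorphic branch of the logarithm; for $\lambda_1\in U$ complex powers $\lambda_1^s$ are taken with this branch. Formal series are formal power series in variables $\lambda_2,\lambda_3,\dots$ whose coefficients are functions of $\lambda_1\in U$. *Graphs.* All graphs are finite directed loopfree multigraphs. For $r\ge 1$, $p\ge 0$, $w\ge 1$ let $GF(r,p,w)$ be the set of isomorphism classes of (strongly) connected graphs with $r$ inner and $p$ outer vertices in which every vertex has equal in- and outdegree, inner vertices have indegree $\ge w$ and outer vertices have indegree $1$ (isomorphisms map inner to inner and outer to outer vertices). A graph in $GF(r,1,w)$ is *unclosable* if the edge leaving its outer vertex ends at the vertex where the edge entering the outer vertex starts; $GFU(r,1,w)$ is the set of unclosable graphs. $Pr(G)$ is obtained from $G$ by splitting each outer vertex into an outgoing vertex (where the edge leaving it starts) and an ingoing vertex (where the edge entering it ends); $Pr(G)=G$ if $p=0$. *Matrices.* $MF(r,p,w)$ is the set of nonzero $(r+p)\times(r+p)$ matrices $F$ of nonnegative integers with zero diagonal, whose $k$-th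 row and column sums agree (common value $dias(F)_k$), with $dias(F)_k\ge w$ for $k\le r$, $dias(F)_k=1$ for $k>r$, and with nonzero cofactor of $\mathrm{Diag}(dias(F))-F$ (all its cofactors coincide). $G(F)$ is the graph with adjacency matrix $F$. $gr(F)$ is the number of distinct matrices obtained from $F$ by simultaneously permuting rows and columns, permuting the first $r$ and the last $p$ indices among themselves. *Weights.* For $F\in MF(r,p,w)$ let $d_k=dias(F)_k$, $R=\sum_{k\le r}d_k$, and divide $\{1,\dots,R+p\}$ into consecutive blocks of sizes $d_1,\dots,d_r,1,\dots,1$; let $q(b)$ be the index of the block of $b$. Let $WS(F)$ be the set of permutations $\sigma$ of $\{1,\dots,R+p\}$ such that $\#\{b: q(b)=i,\ q(\sigma(b))=j\}=F_{i,j}$ for all $i,j$ (in particular $q(\sigma(b))\ne q(b)$ for all $b$) and $R+1,\dots,R+p$ lie on $p$ different cycles of $\sigma$. Put $wei_F(m,p)=\sum_{\sigma\in WS(F)}m^{c(\sigma)-p}$, where $c(\sigma)$ is the number of cycles of $\sigma$. For a graph $G$, $gr(G)$ and $wei_G$ are those of its adjacency matrix. *Feynman integrals.* For a connected multigraph $G$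 with edge set $E$, vertex set $V$ and $L(G)=\#E-\#V+1$, let $\mathcal P_G(\alpha)=\sum_T\prod_{e\notin T}\alpha_e$, summed over the (undirected) spanning trees $T$ of $G$, $$\Gamma_G(n)=\int_{(0,\infty)^E}e^{-\sum_e\alpha_e}\,\mathcal P_G(\alpha)^{n-1}\prod_{e}d\alpha_e,\qquad I_G(d)=\frac{\Gamma_G(1-d/2)}{(4\pi)^{L(G)d/2}},\qquad FM_G(\lambda_1)=\frac{\lambda_1^{L(G)d/2}}{\lambda_1^{\#E}} .$$ *Series.* For $F\in MF(r,0,2)$ and $G\in GF(r,1,2)$ put $$FC(F,\lambda)=wei_F(m,0)\,\prod_{k=1}^r(-\lambda_{dias(F)_k})\;FM_{G(F)}(\lambda_1)\,I_{G(F)}(d),$$ $$FCT(G,\lambda)=\lambda_1^{2}\;gr(G)\,wei_G(m,1)\prod_{v\text{ inner}}(-\lambda_{ind(v)})\;FM_{Pr(G)}(\lambda_1)\,I_{Pr(G)}(d),$$ $$\Gamma^{[0],pt}(\lambda)=\sum_{r\ge 2}\frac1{r!}\sum_{F\in MF(r,0,2)}FC(F,\lambda),\qquad \Sigma^{[U]}(\lambda)=\sum_{r\ge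 1}\frac1{r!}\sum_{G\in GFU(r,1,2)}FCT(G,\lambda).$$ In all these sums each monomial in $\lambda_2,\lambda_3,\dots$ occurs only finitely often. **Lemma.** With $D=\sum_{j=1}^\infty (j+1)(j+m)\,\lambda_{j+1}\,\dfrac{\partial}{\partial\lambda_j}$ (where $\partial/\partial\lambda_1$ is the complex derivative of the coefficients and $\partial/\partial\lambda_j$, $j\ge2$, the formal partial derivative), for every $\lambda_1\in U$, as formal power series in $\lambda_2,\lambda_3,\dots$, $$m\cdot\Sigma^{[U]}(\lambda)=\left[1+\lambda_1^{d/2-2}\lambda_2\cdot\frac{2(1+m)\,\Gamma(2-\frac d2)}{(4\pi)^{d/2}}\right]^{-1}\cdot D\bigl(\Gamma^{[0],pt}(\lambda)\bigr).$$ -/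

import Mathlib

noncomputable section

namespace PhiFour

/-! ### Finite directed multigraphs -/

/-- A directed multigraph with vertex type `V` and edge type `E`. -/
structure Multidigraph (V E : Type) where
  st : E → V
  en : E → V

namespace Multidigraph

variable {V E : Type}

/-- No edge starts and ends at the same vertex. -/
def Loopfree (G : Multidigraph V E) : Prop := ∀ e, G.st e ≠ G.en e

/-- Any two distinct vertices are joined by a (nonempty) directed trail
`e₁, …, eₙ` with `en eᵢ = st eᵢ₊₁`. -/
def Connected (G : Multidigraph V E) : Prop :=
  ∀ u v : V, u ≠ v → Relation.TransGen (fun a b => ∃ e, G.st e = a ∧ G.en e = b) u v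

def ind [Fintype E] [DecidableEq V] (G : Multidigraph V E) (v : V) : ℕ :=
  (Finset.univ.filter fun e => G.en e = v).card

def outd [Fintype E] [DecidableEq V] (G : Multidigraph V E) (v : V) : ℕ :=
  (Finset.univ.filter fun e => G.st e = v).card

/-- The adjacency matrix: `adj i j` is the number of edges from `i` to `j`. -/
def adj [Fintype E] [DecidableEq V] (G : Multidigraph V E) : Matrix V V ℕ :=
  fun i j => (Finset.univ.filter fun e => G.st e = i ∧ G.en e = j).card

/-- The multigraph `G(F)` with adjacency matrix `F`: there are `F i j` edges from `i` to `j`. -/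
def ofMatrix (F : Matrix V V ℕ) : Multidigraph V (Σ ij : V × V, Fin (F ij.1 ij.2)) where
  st e := e.1.1
  en e := e.1.2

/-- A spanning tree (edge directions are ignored): a set of `#V - 1` edges that connects all
vertices. -/
def IsSpanningTree [Fintype V] (G : Multidigraph V E) (T : Finset E) : Prop :=
  (∀ u v : V, Relation.EqvGen (fun a b => ∃ e ∈ T, G.st e = a ∧ G.en e = b) u v) ∧
    T.card + 1 = Fintype.card V

open Classical in
/-- The Kirchhoff-Symanzik polynomial `∑_T ∏_{e ∉ T} α_e`, the sum over all spanning trees. -/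
def kirchhoff [Fintype V] [Fintype E] (G : Multidigraph V E) (α : E → ℝ) : ℝ :=
  ∑ T ∈ Finset.univ.filter (fun T : Finset E => G.IsSpanningTree T),
    ∏ e ∈ Finset.univ.filter (fun e => e ∉ T), α e

/-- The generalized gamma function
`Γ_G(n) = ∫_{α > 0} exp(-∑ α_e) · P_G(α)^(n-1) ∏ dα_e`. -/
def gammaFun [Fintype V] [Fintype E] (G : Multidigraph V E) (n : ℂ) : ℂ :=
  ∫ α : E → ℝ in Set.univ.pi (fun _ => Set.Ioi (0 : ℝ)),
    Complex.exp (-(∑ e, (α e : ℂ))) * ((G.kirchhoff α : ℝ) : ℂ) ^ (n - 1)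

/-- The number of loops `L(G) = #E - #V + 1`. -/
def loops [Fintype V] [Fintype E] (_ : Multidigraph V E) : ℤ :=
  (Fintype.card E : ℤ) - (Fintype.card V : ℤ) + 1

/-- The Feynman integral `I_G(d)` at zero external momenta. -/
def feynman [Fintype V] [Fintype E] (G : Multidigraph V E) (d : ℂ) : ℂ :=
  1 / (4 * (Real.pi : ℂ)) ^ ((G.loops : ℂ) * (d / 2)) * G.gammaFun (1 - d / 2)

/-- The mass factor `λ₁^(L(G)·d/2) / λ₁^(#E)`; complex powers of `λ₁` are taken with the branch
`logb` of the logarithm, i.e. `λ₁^s = exp(s · logb λ₁)`. -/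
def massFactor [Fintype V] [Fintype E] (G : Multidigraph V E) (logb : ℂ → ℂ) (d lam : ℂ) : ℂ :=
  Complex.exp ((G.loops : ℂ) * (d / 2) * logb lam) / lam ^ (Fintype.card E)

/-- `Pr(G)` for a graph with inner vertices `I` and outer vertices `O`: every outer vertex `v` is
split into an outgoing copy `inl (inr v)`, at which the edges leaving `v` start, and an ingoing
copy `inr v`, at which the edges entering `v` end. Without outer vertices nothing changes. -/
def pr {I O : Type} (G : Multidigraph (I ⊕ O) E) : Multidigraph ((I ⊕ O) ⊕ O) E where
  st e := Sum.inl (G.st e)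
  en e := Sum.elim (fun i => Sum.inl (Sum.inl i)) (fun o => Sum.inr o) (G.en e)

end Multidigraph

/-! ### Graphs with `r` inner and `p` outer vertices, up to isomorphism -/

/-- A directed multigraph with `r` inner vertices, `p` outer vertices and finitely many edges. -/
abbrev PGraph (r p : ℕ) : Type := Σ n : ℕ, Multidigraph (Fin r ⊕ Fin p) (Fin n)

/-- `GF(r,p,w)`: connected loopfree balanced graphs whose inner vertices have degree at least `w`
and whose outer vertices have in- and outdegree `1`. -/
def IsGF {r p : ℕ} (w : ℕ) (G : PGraph r p) : Prop :=
  G.2.Loopfree ∧ G.2.Connected ∧ (∀ v, G.2.ind v = G.2.outd v) ∧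
    (∀ k, w ≤ G.2.ind (Sum.inl k)) ∧ (∀ k, G.2.ind (Sum.inr k) = 1)

/-- For one outer vertex: the edge leaving it ends where the edge entering it starts. -/
def IsUnclosable {r : ℕ} (G : PGraph r 1) : Prop :=
  ∃ ank bnk, G.2.st ank = Sum.inr 0 ∧ G.2.en bnk = Sum.inr 0 ∧ G.2.en ank = G.2.st bnk

/-- Graph isomorphisms that map inner to inner and outer to outer vertices. -/
def Iso {r p : ℕ} (G H : PGraph r p) : Prop :=
  ∃ (a : Equiv.Perm (Fin r)) (b : Equiv.Perm (Fin p)) (c : Fin G.1 ≃ Fin H.1),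
    ∀ e, H.2.st (c e) = Sum.map a b (G.2.st e) ∧ H.2.en (c e) = Sum.map a b (G.2.en e)

instance graphSetoid (r p : ℕ) : Setoid (PGraph r p) where
  r := Iso
  iseqv := by
    refine ⟨fun G => ⟨1, 1, Equiv.refl _, fun e => by simp⟩, ?_, ?_⟩
    · rintro G H ⟨a, b, c, h⟩
      refine ⟨a.symm, b.symm, c.symm, fun e => ?_⟩
      have h1 := h (c.symm e)
      simp only [Equiv.apply_symm_apply] at h1
      rw [h1.1, h1.2]
      simp [Sum.map_map]
    · rintro G H K ⟨a, b, c, h⟩ ⟨a', b', c', h'⟩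
      refine ⟨a.trans a', b.trans b', c.trans c', fun e => ?_⟩
      have h1 := h e
      have h2 := h' (c e)
      simp only [Equiv.trans_apply, h2.1, h2.2, h1.1, h1.2, Sum.map_map]
      exact ⟨rfl, rfl⟩

/-- `GFU(r,1,w)`: the isomorphism classes of unclosable graphs in `GF(r,1,w)`. -/
def GFU (r w : ℕ) : Set (Quotient (graphSetoid r 1)) :=
  {q | ∃ G : PGraph r 1, IsGF w G ∧ IsUnclosable G ∧ ⟦G⟧ = q}

/-! ### Matrices -/

/-- Nonzero balanced matrices with zero diagonal. -/
def IsMBaln {V : Type} [Fintype V] (F : Matrix V V ℕ) : Prop :=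
  (∀ i, F i i = 0) ∧ (∀ k, ∑ i, F i k = ∑ i, F k i) ∧ F ≠ 0

def dias {V : Type} [Fintype V] (F : Matrix V V ℕ) (k : V) : ℕ := ∑ i, F k i

/-- `MF(r,p,w)`. For a balanced matrix all cofactors of `Diag(F) - F` coincide; the condition is
stated for the principal ones. -/
def MF (r p w : ℕ) : Set (Matrix (Fin r ⊕ Fin p) (Fin r ⊕ Fin p) ℕ) :=
  {F | IsMBaln F ∧ (∀ k, w ≤ dias F (Sum.inl k)) ∧ (∀ k, dias F (Sum.inr k) = 1) ∧
    ∀ v, (Matrix.diagonal (fun k => (dias F k : ℤ)) - F.map (fun n : ℕ => (n : ℤ))).adjugate v v ≠ 0}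

/-- `dia(F)`, the degrees of the inner vertices. -/
def dia {r p : ℕ} (F : Matrix (Fin r ⊕ Fin p) (Fin r ⊕ Fin p) ℕ) : Fin r → ℕ :=
  fun k => dias F (Sum.inl k)

/-- `gr(F)`, the number of different matrices that arise from `F` by renumbering the inner and the
outer vertices. -/
def gr {r p : ℕ} (F : Matrix (Fin r ⊕ Fin p) (Fin r ⊕ Fin p) ℕ) : ℕ :=
  Set.ncard {F' | ∃ (a : Equiv.Perm (Fin r)) (b : Equiv.Perm (Fin p)),
    F' = fun i j => F (Sum.map a b i) (Sum.map a b j)}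

/-! ### Permutations and weights -/

/-- The set `{1, …, R + p}` with `R = d₁ + … + d_r`, sorted into blocks of sizes `d₁, …, d_r` and
`p` blocks of size one. -/
abbrev Slot {r : ℕ} (tu : Fin r → ℕ) (p : ℕ) : Type := (Σ k : Fin r, Fin (tu k)) ⊕ Fin p

/-- The block that contains a given element. -/
def qa {r p : ℕ} {tu : Fin r → ℕ} : Slot tu p → Fin r ⊕ Fin p := Sum.map Sigma.fst id

def permAdj {r p : ℕ} {tu : Fin r → ℕ} (σ : Equiv.Perm (Slot tu p)) :
    Matrix (Fin r ⊕ Fin p) (Fin r ⊕ Fin p) ℕ :=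
  fun i j => (Finset.univ.filter fun s => qa s = i ∧ qa (σ s) = j).card

/-- `SF(tu,r,p)`: loopfree, admissible (the `p` outer elements are moved and lie on `p` different
cycles) and connected permutations. -/
def SF {r : ℕ} (tu : Fin r → ℕ) (p : ℕ) : Set (Equiv.Perm (Slot tu p)) :=
  {σ | (∀ s, qa s ≠ qa (σ s)) ∧
    ((∀ k : Fin p, σ (Sum.inr k) ≠ Sum.inr k) ∧
      ∀ k l : Fin p, k ≠ l → ¬ σ.SameCycle (Sum.inr k) (Sum.inr l)) ∧
    permAdj σ ∈ MF r p 1}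

/-- The number of cycles of a permutation. -/
def cycn {X : Type} (σ : Equiv.Perm X) : ℕ := Nat.card (Quotient (Equiv.Perm.SameCycle.setoid σ))

/-- `WS(F)`. -/
def WS {r p : ℕ} (F : Matrix (Fin r ⊕ Fin p) (Fin r ⊕ Fin p) ℕ) :
    Set (Equiv.Perm (Slot (dia F) p)) :=
  {σ | σ ∈ SF (dia F) p ∧ permAdj σ = F}

open Classical in
/-- The weight polynomial `wei_F(m,p) = ∑_{σ ∈ WS(F)} m^(cycn(σ) - p)`. -/
def wei {r p : ℕ} (F : Matrix (Fin r ⊕ Fin p) (Fin r ⊕ Fin p) ℕ) (m : ℂ) : ℂ :=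
  ∑ σ ∈ Finset.univ.filter (fun σ => σ ∈ WS F), m ^ (cycn σ - p)

/-! ### Formal series in `λ₂, λ₃, …` -/

/-- Formal power series over `ℂ` in the variables `λ_j`, `j ≥ 2`. -/
abbrev FormalSeries : Type := MvPowerSeries {j : ℕ // 2 ≤ j} ℂ

/-- The variable `λ_j` for `j ≥ 2` (and `0`, never used, for `j < 2`). -/
def coupling (j : ℕ) : FormalSeries := if h : 2 ≤ j then MvPowerSeries.X ⟨j, h⟩ else 0

/-- The sum of a family of formal series in which every monomial occurs in only finitely many
members, computed monomial by monomial. -/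
def formalSum {ι : Type} (f : ι → FormalSeries) : FormalSeries :=
  fun μ => ∑ᶠ i, MvPowerSeries.coeff μ (f i)

/-- Every monomial occurs in only finitely many members of the family. -/
def LocallyFiniteFamily {ι : Type} (f : ι → FormalSeries) : Prop :=
  ∀ μ, {i | MvPowerSeries.coeff μ (f i) ≠ 0}.Finite

/-- `∏_k (-λ_{d_k})`. -/
def vertexFactor {r : ℕ} (tu : Fin r → ℕ) : FormalSeries := ∏ k, -coupling (tu k)

/-! ### Feynman contributions and the two formal series -/

/-- `FC(F,λ)` for a matrix `F`. -/
def FCmat {r p : ℕ} (logb : ℂ → ℂ) (m d lam : ℂ)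
    (F : Matrix (Fin r ⊕ Fin p) (Fin r ⊕ Fin p) ℕ) : FormalSeries :=
  MvPowerSeries.C (wei F m * (Multidigraph.ofMatrix F).pr.massFactor logb d lam *
    (Multidigraph.ofMatrix F).pr.feynman d) * vertexFactor (dia F)

/-- `FC(G,λ)` for a graph `G`. -/
def FCgraph {r p : ℕ} (logb : ℂ → ℂ) (m d lam : ℂ) (G : PGraph r p) : FormalSeries :=
  MvPowerSeries.C ((gr G.2.adj : ℂ) * wei G.2.adj m * G.2.pr.massFactor logb d lam *
    G.2.pr.feynman d) * vertexFactor (fun k => G.2.ind (Sum.inl k))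

/-- The truncated contribution `FCT(G,λ) = λ₁^(2p) · FC(G,λ)`. -/
def FCT {r p : ℕ} (logb : ℂ → ℂ) (m d lam : ℂ) (G : PGraph r p) : FormalSeries :=
  MvPowerSeries.C (lam ^ (2 * p)) * FCgraph logb m d lam G

/-- `Γ^{[0],pt}_r`, the sum of the connected vacuum contributions with `r` vertices. -/
def gammaZeroOrder (logb : ℂ → ℂ) (m d lam : ℂ) (r : ℕ) : FormalSeries :=
  MvPowerSeries.C (1 / (r.factorial : ℂ)) *
    formalSum (fun F : MF r 0 2 => FCmat logb m d lam F.1)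

/-- `Γ^{[0],pt} = ∑_{r ≥ 2} Γ^{[0],pt}_r`. -/
def gammaZero (logb : ℂ → ℂ) (m d lam : ℂ) : FormalSeries :=
  formalSum (fun r : {r : ℕ // 2 ≤ r} => gammaZeroOrder logb m d lam r.1)

/-- `Σ^{[U]}_r`, the sum over the isomorphism classes of unclosable graphs; `Σ^{[U]}_0 = 0`. -/
def sigmaUOrder (logb : ℂ → ℂ) (m d lam : ℂ) (r : ℕ) : FormalSeries :=
  if r = 0 then 0 else
    MvPowerSeries.C (1 / (r.factorial : ℂ)) *
      formalSum (fun q : GFU r 2 => FCT logb m d lam q.1.out)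

/-- `Σ^{[U]} = ∑_{r ≥ 0} Σ^{[U]}_r`. -/
def sigmaU (logb : ℂ → ℂ) (m d lam : ℂ) : FormalSeries :=
  formalSum (fun r : ℕ => sigmaUOrder logb m d lam r)

/-- The partial derivative `∂/∂λ_j`, `j ≥ 1`, at `λ₁ = lam`, of a formal series in `λ₂, λ₃, …`
whose coefficients are functions of `λ₁`: for `j ≥ 2` the formal partial derivative, for `j = 1`
the complex derivative of every coefficient. -/
def partialD (j : ℕ) (f : ℂ → FormalSeries) (lam : ℂ) : FormalSeries :=
  if h : 2 ≤ j then MvPowerSeries.pderiv ℂ ⟨j, h⟩ (f lam)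
  else fun μ => deriv (fun z => MvPowerSeries.coeff μ (f z)) lam

/-- `D = ∑_{j ≥ 1} (j+1)(j+m) λ_{j+1} ∂/∂λ_j`. -/
def opD (m : ℂ) (f : ℂ → FormalSeries) (lam : ℂ) : FormalSeries :=
  formalSum (fun j : {j : ℕ // 1 ≤ j} =>
    MvPowerSeries.C (((j.1 : ℂ) + 1) * ((j.1 : ℂ) + m)) * coupling (j.1 + 1) *
      partialD j.1 f lam)

/-! ### The formal sums are locally finite -/

theorem coeff_vertexFactor_ne {r : ℕ} (tu : Fin r → ℕ) (c : ℂ) (μ : {j : ℕ // 2 ≤ j} →₀ ℕ)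
    (h : MvPowerSeries.coeff μ (MvPowerSeries.C c * vertexFactor tu) ≠ 0) :
    μ.degree = r ∧ ∀ k, ∃ j ∈ μ.support, tu k = j.1 := by
  classical
  by_cases h2 : ∀ k, 2 ≤ tu k
  · have e : MvPowerSeries.C c * vertexFactor tu =
        MvPowerSeries.monomial (∑ k, Finsupp.single ⟨tu k, h2 k⟩ 1) (c * (-1) ^ r) := by
      have e1 : vertexFactor tu = ∏ k, MvPowerSeries.monomial
          (Finsupp.single (⟨tu k, h2 k⟩ : {j : ℕ // 2 ≤ j}) 1) (-1 : ℂ) := by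
        refine Finset.prod_congr rfl fun k _ => ?_
        simp [coupling, h2 k, MvPowerSeries.X]
      rw [e1, MvPowerSeries.prod_monomial, ← MvPowerSeries.monomial_zero_eq_C_apply,
        MvPowerSeries.monomial_mul_monomial]
      simp
    rw [e, MvPowerSeries.coeff_monomial] at h
    have hμ : μ = ∑ k, Finsupp.single ⟨tu k, h2 k⟩ 1 := by
      by_contra hne
      simp [hne] at h
    refine ⟨by simp [hμ], fun k => ⟨⟨tu k, h2 k⟩, ?_, rfl⟩⟩
    rw [hμ, Finsupp.mem_support_iff, Finsupp.finsetSum_apply]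
    have := Finset.single_le_sum (f := fun i => (Finsupp.single
      (⟨tu i, h2 i⟩ : {j : ℕ // 2 ≤ j}) 1) ⟨tu k, h2 k⟩) (fun i _ => Nat.zero_le _)
      (Finset.mem_univ k)
    simp only [Finsupp.single_eq_same] at this
    omega
  · push Not at h2
    obtain ⟨k, hk⟩ := h2
    exfalso
    apply h
    have : vertexFactor tu = 0 :=
      Finset.prod_eq_zero (Finset.mem_univ k) (by simp [coupling, Nat.not_le.mpr hk])
    simp [this]

theorem coeff_formalSum_ne {ι : Type} {f : ι → FormalSeries} {μ : {j : ℕ // 2 ≤ j} →₀ ℕ}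
    (h : MvPowerSeries.coeff μ (formalSum f) ≠ 0) : ∃ i, MvPowerSeries.coeff μ (f i) ≠ 0 := by
  by_contra hc
  push Not at hc
  exact h (by
    change ∑ᶠ i, MvPowerSeries.coeff μ (f i) = 0
    simp [hc])

theorem locallyFinite_FCmat (logb : ℂ → ℂ) (m d lam : ℂ) (r : ℕ) :
    LocallyFiniteFamily (fun F : MF r 0 2 => FCmat logb m d lam F.1) := by
  intro μ
  let N := μ.support.sup (fun j => j.1)
  have hfin : (Set.univ.pi fun _ : Fin r ⊕ Fin 0 =>
      Set.univ.pi fun _ : Fin r ⊕ Fin 0 => Set.Iic N).Finite :=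
    Set.Finite.pi fun _ => Set.Finite.pi fun _ => Set.finite_Iic N
  refine Set.Finite.of_finite_image (f := Subtype.val) (hfin.subset ?_)
    Subtype.val_injective.injOn
  rintro _ ⟨F, hF, rfl⟩ i - j -
  obtain ⟨-, h⟩ := coeff_vertexFactor_ne _ _ _ hF
  rcases i with k | k
  · obtain ⟨t, ht, hk⟩ := h k
    have h1 : F.1 (Sum.inl k) j ≤ dia F.1 k :=
      Finset.single_le_sum (f := fun j => F.1 (Sum.inl k) j) (fun _ _ => Nat.zero_le _)
        (Finset.mem_univ j)
    exact h1.trans (hk.le.trans (Finset.le_sup (f := fun j : {j : ℕ // 2 ≤ j} => j.1) ht))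
  · exact k.elim0

theorem Iso.ind_eq {r p : ℕ} {G H : PGraph r p} (h : Iso G H) (k : Fin p)
    (hG : ∀ k, G.2.ind (Sum.inr k) = 1) : H.2.ind (Sum.inr k) = 1 := by
  obtain ⟨a, b, c, hc⟩ := h
  rw [← hG (b.symm k)]
  refine (Finset.card_bij (fun e _ => c e) ?_ (fun _ _ _ _ h => c.injective h) ?_).symm
  · intro e he
    simp only [Finset.mem_filter, Finset.mem_univ, true_and] at he ⊢
    simp [(hc e).2, he]
  · intro e he
    simp only [Finset.mem_filter, Finset.mem_univ, true_and] at he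
    refine ⟨c.symm e, ?_, by simp⟩
    have h1 := (hc (c.symm e)).2
    simp only [Equiv.apply_symm_apply, he] at h1
    simp only [Finset.mem_filter, Finset.mem_univ, true_and]
    rcases hq : G.2.en (c.symm e) with i | i
    · simp [hq] at h1
    · simp only [hq, Sum.map_inr, Sum.inr.injEq] at h1
      simp [h1]

theorem locallyFinite_FCT (logb : ℂ → ℂ) (m d lam : ℂ) (r : ℕ) :
    LocallyFiniteFamily (fun q : GFU r 2 => FCT logb m d lam q.1.out) := by
  intro μ
  let N := μ.support.sup (fun j => j.1)
  let e : ∀ n, Multidigraph (Fin r ⊕ Fin 1) (Fin n) →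
      (Fin n → Fin r ⊕ Fin 1) × (Fin n → Fin r ⊕ Fin 1) := fun n G => (G.st, G.en)
  have he : ∀ n, Function.Injective (e n) := by
    rintro n ⟨s, t⟩ ⟨s', t'⟩ h
    simpa [e] using h
  have : ∀ n, Finite (Multidigraph (Fin r ⊕ Fin 1) (Fin n)) := fun n =>
    Finite.of_injective _ (he n)
  have hfin : {G : PGraph r 1 | G.1 ≤ r * N + 1}.Finite := by
    have : {G : PGraph r 1 | G.1 ≤ r * N + 1} =
        ⋃ n ∈ Set.Iic (r * N + 1), Set.range (Sigma.mk n) := by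
      ext ⟨n, G⟩
      simp only [Set.mem_ofPred_eq, Set.mem_iUnion, Set.mem_Iic, Set.mem_range]
      exact ⟨fun h => ⟨n, h, G, rfl⟩, by rintro ⟨n', h, G', h'⟩; cases h'; exact h⟩
    rw [this]
    exact (Set.finite_Iic _).biUnion fun n _ => Set.finite_range _
  refine Set.Finite.of_finite_image (f := fun q => q.1.out) (hfin.subset ?_) ?_
  · rintro _ ⟨⟨q, G, hG, hU, rfl⟩, hq, rfl⟩
    have hiso : Iso G (⟦G⟧ : Quotient (graphSetoid r 1)).out :=
      (graphSetoid r 1).symm (Quotient.mk_out G)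
    change (⟦G⟧ : Quotient (graphSetoid r 1)).out.1 ≤ r * N + 1
    replace hq : MvPowerSeries.coeff μ
      (FCT logb m d lam (⟦G⟧ : Quotient (graphSetoid r 1)).out) ≠ 0 := hq
    generalize (⟦G⟧ : Quotient (graphSetoid r 1)).out = H at hq hiso ⊢
    have hout := fun k => hiso.ind_eq k hG.2.2.2.2
    unfold FCT FCgraph at hq
    rw [← mul_assoc, ← map_mul] at hq
    obtain ⟨-, h⟩ := coeff_vertexFactor_ne _ _ _ hq
    have hn : H.1 = ∑ v, H.2.ind v := by
      have := Finset.card_eq_sum_card_fiberwise (s := (Finset.univ : Finset (Fin H.1)))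
        (t := Finset.univ) (f := H.2.en) (fun _ _ => Finset.mem_coe.mpr (Finset.mem_univ _))
      simpa [Multidigraph.ind] using this
    rw [hn, Fintype.sum_sum_type]
    refine add_le_add ?_ (by simp [hout])
    calc ∑ k, H.2.ind (Sum.inl k) ≤ ∑ _k : Fin r, N := Finset.sum_le_sum fun k _ => by
          obtain ⟨t, ht, hk⟩ := h k
          exact hk.le.trans (Finset.le_sup (f := fun j : {j : ℕ // 2 ≤ j} => j.1) ht)
      _ = r * N := by simp
  · intro q _ q' _ h
    exact Subtype.ext (Quotient.out_injective h)

theorem coeff_order_ne {ι : Type} {f : ι → FormalSeries} {c : ℂ} {μ : {j : ℕ // 2 ≤ j} →₀ ℕ}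
    (h : MvPowerSeries.coeff μ (MvPowerSeries.C c * formalSum f) ≠ 0) :
    ∃ i, MvPowerSeries.coeff μ (f i) ≠ 0 := by
  rw [MvPowerSeries.coeff_C_mul] at h
  exact coeff_formalSum_ne (right_ne_zero_of_mul h)

theorem locallyFinite_gammaZeroOrder (logb : ℂ → ℂ) (m d lam : ℂ) :
    LocallyFiniteFamily (fun r : {r : ℕ // 2 ≤ r} => gammaZeroOrder logb m d lam r.1) := by
  intro μ
  refine Set.Finite.of_finite_image (f := Subtype.val)
    ((Set.finite_singleton μ.degree).subset ?_) Subtype.val_injective.injOn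
  rintro _ ⟨r, hr, rfl⟩
  obtain ⟨F, hF⟩ := coeff_order_ne hr
  exact (coeff_vertexFactor_ne _ _ _ hF).1.symm

theorem locallyFinite_sigmaUOrder (logb : ℂ → ℂ) (m d lam : ℂ) :
    LocallyFiniteFamily (fun r : ℕ => sigmaUOrder logb m d lam r) := by
  intro μ
  refine (Set.finite_singleton μ.degree).subset ?_
  intro r hr
  simp only [Set.mem_ofPred_eq, sigmaUOrder] at hr
  split_ifs at hr with h0
  · simp at hr
  · obtain ⟨q, hq⟩ := coeff_order_ne hr
    unfold FCT FCgraph at hq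
    rw [← mul_assoc, ← map_mul] at hq
    exact (coeff_vertexFactor_ne _ _ _ hq).1.symm

theorem locallyFinite_opD (m : ℂ) (f : ℂ → FormalSeries) (lam : ℂ) :
    LocallyFiniteFamily (fun j : {j : ℕ // 1 ≤ j} =>
      MvPowerSeries.C (((j.1 : ℂ) + 1) * ((j.1 : ℂ) + m)) * coupling (j.1 + 1) *
        partialD j.1 f lam) := by
  classical
  intro μ
  refine Set.Finite.of_finite_image (f := fun j => j.1 + 1)
    ((μ.support.image Subtype.val).finite_toSet.subset ?_) ?_
  · rintro _ ⟨j, hj, rfl⟩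
    simp only [Finset.coe_image, Set.mem_image, Finset.mem_coe, Finsupp.mem_support_iff]
    refine ⟨⟨j.1 + 1, by have := j.2; omega⟩, fun h0 => hj ?_, rfl⟩
    have h2 : 2 ≤ j.1 + 1 := by have := j.2; omega
    change MvPowerSeries.coeff μ (_ * _ * _) = 0
    rw [mul_assoc, MvPowerSeries.coeff_C_mul, coupling, dif_pos h2, MvPowerSeries.X,
      MvPowerSeries.coeff_monomial_mul, if_neg, mul_zero]
    intro hle
    have := hle ⟨j.1 + 1, h2⟩
    simp [h0] at this
  · intro a _ b _ h
    exact Subtype.ext (Nat.succ_injective h)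

end PhiFour

end

set_option linter.unusedSectionVars false

noncomputable section

namespace PhiFour

open Equiv Finset

/-! ### Cycle counts of permutations -/

section Cycles

/-! Both series are compared coefficient by coefficient after being rewritten as sums over labelled
matrices. For a monomial `μ` of degree `r`, only graphs with `r` inner vertices occur. An unclosable
graph is a vacuum graph `H` with a chosen vertex `a` to which the outer vertex is attached. Its `gr`
labelled versions resolve the sum over isomorphism classes into a sum over pairs `(a, H)`
(`gr_eq_card`, `coeff_formalSum_FCT`). Since the outer slot lies on one cycle, `m * wei` counts all
cycles. With `j` the degree of `a` in `H`, this weight is `(j+1)(j+m)` times the weight of `H`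
(`matWeight_extMat_self`). The two external edges cost `λ₁⁻²`, which the truncation removes
(`amplitude_pr_one`). Hence `m * Σ` has the coefficients `bumpSum`, up to sign and factorial
(`coeff_sigmaU`): a vertex of degree `j` is raised to degree `j+1` with factor `(j+1)(j+m)`. This is
what `D` does to vacuum graphs.

For `j ≥ 2` the pairs with a vertex of degree `j` are produced exactly by `λ_{j+1} ∂/∂λ_j`
(`bumpSum_ge`). For `j = 1` the chosen vertex has one incoming and one outgoing edge, and it is
raised to a `λ₂` vertex (`bumpSum_one`). Deleting it joins its edges to an edge from `a` to `b`, and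
two cases arise (`pendSum_eq`).

If `a ≠ b`, the result is a vacuum graph with a marked edge. Subdividing an edge `e` inserts `α_e /
λ₁` into the parametric integral (`gammaFun_subdiv`). Summing over all edges and using the
homogeneity of the Kirchhoff polynomial gives minus the `λ₁`-derivative of the amplitude
(`Convergent.sum_integral`, `hasDerivAt_matAmp`). The sign cancels against that of the additional
vertex factor `-λ₂`, so this case is the term `2(1+m) λ₂ ∂/∂λ₁` of `D`.

If `a = b`, the deleted vertex formed a bubble at `a`. The bubble factorises as `λ₁^(d/2-2) Γ(2-d/2)
/ (4π)^(d/2)` (`gammaFun_subdiv_loop`), and what remains is again `bumpSum` with one vertex less.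
This case is not in `D Γ`, so `D Γ = (1 + 2(1+m) λ₂ · bubble) · m Σ` (`coeff_opD`). The first factor
has constant term one and is inverted. -/

theorem cycn_congr {X Y : Type} (e : X ≃ Y) (σ : Perm X) :
    cycn (e.permCongr σ) = cycn σ := by
  refine (Nat.card_congr (Quotient.congr e fun a b => ?_)).symm
  change σ.SameCycle a b ↔ (e.permCongr σ).SameCycle (e a) (e b)
  have hpow : ∀ n : ℤ, (e.permCongr σ ^ n) (e a) = e ((σ ^ n) a) := by
    intro n
    have : e.permCongr σ ^ n = e.permCongr (σ ^ n) := by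
      have := map_zpow (e.permCongrHom) σ n
      exact this.symm
    rw [this]
    simp
  simp only [Perm.SameCycle, hpow, e.injective.eq_iff]

/-- Lying on the same cycle is the least equivalence relation containing all pairs `(x, σ x)`. A
negative power is handled by walking forward from its value back to `a`. -/
theorem sameCycle_imp {X : Type} {σ : Perm X} {r : X → X → Prop} (hr : Equivalence r)
    (h : ∀ x, r x (σ x)) {a b : X} (hab : σ.SameCycle a b) : r a b := by
  obtain ⟨n, rfl⟩ := hab
  have key : ∀ (n : ℕ) x, r x ((σ ^ n) x) := by
    intro n
    induction n with
    | zero => intro x; exact hr.refl _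
    | succ k ih =>
      intro x
      rw [pow_succ', Perm.mul_apply]
      exact hr.trans (ih x) (h _)
  cases n with
  | ofNat n => exact key n a
  | negSucc n =>
    have := key (n + 1) ((σ ^ (Int.negSucc n)) a)
    rw [zpow_negSucc, ← Perm.mul_apply, mul_inv_cancel, Perm.one_apply] at this
    rw [zpow_negSucc]
    exact hr.symm this

variable {X : Type} [DecidableEq X]

theorem decomposeOption_symm_some_none (y : X) (τ : Perm X) :
    Perm.decomposeOption.symm (some y, τ) none = some y := by
  simp

/-- The permutation is `τ` with `none` spliced into its cycle immediately before `y`. -/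
theorem decomposeOption_symm_some_some (y x : X) (τ : Perm X) :
    Perm.decomposeOption.symm (some y, τ) (some x) =
      if τ x = y then none else some (τ x) := by
  simp only [Perm.decomposeOption_symm_apply, Perm.mul_apply, optionCongr_apply,
    Option.map_some]
  split_ifs with h
  · simp [h]
  · rw [swap_apply_of_ne_of_ne] <;> simp [h]

/-- Here `none` is a fixed point and forms an additional cycle; this is the source of the summand
`m` in `j + m`. -/
theorem cycn_decomposeOption_none (τ : Perm X) [Finite X] :
    cycn (Perm.decomposeOption.symm (none, τ)) = cycn τ + 1 := by
  set σ := Perm.decomposeOption.symm (none, τ) with hσ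
  have h0 : ∀ i, σ i = i.map τ := Perm.decomposeOption_symm_of_none_apply τ
  have h1 : ∀ a b, σ.SameCycle (some a) (some b) ↔ τ.SameCycle a b := by
    intro a b
    constructor
    · intro h
      have := sameCycle_imp (σ := σ)
        (r := fun x y => Option.Rel τ.SameCycle x y) ?_ ?_ h
      · simpa using this
      · refine ⟨?_, ?_, ?_⟩
        · rintro (_ | x)
          · exact .none
          · exact .some (Perm.SameCycle.refl _ _)
        · rintro _ _ (h | _)
          · exact .some h.symm
          · exact .none
        · rintro _ _ _ (h | _) (h' | _)
          · exact .some (h.trans h')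
          · exact .none
      · rintro (_ | x)
        · rw [h0]; exact .none
        · rw [h0]; exact .some ⟨1, by simp⟩
    · intro h
      refine sameCycle_imp (σ := τ) (r := fun x y => σ.SameCycle (some x) (some y)) ?_ ?_ h
      · exact ⟨fun _ => Perm.SameCycle.refl _ _, Perm.SameCycle.symm, Perm.SameCycle.trans⟩
      · intro x
        exact ⟨1, by simp [h0]⟩
  have h2 : ∀ a, ¬ σ.SameCycle none (some a) := by
    intro a h
    have := sameCycle_imp (σ := σ) (r := fun x y => x.isSome = y.isSome)
      ⟨fun _ => rfl, Eq.symm, Eq.trans⟩ (fun x => by simp [h0]) h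
    simp at this
  have e : Quotient (Perm.SameCycle.setoid σ) ≃ Option (Quotient (Perm.SameCycle.setoid τ)) := by
    refine
      { toFun := Quotient.lift (fun x : Option X => x.map (Quotient.mk _)) ?_
        invFun := fun x => x.elim (Quotient.mk _ none)
          (Quotient.lift (fun a => Quotient.mk _ (some a)) ?_)
        left_inv := ?_
        right_inv := ?_ }
    · rintro (_ | a) (_ | b) h
      · rfl
      · exact (h2 _ h).elim
      · exact (h2 _ (Perm.SameCycle.symm h)).elim
      · simp only [Option.map_some, Option.some.injEq]
        exact Quotient.sound ((h1 a b).1 h)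
    · intro a b h
      exact Quotient.sound ((h1 a b).2 h)
    · intro q
      induction q using Quotient.inductionOn with
      | h x => cases x <;> rfl
    · rintro (_ | q)
      · rfl
      · induction q using Quotient.inductionOn with
        | h x => rfl
  unfold cycn
  rw [Nat.card_congr e, Finite.card_option]

/-- Splicing a point into an existing cycle creates no new cycle: collapsing `none` to `y` turns
each step of the longer permutation into a step of `τ` or into no step. -/
theorem cycn_decomposeOption_some (y : X) (τ : Perm X) :
    cycn (Perm.decomposeOption.symm (some y, τ)) = cycn τ := by
  set σ := Perm.decomposeOption.symm (some y, τ) with hσ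
  have hn : σ none = some y := decomposeOption_symm_some_none y τ
  have hs : ∀ x, σ (some x) = if τ x = y then none else some (τ x) :=
    fun x => decomposeOption_symm_some_some y x τ
  have f1 : ∀ a b, σ.SameCycle a b → τ.SameCycle (a.getD y) (b.getD y) := by
    intro a b h
    refine sameCycle_imp (σ := σ) (r := fun x z => τ.SameCycle (x.getD y) (z.getD y)) ?_ ?_ h
    · exact ⟨fun _ => Perm.SameCycle.refl _ _, Perm.SameCycle.symm, Perm.SameCycle.trans⟩
    · rintro (_ | x)
      · rw [hn]; exact Perm.SameCycle.refl _ _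
      · rw [hs]
        split_ifs with h
        · exact ⟨1, by simp [h]⟩
        · exact ⟨1, by simp⟩
  have f2 : ∀ a b, τ.SameCycle a b → σ.SameCycle (some a) (some b) := by
    intro a b h
    refine sameCycle_imp (σ := τ) (r := fun x z => σ.SameCycle (some x) (some z)) ?_ ?_ h
    · exact ⟨fun _ => Perm.SameCycle.refl _ _, Perm.SameCycle.symm, Perm.SameCycle.trans⟩
    · intro x
      by_cases h : τ x = y
      · refine Perm.SameCycle.trans (y := none) ⟨1, by simp [hs, h]⟩ ⟨1, by simp [hn, h]⟩
      · exact ⟨1, by simp [hs, h]⟩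
  refine Nat.card_congr
    { toFun := Quotient.map' (fun a : Option X => a.getD y) fun a b h => f1 a b h
      invFun := Quotient.map' some fun a b h => f2 a b h
      left_inv := ?_
      right_inv := ?_ }
  · intro q
    induction q using Quotient.inductionOn with
    | h x =>
      cases x with
      | none => exact Quotient.sound (show σ.SameCycle _ _ from
          Perm.SameCycle.symm ⟨1, by simp [hn]⟩)
      | some x => rfl
  · intro q
    induction q using Quotient.inductionOn with
    | h x => rfl

end Cycles

/-! ### Cycle-counting weights of adjacency matrices -/

section Weights

variable {V W : Type} [DecidableEq V] [DecidableEq W] [Fintype V] [Fintype W]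
variable {X Y : Type} [DecidableEq X] [DecidableEq Y] [Fintype X] [Fintype Y]

/-- The adjacency matrix of a permutation of slots with block map `q`. -/
def pAdj (q : X → V) (σ : Perm X) : Matrix V V ℕ :=
  fun i j => (univ.filter fun s => q s = i ∧ q (σ s) = j).card

/-- The sum of `m ^ (number of cycles)` over all permutations with adjacency matrix `F`. -/
def permWeight (q : X → V) (m : ℂ) (F : Matrix V V ℕ) : ℂ :=
  ∑ σ ∈ univ.filter (fun σ : Perm X => pAdj q σ = F), m ^ cycn σ

theorem pAdj_congr (e : X ≃ Y) (v : V ≃ W) (q : X → V) (q' : Y → W)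
    (h : ∀ x, q' (e x) = v (q x)) (σ : Perm X) (i j : V) :
    pAdj q' (e.permCongr σ) (v i) (v j) = pAdj q σ i j := by
  refine (card_equiv e fun s => ?_).symm
  simp [h]

theorem permWeight_congr (e : X ≃ Y) (v : V ≃ W) (q : X → V) (q' : Y → W)
    (h : ∀ x, q' (e x) = v (q x)) (m : ℂ) (F : Matrix V V ℕ) (F' : Matrix W W ℕ)
    (hF : ∀ i j, F' (v i) (v j) = F i j) : permWeight q' m F' = permWeight q m F := by
  refine (sum_equiv e.permCongr (fun σ => ?_) fun σ _ => ?_).symm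
  · simp only [mem_filter, mem_univ, true_and]
    constructor
    · rintro rfl
      ext i j
      obtain ⟨i, rfl⟩ := v.surjective i
      obtain ⟨j, rfl⟩ := v.surjective j
      rw [pAdj_congr e v q q' h, hF]
    · intro h'
      ext i j
      rw [← hF, ← h', pAdj_congr e v q q' h]
  · rw [cycn_congr]

/-- Slots over equal degree functions are equivalent over the vertices. -/
theorem exists_slot_equiv (q : X → V) (q' : Y → V)
    (h : ∀ i, (univ.filter fun s => q s = i).card = (univ.filter fun s => q' s = i).card) :
    ∃ e : X ≃ Y, ∀ x, q' (e x) = q x := by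
  have h' : ∀ i, Nonempty ({s // q s = i} ≃ {s // q' s = i}) := by
    intro i
    refine Fintype.card_eq.1 ?_
    simpa [Fintype.card_subtype] using h i
  refine ⟨(Equiv.sigmaFiberEquiv q).symm.trans ((Equiv.sigmaCongrRight fun i => (h' i).some).trans
    (Equiv.sigmaFiberEquiv q')), fun x => ?_⟩
  simp only [Equiv.trans_apply, Equiv.sigmaCongrRight_apply, Equiv.sigmaFiberEquiv]
  exact ((h' (q x)).some ⟨x, rfl⟩).2

/-- The weight of a matrix: the slots of `i` are the `dias F i` copies of `i`. -/
def matWeight (m : ℂ) (F : Matrix V V ℕ) : ℂ :=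
  permWeight (X := Σ i, Fin (dias F i)) Sigma.fst m F

theorem card_slot_fiber (t : V → ℕ) (i : V) :
    (univ.filter fun s : Σ i, Fin (t i) => s.1 = i).card = t i := by
  rw [show (univ.filter fun s : Σ i, Fin (t i) => s.1 = i) =
    (univ : Finset (Fin (t i))).map ⟨Sigma.mk i, sigma_mk_injective⟩ from ?_]
  · simp
  · ext ⟨j, s⟩
    simp only [mem_filter, mem_univ, true_and, mem_map, Function.Embedding.coeFn_mk]
    constructor
    · rintro rfl; exact ⟨s, rfl⟩
    · rintro ⟨s', h⟩; cases h; rfl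

/-- Only the block sizes matter, so the slots can be chosen to suit each computation. -/
theorem permWeight_eq_matWeight (q : X → V) (m : ℂ) (F : Matrix V V ℕ)
    (h : ∀ i, (univ.filter fun s => q s = i).card = dias F i) :
    permWeight q m F = matWeight m F := by
  obtain ⟨e, he⟩ := exists_slot_equiv q (Sigma.fst : (Σ i, Fin (dias F i)) → V)
    (fun i => by rw [h, card_slot_fiber])
  exact (permWeight_congr e (Equiv.refl V) _ _ he m F F fun _ _ => rfl).symm

theorem dias_congr (v : V ≃ W) (F : Matrix V V ℕ) (F' : Matrix W W ℕ)
    (hF : ∀ i j, F' (v i) (v j) = F i j) (i : V) : dias F' (v i) = dias F i := by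
  unfold dias
  rw [← Equiv.sum_comp v]
  simp [hF]

theorem matWeight_congr (v : V ≃ W) (m : ℂ) (F : Matrix V V ℕ) (F' : Matrix W W ℕ)
    (hF : ∀ i j, F' (v i) (v j) = F i j) : matWeight m F' = matWeight m F := by
  rw [← permWeight_eq_matWeight (fun s : Σ i, Fin (dias F i) => v s.1) m F']
  · exact permWeight_congr (Equiv.refl (Σ i, Fin (dias F i))) v _ _ (fun _ => rfl) m F F' hF
  · intro i
    obtain ⟨i, rfl⟩ := v.surjective i
    simp only [v.injective.eq_iff]
    rw [card_slot_fiber, dias_congr v F F' hF]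

/-! ### Inserting a vertex of degree one -/

/-- The matrix on `Option V` that arises from `H` by adding a vertex `none` with one edge coming
from `a` and one edge leading to `b`. -/
def extMat (a b : V) (H : Matrix V V ℕ) : Matrix (Option V) (Option V) ℕ
  | some i, some j => H i j
  | some i, none => if i = a then 1 else 0
  | none, some j => if j = b then 1 else 0
  | none, none => 0

/-- The matrix with one additional edge from `a` to `b`. -/
def addEdge (a b : V) (H : Matrix V V ℕ) : Matrix V V ℕ :=
  fun i j => H i j + if i = a ∧ j = b then 1 else 0

theorem dias_extMat_none (a b : V) (H : Matrix V V ℕ) : dias (extMat a b H) none = 1 := by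
  simp [dias, Fintype.sum_option, extMat]

theorem dias_extMat_some (a b : V) (H : Matrix V V ℕ) (i : V) :
    dias (extMat a b H) (some i) = dias H i + if i = a then 1 else 0 := by
  simp [dias, Fintype.sum_option, extMat, add_comm]

theorem dias_addEdge (a b : V) (H : Matrix V V ℕ) (i : V) :
    dias (addEdge a b H) i = dias H i + if i = a then 1 else 0 := by
  simp only [dias, addEdge, sum_add_distrib]
  congr 1
  by_cases h : i = a <;> simp [h]

/-- The block map on `Option X` for an additional slot in an additional block. -/
abbrev optMap (q : X → V) : Option X → Option V := Option.map q

/-- A fixed slot `none` would be a loop at the new vertex, so such permutations never realise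
`extMat`. -/
theorem pAdj_optMap_none (q : X → V) (τ : Perm X) :
    pAdj (optMap q) (Perm.decomposeOption.symm (none, τ)) none none ≠ 0 := by
  unfold pAdj
  rw [← Nat.pos_iff_ne_zero, card_pos]
  exact ⟨none, by simp⟩

theorem card_filter_option (p : Option X → Prop) [DecidablePred p] :
    (univ.filter p).card = (if p none then 1 else 0) + (univ.filter fun x => p (some x)).card := by
  rw [Finset.card_filter, Fintype.sum_option, Finset.card_filter]

/-- Skipping `none` replaces the two arrows `τ⁻¹ y → none → y` by the single arrow `τ⁻¹ y → y`,
which is the additional edge from `a` to `b`; all other arrows are shared. -/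
theorem pAdj_optMap_some (q : X → V) (y : X) (τ : Perm X) (H : Matrix V V ℕ) (a b : V) :
    pAdj (optMap q) (Perm.decomposeOption.symm (some y, τ)) = extMat a b H ↔
      (q y = b ∧ q (τ.symm y) = a) ∧ pAdj q τ = addEdge a b H := by
  set σ := Perm.decomposeOption.symm (some y, τ) with hσ
  have hn : σ none = some y := decomposeOption_symm_some_none y τ
  have hs : ∀ x, σ (some x) = if τ x = y then none else some (τ x) :=
    fun x => decomposeOption_symm_some_some y x τ
  have hy : ∀ x, τ x = y ↔ x = τ.symm y := fun x => by rw [Equiv.eq_symm_apply]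
  have e1 : ∀ j, pAdj (optMap q) σ none (some j) = if q y = j then 1 else 0 := by
    intro j
    unfold pAdj
    rw [card_filter_option]
    simp [hn]
  have e2 : ∀ i, pAdj (optMap q) σ (some i) none = if q (τ.symm y) = i then 1 else 0 := by
    intro i
    unfold pAdj
    rw [card_filter_option]
    simp only [Option.map_none, reduceCtorEq, false_and, if_false, zero_add, Option.map_some,
      Option.some.injEq, hs]
    rw [show (univ.filter fun x => q x = i ∧
        Option.map q (if τ x = y then none else some (τ x)) = none) =
        univ.filter fun x => x = τ.symm y ∧ q (τ.symm y) = i from ?_]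
    · by_cases h : q (τ.symm y) = i
      · simp only [h, and_true, if_true]
        exact card_eq_one.2 ⟨τ.symm y, by ext; simp⟩
      · simp [h]
    · ext x
      simp only [mem_filter, mem_univ, true_and]
      by_cases h : τ x = y
      · simp [h, ← (hy x).1 h]
      · simp [h, mt (hy x).2 h]
  have e3 : pAdj (optMap q) σ none none = 0 := by
    unfold pAdj
    rw [card_filter_option]
    simp [hn]
  have e4 : ∀ i j, pAdj q τ i j = pAdj (optMap q) σ (some i) (some j) +
      if i = q (τ.symm y) ∧ j = q y then 1 else 0 := by
    intro i j
    have h1 : pAdj (optMap q) σ (some i) (some j) =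
        (univ.filter fun x => (q x = i ∧ q (τ x) = j) ∧ ¬ τ x = y).card := by
      unfold pAdj
      rw [card_filter_option]
      simp only [Option.map_none, reduceCtorEq, false_and, if_false, zero_add, Option.map_some,
        Option.some.injEq, hs]
      congr 1
      ext x
      simp only [mem_filter, mem_univ, true_and]
      by_cases h : τ x = y <;> simp [h]
    have h2 : (univ.filter fun x => (q x = i ∧ q (τ x) = j) ∧ τ x = y).card =
        if i = q (τ.symm y) ∧ j = q y then 1 else 0 := by
      rw [show (univ.filter fun x => (q x = i ∧ q (τ x) = j) ∧ τ x = y) =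
        univ.filter fun x => x = τ.symm y ∧ (i = q (τ.symm y) ∧ j = q y) from ?_]
      · by_cases h : i = q (τ.symm y) ∧ j = q y
        · rw [if_pos h]
          exact card_eq_one.2 ⟨τ.symm y, by ext x; simp [← h.1, ← h.2]⟩
        · simp [h]
      · ext x
        simp only [mem_filter, mem_univ, true_and]
        by_cases h : τ x = y
        · have := (hy x).1 h
          subst this
          simp [eq_comm]
        · simp [h, mt (hy x).2 h]
    rw [h1, ← h2]
    unfold pAdj
    rw [add_comm, ← filter_filter _ (fun x => τ x = y), ← filter_filter _ (fun x => ¬ τ x = y),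
      card_filter_add_card_filter_not]
  constructor
  · intro h
    have hb : q y = b := by
      have := e1 b
      rw [h] at this
      by_contra hne
      simp [extMat, hne] at this
    have ha : q (τ.symm y) = a := by
      have := e2 a
      rw [h] at this
      by_contra hne
      simp [extMat, hne] at this
    refine ⟨⟨hb, ha⟩, ?_⟩
    ext i j
    rw [e4, h, ha, hb]
    simp [extMat, addEdge]
  · rintro ⟨⟨rfl, rfl⟩, h⟩
    ext (_ | i) (_ | j)
    · rw [e3]; rfl
    · rw [e1]; simp [extMat, eq_comm]
    · rw [e2]; simp [extMat, eq_comm]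
    · have := e4 i j
      rw [h] at this
      simp only [addEdge] at this
      simp only [extMat]
      omega

/-- Any of the `H a b + 1` arrows from `a` to `b` can receive the new slot, without changing the
number of cycles. -/
theorem permWeight_extMat (q : X → V) (m : ℂ) (H : Matrix V V ℕ) (a b : V) :
    permWeight (optMap q) m (extMat a b H) =
      (H a b + 1 : ℕ) * permWeight q m (addEdge a b H) := by
  unfold permWeight
  rw [sum_filter, ← Equiv.sum_comp Perm.decomposeOption.symm, Fintype.sum_prod_type,
    Fintype.sum_option, sum_comm]
  have h0 : ∀ τ : Perm X, ¬ pAdj (optMap q) (Perm.decomposeOption.symm (none, τ)) =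
      extMat a b H := by
    intro τ h
    apply pAdj_optMap_none q τ
    rw [h]; rfl
  simp only [h0, if_false, sum_const_zero, zero_add, pAdj_optMap_some, cycn_decomposeOption_some]
  rw [mul_sum, sum_filter]
  refine sum_congr rfl fun τ _ => ?_
  by_cases h : pAdj q τ = addEdge a b H
  · simp only [h, and_true, if_true]
    rw [← sum_filter, sum_const, nsmul_eq_mul]
    congr 2
    have : addEdge a b H a b = H a b + 1 := by simp [addEdge]
    rw [← this, ← h]
    refine card_equiv τ.symm fun s => ?_
    simp [and_comm]
  · simp [h]

/-- Here `none` is an additional slot of the old block `a`. If its arrow stays in that block,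
skipping `none` removes one loop at `a`; the next lemma is the case where `none` is not fixed. -/
theorem pAdj_loop_none (q : Option X → V) (a : V) (ha : q none = a) (τ : Perm X) :
    pAdj q (Perm.decomposeOption.symm (none, τ)) = addEdge a a (pAdj (q ∘ some) τ) := by
  ext i j
  unfold pAdj addEdge
  rw [card_filter_option, add_comm]
  simp [ha, eq_comm]

theorem pAdj_loop_some (q : Option X → V) (a : V) (ha : q none = a) (τ : Perm X) (y : X)
    (hy : q (some y) = a) :
    pAdj q (Perm.decomposeOption.symm (some y, τ)) = addEdge a a (pAdj (q ∘ some) τ) := by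
  ext i j
  unfold pAdj addEdge
  rw [card_filter_option, add_comm]
  congr 1
  · congr 1
    ext x
    simp only [mem_filter, mem_univ, true_and, decomposeOption_symm_some_some]
    by_cases h : τ x = y <;> simp [h, ha, hy]
  · simp [ha, hy, eq_comm]

theorem addEdge_injective (a b : V) : Function.Injective (addEdge a b) := by
  intro H H' h
  ext i j
  have := congrFun (congrFun h i) j
  simpa [addEdge] using this

/-- The permutations whose arrow starting at a given slot of `a` stays inside the block of `a`. -/
theorem sum_loop_at (q : Option X → V) (m : ℂ) (a : V) (ha : q none = a) (H : Matrix V V ℕ) :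
    ∑ σ ∈ univ.filter (fun σ : Perm (Option X) => pAdj q σ = addEdge a a H ∧ q (σ none) = a),
      m ^ cycn σ =
      (((univ.filter fun y => q (some y) = a).card : ℂ) + m) * permWeight (q ∘ some) m H := by
  -- The image of `none` is another slot of the block, with the cycle count unchanged, or `none`
  -- itself, with one more cycle and hence a factor `m`.
  rw [sum_filter, ← Equiv.sum_comp Perm.decomposeOption.symm, Fintype.sum_prod_type,
    Fintype.sum_option, add_mul, add_comm]
  congr 1
  · rw [card_filter, Nat.cast_sum, sum_mul]
    refine sum_congr rfl fun y _ => ?_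
    by_cases hy : q (some y) = a
    · simp only [pAdj_loop_some q a ha _ y hy, decomposeOption_symm_some_none, hy, and_true,
        (addEdge_injective a a).eq_iff, cycn_decomposeOption_some]
      simp [permWeight, sum_filter]
    · simp only [decomposeOption_symm_some_none, hy]
      simp
  · simp only [pAdj_loop_none q a ha, (addEdge_injective a a).eq_iff,
      Perm.decomposeOption_symm_of_none_apply, Option.map_none, ha, and_true,
      cycn_decomposeOption_none, pow_succ']
    rw [permWeight, mul_sum, sum_filter]

theorem sum_loop_at_slot (q : X → V) (m : ℂ) (a : V) (s : X) (hs : q s = a) (H : Matrix V V ℕ)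
    (hq : ∀ i, (univ.filter fun s => q s = i).card = dias H i + if i = a then 1 else 0) :
    ∑ σ ∈ univ.filter (fun σ : Perm X => pAdj q σ = addEdge a a H ∧ q (σ s) = a), m ^ cycn σ =
      ((dias H a : ℂ) + m) * matWeight m H := by
  let e : Option {x // x ≠ s} ≃ X := Equiv.optionSubtypeNe s
  have hes : e none = s := Equiv.optionSubtypeNe_none s
  have key := sum_loop_at (q ∘ e) m a (by simp [hes, hs]) H
  have hcard : ∀ i, (univ.filter fun y => (q ∘ e) (some y) = i).card = dias H i := by
    intro i
    have h1 := hq i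
    have h2 : (univ.filter fun s => q s = i).card =
        (univ.filter fun z => (q ∘ e) z = i).card := by
      refine (card_equiv e fun z => ?_).symm
      simp
    rw [h2, card_filter_option] at h1
    simp only [Function.comp_apply, hes, hs] at h1 ⊢
    simp only [eq_comm (a := a)] at h1
    omega
  rw [hcard, permWeight_eq_matWeight ((q ∘ e) ∘ some) m H hcard] at key
  rw [← key]
  refine (sum_equiv e.permCongr (fun σ => ?_) fun σ _ => by rw [cycn_congr]).symm
  simp only [mem_filter, mem_univ, true_and]
  have : pAdj q (e.permCongr σ) = pAdj (q ∘ e) σ := by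
    ext i j
    exact pAdj_congr e (Equiv.refl V) (q ∘ e) q (fun _ => rfl) σ i j
  rw [this]
  simp [← hes]

/-- As `H a a = 0`, each permutation has exactly one arrow inside the block of `a`. Its start is one
of `dias H a + 1` slots, and each start contributes `dias H a + m`. -/
theorem permWeight_addEdge_loop (q : X → V) (m : ℂ) (a : V) (H : Matrix V V ℕ) (h0 : H a a = 0)
    (hq : ∀ i, (univ.filter fun s => q s = i).card = dias H i + if i = a then 1 else 0) :
    permWeight q m (addEdge a a H) =
      ((dias H a : ℂ) + 1) * ((dias H a : ℂ) + m) * matWeight m H := by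
  have h1 : permWeight q m (addEdge a a H) = ∑ s ∈ univ.filter (fun s => q s = a),
      ∑ σ ∈ univ.filter (fun σ : Perm X => pAdj q σ = addEdge a a H ∧ q (σ s) = a),
        m ^ cycn σ := by
    rw [permWeight]
    simp only [sum_filter (s := (univ : Finset (Perm X)))]
    rw [sum_comm]
    refine sum_congr rfl fun σ _ => ?_
    by_cases h : pAdj q σ = addEdge a a H
    · simp only [h, true_and, if_true]
      rw [← sum_filter, sum_const, filter_filter]
      have : (univ.filter fun s => q s = a ∧ q (σ s) = a).card = 1 := by
        have := congrFun (congrFun h a) a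
        simpa [pAdj, addEdge, h0] using this
      rw [this, one_smul]
    · simp [h]
  rw [h1, sum_congr rfl fun s hs =>
    sum_loop_at_slot q m a s (by simpa using hs) H hq, sum_const, hq, nsmul_eq_mul]
  simp [mul_assoc]

theorem matWeight_extMat (m : ℂ) (H : Matrix V V ℕ) (a b : V) :
    matWeight m (extMat a b H) = (H a b + 1 : ℕ) * permWeight
      (X := Σ i, Fin (dias (addEdge a b H) i)) Sigma.fst m (addEdge a b H) := by
  rw [← permWeight_extMat, permWeight_eq_matWeight]
  rintro (_ | i)
  · rw [card_filter_option, dias_extMat_none]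
    simp
  · rw [card_filter_option, dias_extMat_some, ← dias_addEdge a b]
    simp [card_slot_fiber]

/-- The new vertex sits on the single loop at `a`. This is the origin of the coefficients
`(j+1)(j+m)` of `D`. -/
theorem matWeight_extMat_self (m : ℂ) (H : Matrix V V ℕ) (a : V) (h0 : H a a = 0) :
    matWeight m (extMat a a H) =
      ((dias H a : ℂ) + 1) * ((dias H a : ℂ) + m) * matWeight m H := by
  rw [matWeight_extMat, h0, permWeight_addEdge_loop _ _ _ _ h0]
  · simp
  · intro i
    rw [card_slot_fiber, dias_addEdge]

theorem matWeight_extMat_eq (m : ℂ) (H : Matrix V V ℕ) (a b : V) :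
    matWeight m (extMat a b H) = (H a b + 1 : ℕ) * matWeight m (addEdge a b H) :=
  matWeight_extMat m H a b

end Weights

end PhiFour

end

noncomputable section

namespace PhiFour

open Equiv Finset

/-! ### Undirected connectivity -/

section Relations

open Relation

variable {V W : Type}

/-- Any two elements are joined by an undirected path. -/
def ConnRel (r : V → V → Prop) : Prop := ∀ u v, EqvGen r u v

theorem eqvGen_map {r : V → V → Prop} {s : W → W → Prop} (f : V → W)
    (h : ∀ i j, r i j → EqvGen s (f i) (f j)) {u v : V} (huv : EqvGen r u v) :
    EqvGen s (f u) (f v) := by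
  induction huv with
  | rel x y hxy => exact h x y hxy
  | refl x => exact .refl _
  | symm x y _ ih => exact .symm _ _ ih
  | trans x y z _ _ ih1 ih2 => exact .trans _ _ _ ih1 ih2

theorem eqvGen_imp {r : V → V → Prop} {p : V → Prop} (h : ∀ i j, r i j → (p i ↔ p j)) {u v : V}
    (huv : EqvGen r u v) : p u ↔ p v := by
  induction huv with
  | rel x y hxy => exact h x y hxy
  | refl x => exact Iff.rfl
  | symm x y _ ih => exact ih.symm
  | trans x y z _ _ ih1 ih2 => exact ih1.trans ih2

/-- Contracting `none` onto `a` preserves and reflects connectivity. All insertions of a vertex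
below are instances. -/
theorem connRel_option {r : Option V → Option V → Prop} {s : V → V → Prop} (a : V)
    (h1 : ∀ i j, s i j → EqvGen r (some i) (some j)) (h2 : EqvGen r (some a) none)
    (h3 : ∀ x y, r x y → EqvGen s (x.getD a) (y.getD a)) : ConnRel r ↔ ConnRel s := by
  constructor
  · intro h u v
    exact eqvGen_map (fun x : Option V => x.getD a) h3 (h (some u) (some v))
  · intro h
    have key : ∀ x : Option V, EqvGen r (some (x.getD a)) x := by
      rintro (_ | x)
      · exact h2
      · exact .refl _
    intro x y
    exact .trans _ _ _ (.symm _ _ (key x)) (.trans _ _ _ (eqvGen_map some h1 (h _ _)) (key y))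

theorem connRel_congr (v : V ≃ W) {r : V → V → Prop} {s : W → W → Prop}
    (h : ∀ i j, s (v i) (v j) ↔ r i j) : ConnRel s ↔ ConnRel r := by
  constructor
  · intro hs i j
    have := eqvGen_map (r := s) (s := r) v.symm (fun i j hij => .rel _ _ (by
      rw [← h]; simpa using hij)) (hs (v i) (v j))
    simpa using this
  · intro hr i j
    have := eqvGen_map (r := r) (s := s) v (fun i j hij => .rel _ _ ((h i j).2 hij))
      (hr (v.symm i) (v.symm j))
    simpa using this

end Relations

/-! ### Balanced matrices, cofactors and connectivity -/

section Matrices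

variable {V W : Type} [Fintype V] [Fintype W] [DecidableEq V] [DecidableEq W]

/-- The support of the matrix is weakly connected. -/
def ConnMat (F : Matrix V V ℕ) : Prop := ConnRel fun i j => F i j ≠ 0

def Balanced (F : Matrix V V ℕ) : Prop := ∀ k, ∑ i, F i k = ∑ i, F k i

/-- Adjacency matrices of connected balanced loopfree graphs. -/
structure IsVac (F : Matrix V V ℕ) : Prop where
  diag : ∀ i, F i i = 0
  bal : Balanced F
  conn : ConnMat F
  ne : Nonempty V

/-- The quadratic form of the Laplacian is a sum of squares even for a non-symmetric `F`: balance
makes the terms in `x j ^ 2` collect to row sums as well. -/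
theorem Balanced.sum_sq {F : Matrix V V ℕ} (h : Balanced F) (x : V → ℤ) :
    ∑ i, ∑ j, (F i j : ℤ) * (x i - x j) ^ 2 =
      2 * ∑ i, x i * ((dias F i : ℤ) * x i - ∑ j, (F i j : ℤ) * x j) := by
  have h1 : ∑ i, ∑ j, (F i j : ℤ) * x i ^ 2 = ∑ i, (dias F i : ℤ) * x i ^ 2 := by
    refine sum_congr rfl fun i _ => ?_
    rw [← sum_mul]; simp [dias]
  have h2 : ∑ i, ∑ j, (F i j : ℤ) * x j ^ 2 = ∑ i, (dias F i : ℤ) * x i ^ 2 := by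
    rw [sum_comm]
    refine sum_congr rfl fun j _ => ?_
    rw [← sum_mul, dias, ← h j]; simp
  have h3 : ∑ i, x i * ((dias F i : ℤ) * x i - ∑ j, (F i j : ℤ) * x j) =
      ∑ i, (dias F i : ℤ) * x i ^ 2 - ∑ i, ∑ j, (F i j : ℤ) * (x i * x j) := by
    rw [← sum_sub_distrib]
    refine sum_congr rfl fun i _ => ?_
    rw [mul_sub, mul_sum]
    congr 1
    · ring
    · exact sum_congr rfl fun j _ => by ring
  have h4 : ∑ i, ∑ j, (F i j : ℤ) * (x i - x j) ^ 2 =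
      ∑ i, ∑ j, (F i j : ℤ) * x i ^ 2 + ∑ i, ∑ j, (F i j : ℤ) * x j ^ 2 -
        2 * ∑ i, ∑ j, (F i j : ℤ) * (x i * x j) := by
    rw [mul_sum, ← sum_add_distrib, ← sum_sub_distrib]
    refine sum_congr rfl fun i _ => ?_
    rw [mul_sum, ← sum_add_distrib, ← sum_sub_distrib]
    exact sum_congr rfl fun j _ => by ring
  rw [h4, h1, h2, h3]; ring

theorem laplace_mulVec (F : Matrix V V ℕ) (x : V → ℤ) (i : V) :
    ((Matrix.diagonal (fun k => (dias F k : ℤ)) - F.map (fun n : ℕ => (n : ℤ))).mulVec x) i =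
      (dias F i : ℤ) * x i - ∑ j, (F i j : ℤ) * x j := by
  rw [Matrix.sub_mulVec, Pi.sub_apply, Matrix.mulVec_diagonal]
  rfl

/-- The cofactor at `v` is the determinant of the Laplacian with row `v` replaced by a unit vector,
so it vanishes iff some nonzero `x` is zero at `v` and harmonic elsewhere. The indicator of a
component not containing `v` is such an `x`. In the connected case the sum of squares forces `x` to
be constant along edges, hence zero. -/
theorem Balanced.cofactor_ne_zero_iff {F : Matrix V V ℕ} (h : Balanced F) :
    (∀ v, (Matrix.diagonal (fun k => (dias F k : ℤ)) -
      F.map (fun n : ℕ => (n : ℤ))).adjugate v v ≠ 0) ↔ ConnMat F := by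
  classical
  set A := Matrix.diagonal (fun k => (dias F k : ℤ)) - F.map (fun n : ℕ => (n : ℤ)) with hA
  have hker : ∀ v (x : V → ℤ), (A.updateRow v (Pi.single v 1)).mulVec x = 0 ↔
      x v = 0 ∧ ∀ i, i ≠ v → (dias F i : ℤ) * x i - ∑ j, (F i j : ℤ) * x j = 0 := by
    intro v x
    have e : ∀ i, (A.updateRow v (Pi.single v 1)).mulVec x i =
        if i = v then x v else (dias F i : ℤ) * x i - ∑ j, (F i j : ℤ) * x j := by
      intro i
      split_ifs with hi
      · subst hi
        simp [Matrix.mulVec]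
      · rw [← laplace_mulVec]
        simp only [Matrix.mulVec, Matrix.updateRow_ne hi, hA]
    constructor
    · intro hx
      refine ⟨by simpa [hx] using (e v).symm, fun i hi => by simpa [hx, hi] using (e i).symm⟩
    · rintro ⟨h1, h2⟩
      ext i
      rw [e]
      split_ifs with hi
      · exact h1
      · exact h2 i hi
  simp only [Matrix.adjugate_apply]
  constructor
  · intro hdet
    by_contra hc
    unfold ConnMat ConnRel at hc
    push Not at hc
    obtain ⟨u, w, huw⟩ := hc
    apply hdet u
    rw [← Matrix.exists_mulVec_eq_zero_iff]
    refine ⟨fun i => if Relation.EqvGen (fun i j => F i j ≠ 0) i w then 1 else 0, ?_, ?_⟩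
    · intro h0
      have := congrFun h0 w
      simp [Relation.EqvGen.refl] at this
    · rw [hker]
      refine ⟨by simp [huw], fun i _ => ?_⟩
      have : ∀ j, (F i j : ℤ) * (if Relation.EqvGen (fun i j => F i j ≠ 0) j w then 1 else 0) =
          (F i j : ℤ) * (if Relation.EqvGen (fun i j => F i j ≠ 0) i w then 1 else 0) := by
        intro j
        by_cases hij : F i j = 0
        · simp [hij]
        · have h1 : Relation.EqvGen (fun i j => F i j ≠ 0) i j := .rel _ _ hij
          congr 1
          exact if_congr ⟨fun h => .trans _ _ _ h1 h, fun h => .trans _ _ _ (.symm _ _ h1) h⟩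
            rfl rfl
      rw [sum_congr rfl fun j _ => this j, ← sum_mul]
      simp [dias]
  · intro hc v hdet
    rw [← Matrix.exists_mulVec_eq_zero_iff] at hdet
    obtain ⟨x, hx0, hx⟩ := hdet
    rw [hker] at hx
    apply hx0
    have hz : ∑ i, ∑ j, (F i j : ℤ) * (x i - x j) ^ 2 = 0 := by
      rw [h.sum_sq, sum_eq_zero, mul_zero]
      intro i _
      by_cases hi : i = v
      · subst hi; rw [hx.1, zero_mul]
      · rw [hx.2 i hi, mul_zero]
    have hnn : ∀ i j, 0 ≤ (F i j : ℤ) * (x i - x j) ^ 2 := fun i j => by positivity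
    rw [sum_eq_zero_iff_of_nonneg fun i _ => sum_nonneg fun j _ => hnn i j] at hz
    have hz' : ∀ i j, F i j ≠ 0 → x i = x j := by
      intro i j hij
      have h1 := hz i (mem_univ _)
      rw [sum_eq_zero_iff_of_nonneg fun j _ => hnn i j] at h1
      have h2 := h1 j (mem_univ _)
      have h3 : (F i j : ℤ) ≠ 0 := by exact_mod_cast hij
      have h4 : (x i - x j) ^ 2 = 0 := by
        rcases mul_eq_zero.1 h2 with h | h
        · exact absurd h h3
        · exact h
      have := pow_eq_zero_iff (two_ne_zero) |>.1 h4
      linarith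
    ext i
    have := eqvGen_imp (p := fun k => x k = 0) (fun i j hij => by rw [hz' i j hij]) (hc i v)
    simpa [hx.1] using this

/-- No edge leaves the set of vertices reachable from `u`. By balance the flow into this set equals
the flow out of it, so no edge enters either, and weak connectivity makes it everything. -/
theorem Balanced.strong {F : Matrix V V ℕ} (h : Balanced F) (hc : ConnMat F) (u v : V)
    (huv : u ≠ v) : Relation.TransGen (fun i j => F i j ≠ 0) u v := by
  classical
  let S := univ.filter fun i => Relation.ReflTransGen (fun i j => F i j ≠ 0) u i
  have hout : ∀ i ∈ S, ∀ j, j ∉ S → F i j = 0 := by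
    intro i hi j hj
    by_contra hne
    simp only [S, mem_filter, mem_univ, true_and] at hi hj
    exact hj (hi.tail hne)
  have hflow : ∑ k ∈ S, ∑ i, F i k = ∑ k ∈ S, ∑ i, F k i := sum_congr rfl fun k _ => h k
  have e1 : ∑ k ∈ S, ∑ i, F k i = ∑ k ∈ S, ∑ i ∈ S, F k i := by
    refine sum_congr rfl fun k hk => ?_
    rw [← sum_add_sum_compl S, Nat.add_eq_left]
    exact sum_eq_zero fun i hi => hout k hk i (by simpa using hi)
  have e2 : ∑ k ∈ S, ∑ i, F i k = ∑ k ∈ S, ∑ i ∈ S, F k i + ∑ k ∈ S, ∑ i ∈ Sᶜ, F i k := by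
    have sw : ∑ k ∈ S, ∑ i ∈ S, F k i = ∑ k ∈ S, ∑ i ∈ S, F i k := sum_comm
    rw [sw, ← sum_add_distrib]
    exact sum_congr rfl fun k _ => (sum_add_sum_compl S _).symm
  have e3 : ∑ k ∈ S, ∑ i ∈ Sᶜ, F i k = 0 := by omega
  have hin : ∀ k ∈ S, ∀ i, i ∉ S → F i k = 0 := by
    intro k hk i hi
    have := sum_eq_zero_iff.1 (sum_eq_zero_iff.1 e3 k hk) i (by simpa using hi)
    exact this
  have hv : u ∈ S ↔ v ∈ S := by
    refine eqvGen_imp (p := fun k => k ∈ S) (fun i j hij => ?_) (hc u v)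
    constructor
    · intro hi
      by_contra hj
      exact hij (hout i hi j hj)
    · intro hj
      by_contra hi
      exact hij (hin j hj i hi)
  have hu : u ∈ S := by simp [S, Relation.ReflTransGen.refl]
  have := hv.1 hu
  simp only [S, mem_filter, mem_univ, true_and] at this
  rcases Relation.reflTransGen_iff_eq_or_transGen.1 this with h | h
  · exact absurd h.symm huv
  · exact h

/-- A nonzero matrix has an index; conversely an index of degree at least one, which uses `1 ≤ w`,
excludes the zero matrix. -/
theorem mem_MF_iff {r p w : ℕ} (hw : 1 ≤ w) (F : Matrix (Fin r ⊕ Fin p) (Fin r ⊕ Fin p) ℕ) :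
    F ∈ MF r p w ↔ IsVac F ∧ (∀ k, w ≤ dias F (Sum.inl k)) ∧ ∀ k, dias F (Sum.inr k) = 1 := by
  constructor
  · rintro ⟨⟨h1, h2, h3⟩, h4, h5, h6⟩
    refine ⟨⟨h1, h2, (Balanced.cofactor_ne_zero_iff h2).1 h6, ?_⟩, h4, h5⟩
    by_contra hne
    rw [not_nonempty_iff] at hne
    exact h3 (Subsingleton.elim _ _)
  · rintro ⟨hF, h4, h5⟩
    refine ⟨⟨hF.diag, hF.bal, ?_⟩, h4, h5, (Balanced.cofactor_ne_zero_iff hF.bal).2 hF.conn⟩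
    rintro rfl
    obtain ⟨k | k⟩ := hF.ne
    · have := h4 k
      simp [dias] at this
      omega
    · have := h5 k
      simp [dias] at this

theorem IsVac.congr (v : V ≃ W) {F : Matrix V V ℕ} {F' : Matrix W W ℕ}
    (hF : ∀ i j, F' (v i) (v j) = F i j) (h : IsVac F) : IsVac F' := by
  refine ⟨fun i => ?_, fun k => ?_, ?_, h.ne.map v⟩
  · obtain ⟨i, rfl⟩ := v.surjective i
    rw [hF, h.diag]
  · obtain ⟨k, rfl⟩ := v.surjective k
    rw [← Equiv.sum_comp v, ← Equiv.sum_comp v]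
    simp only [hF, h.bal k]
  · exact (connRel_congr v fun i j => by rw [hF]).2 h.conn

theorem connMat_extMat (a b : V) (H : Matrix V V ℕ) :
    ConnMat (extMat a b H) ↔ ConnMat (addEdge a b H) := by
  refine connRel_option a ?_ ?_ ?_
  · intro i j hij
    by_cases h : i = a ∧ j = b
    · obtain ⟨rfl, rfl⟩ := h
      exact .trans _ none _ (.rel _ _ (by simp [extMat])) (.rel _ _ (by simp [extMat]))
    · exact .rel _ _ (by simpa [addEdge, extMat, h] using hij)
  · exact .rel _ _ (by simp [extMat])
  · rintro (_ | i) (_ | j) hij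
    · exact .refl _
    · by_cases h : j = b
      · exact .rel _ _ (by simp [addEdge, h])
      · simp [extMat, h] at hij
    · by_cases h : i = a
      · subst h; exact .refl _
      · simp [extMat, h] at hij
    · exact .rel _ _ (by simp only [extMat] at hij; simp [addEdge, hij])

theorem connMat_addEdge_self (a : V) (H : Matrix V V ℕ) :
    ConnMat (addEdge a a H) ↔ ConnMat H := by
  constructor
  · intro h u v
    refine eqvGen_map id (fun i j hij => ?_) (h u v)
    by_cases h : i = a ∧ j = a
    · obtain ⟨rfl, rfl⟩ := h; exact .refl _
    · exact .rel _ _ (by simpa [addEdge, h] using hij)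
  · intro h u v
    exact eqvGen_map id (fun i j hij => .rel _ _ (by simp [addEdge, hij])) (h u v)

theorem balanced_extMat (a b : V) (H : Matrix V V ℕ) :
    Balanced (extMat a b H) ↔ Balanced (addEdge a b H) := by
  have hr : ∀ k, ∑ i, addEdge a b H k i = ∑ i, H k i + if k = a then 1 else 0 :=
    dias_addEdge a b H
  have hc : ∀ k, ∑ i, addEdge a b H i k = ∑ i, H i k + if k = b then 1 else 0 := by
    intro k
    simp only [addEdge, sum_add_distrib]
    congr 1
    by_cases h : k = b <;> simp [h]
  unfold Balanced
  simp only [hr, hc]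
  constructor
  · intro h k
    have := h (some k)
    simp only [Fintype.sum_option, extMat] at this
    omega
  · rintro h (_ | k)
    · simp [Fintype.sum_option, extMat]
    · have := h k
      simp only [Fintype.sum_option, extMat]
      omega

theorem balanced_addEdge_self (a : V) (H : Matrix V V ℕ) :
    Balanced (addEdge a a H) ↔ Balanced H := by
  have hr : ∀ k, ∑ i, addEdge a a H k i = ∑ i, H k i + if k = a then 1 else 0 :=
    dias_addEdge a a H
  have hc : ∀ k, ∑ i, addEdge a a H i k = ∑ i, H i k + if k = a then 1 else 0 := by
    intro k
    simp only [addEdge, sum_add_distrib]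
    congr 1
    by_cases h : k = a <;> simp [h]
  unfold Balanced
  simp only [hr, hc, add_left_inj]

/-- For `a = b` the joined edge would be a loop on the diagonal; that case is treated in
`isVac_extMat_self`, where the loop is dropped without harm to balance or connectivity. -/
theorem isVac_extMat (a b : V) (hab : a ≠ b) (H : Matrix V V ℕ) :
    IsVac (extMat a b H) ↔ IsVac (addEdge a b H) := by
  have hd : ∀ i, addEdge a b H i i = H i i := by
    intro i
    simp only [addEdge, Nat.add_eq_left, ite_eq_right_iff]
    rintro ⟨rfl, h⟩
    exact absurd h hab
  constructor
  · intro h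
    exact ⟨fun i => by rw [hd]; exact h.diag (some i), (balanced_extMat a b H).1 h.bal,
      (connMat_extMat a b H).1 h.conn, ⟨a⟩⟩
  · intro h
    refine ⟨?_, (balanced_extMat a b H).2 h.bal, (connMat_extMat a b H).2 h.conn, ⟨none⟩⟩
    rintro (_ | i)
    · rfl
    · exact (hd i).symm.trans (h.diag i)

theorem isVac_extMat_self (a : V) (H : Matrix V V ℕ) : IsVac (extMat a a H) ↔ IsVac H := by
  constructor
  · intro h
    exact ⟨fun i => h.diag (some i),
      (balanced_addEdge_self a H).1 ((balanced_extMat a a H).1 h.bal),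
      (connMat_addEdge_self a H).1 ((connMat_extMat a a H).1 h.conn), ⟨a⟩⟩
  · intro h
    refine ⟨?_, (balanced_extMat a a H).2 ((balanced_addEdge_self a H).2 h.bal),
      (connMat_extMat a a H).2 ((connMat_addEdge_self a H).2 h.conn), ⟨none⟩⟩
    rintro (_ | i)
    · rfl
    · exact h.diag i

/-- A balanced matrix in which `none` has degree one arises by inserting `none`. -/
theorem exists_eq_extMat {F : Matrix (Option V) (Option V) ℕ} (h0 : F none none = 0)
    (hb : Balanced F) (hd : dias F none = 1) :
    ∃ a b, ∃ H : Matrix V V ℕ, F = extMat a b H := by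
  have key : ∀ f : V → ℕ, ∑ i, f i = 1 → ∃ a, ∀ i, f i = if i = a then 1 else 0 := by
    intro f hf
    have : ∃ a, f a ≠ 0 := by
      by_contra hc
      push Not at hc
      simp [hc] at hf
    obtain ⟨a, ha⟩ := this
    rw [← add_sum_erase _ _ (mem_univ a)] at hf
    have h1 : ∑ i ∈ univ.erase a, f i = 0 := by omega
    refine ⟨a, fun i => ?_⟩
    split_ifs with hi
    · subst hi; omega
    · exact sum_eq_zero_iff.1 h1 i (by simp [hi])
  obtain ⟨b, hb'⟩ := key (fun j => F none (some j)) (by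
    simpa [dias, Fintype.sum_option, h0] using hd)
  obtain ⟨a, ha'⟩ := key (fun j => F (some j) none) (by
    have := hb none
    rw [Fintype.sum_option, h0, zero_add] at this
    rw [this]; exact hd)
  refine ⟨a, b, fun i j => F (some i) (some j), ?_⟩
  ext (_ | i) (_ | j)
  · exact h0
  · exact hb' j
  · exact ha' i
  · rfl

end Matrices

/-! ### Graphs and their adjacency matrices -/

section Graphs

namespace Multidigraph

variable {V W E E' : Type} [Fintype V] [Fintype W] [DecidableEq V] [DecidableEq W]
  [Fintype E] [Fintype E'] [DecidableEq E] [DecidableEq E']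

theorem adj_ne_zero_iff (G : Multidigraph V E) (i j : V) :
    G.adj i j ≠ 0 ↔ ∃ e, G.st e = i ∧ G.en e = j := by
  unfold adj
  rw [← Nat.pos_iff_ne_zero, card_pos]
  simp [Finset.Nonempty]

theorem adj_ofMatrix (F : Matrix V V ℕ) : (ofMatrix F).adj = F := by
  ext i j
  rw [← card_slot_fiber (fun ij : V × V => F ij.1 ij.2) (i, j)]
  unfold adj
  congr 1
  ext e
  rw [mem_filter, mem_filter]
  simp [ofMatrix, Prod.ext_iff]

theorem sum_adj_row (G : Multidigraph V E) (i : V) : ∑ j, G.adj i j = G.outd i := by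
  unfold outd adj
  rw [card_eq_sum_card_fiberwise (f := G.en) (t := univ) (by simp)]
  simp only [filter_filter]

theorem sum_adj_col (G : Multidigraph V E) (j : V) : ∑ i, G.adj i j = G.ind j := by
  unfold ind adj
  rw [card_eq_sum_card_fiberwise (f := G.st) (t := univ) (by simp)]
  simp only [filter_filter, and_comm]

theorem connMat_adj (G : Multidigraph V E) :
    ConnMat G.adj ↔ ConnRel fun a b => ∃ e, G.st e = a ∧ G.en e = b := by
  unfold ConnMat
  simp only [adj_ne_zero_iff]

/-- Edges are slots over ordered pairs of vertices, and the adjacency matrix records the sizes of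
the fibres. -/
theorem exists_edge_equiv (G : Multidigraph V E) (H : Multidigraph W E') (v : V ≃ W)
    (h : ∀ i j, H.adj (v i) (v j) = G.adj i j) :
    ∃ c : E ≃ E', ∀ e, H.st (c e) = v (G.st e) ∧ H.en (c e) = v (G.en e) := by
  obtain ⟨c, hc⟩ := exists_slot_equiv (V := W × W) (fun e => (v (G.st e), v (G.en e)))
    (fun e => (H.st e, H.en e)) (by
      rintro ⟨i, j⟩
      obtain ⟨i, rfl⟩ := v.surjective i
      obtain ⟨j, rfl⟩ := v.surjective j
      simpa [adj] using (h i j).symm)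
  exact ⟨c, fun e => Prod.ext_iff.1 (hc e)⟩

end Multidigraph

open Multidigraph

/-- The directed connectivity of the graph and the cofactor condition on the matrix meet in weak
connectivity, by `Balanced.strong`. -/
theorem isGF_iff {r p w : ℕ} (hw : 1 ≤ w) (hrp : Nonempty (Fin r ⊕ Fin p)) (G : PGraph r p) :
    IsGF w G ↔ G.2.adj ∈ MF r p w := by
  have hloop : G.2.Loopfree ↔ ∀ i, G.2.adj i i = 0 := by
    constructor
    · intro h i
      by_contra hne
      obtain ⟨e, h1, h2⟩ := (adj_ne_zero_iff _ _ _).1 hne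
      exact h e (h1.trans h2.symm)
    · intro h e he
      exact (adj_ne_zero_iff _ _ _).2 ⟨e, rfl, he.symm⟩ (h _)
  have hbal : (∀ v, G.2.ind v = G.2.outd v) ↔ Balanced G.2.adj := by
    unfold Balanced
    simp only [sum_adj_row, sum_adj_col]
  rw [mem_MF_iff hw]
  constructor
  · rintro ⟨h1, h2, h3, h4, h5⟩
    refine ⟨⟨hloop.1 h1, hbal.1 h3, ?_, hrp⟩, fun k => ?_, fun k => ?_⟩
    · rw [connMat_adj]
      intro u v
      by_cases huv : u = v
      · subst huv; exact .refl _
      · have := h2 u v huv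
        clear huv
        induction this with
        | single h => exact .rel _ _ h
        | tail _ h ih => exact .trans _ _ _ ih (.rel _ _ h)
    · rw [dias, sum_adj_row, ← h3]; exact h4 k
    · rw [dias, sum_adj_row, ← h3]; exact h5 k
  · rintro ⟨h, h4, h5⟩
    have h3 := hbal.2 h.bal
    refine ⟨hloop.2 h.diag, fun u v huv => ?_, h3, fun k => ?_, fun k => ?_⟩
    · have := h.bal.strong h.conn u v huv
      simpa only [adj_ne_zero_iff] using this
    · rw [h3, ← sum_adj_row]; exact h4 k
    · rw [h3, ← sum_adj_row]; exact h5 k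

end Graphs

end PhiFour

end

noncomputable section

namespace PhiFour

open Equiv Finset

namespace Multidigraph

variable {V W E E' : Type}

/-! ### Spanning trees -/

section Trees

open Relation

/-- The edge relation of a set of edges. -/
def edgeRel (G : Multidigraph V E) (T : Finset E) (a b : V) : Prop :=
  ∃ e ∈ T, G.st e = a ∧ G.en e = b

theorem isSpanningTree_iff [Fintype V] (G : Multidigraph V E) (T : Finset E) :
    G.IsSpanningTree T ↔ ConnRel (G.edgeRel T) ∧ T.card + 1 = Fintype.card V := Iff.rfl

theorem edgeRel_reachable (G : Multidigraph V E) (T : Finset E) {u v : V}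
    (h : EqvGen (G.edgeRel T) u v) : (SimpleGraph.fromRel (G.edgeRel T)).Reachable u v := by
  induction h with
  | rel x y hxy =>
    by_cases hne : x = y
    · subst hne; exact SimpleGraph.Reachable.refl _
    · exact SimpleGraph.Adj.reachable ((SimpleGraph.fromRel_adj _ _ _).2 ⟨hne, Or.inl hxy⟩)
  | refl x => exact SimpleGraph.Reachable.refl _
  | symm x y _ ih => exact ih.symm
  | trans x y z _ _ ih1 ih2 => exact ih1.trans ih2

/-- Passing to the underlying simple graph only loses edges. The bound shows that no spanning tree
contains a loop. -/
theorem card_le_of_connRel [Fintype V] [Nonempty V] (G : Multidigraph V E) (T : Finset E)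
    (h : ConnRel (G.edgeRel T)) : Fintype.card V ≤ T.card + 1 := by
  classical
  have hc : (SimpleGraph.fromRel (G.edgeRel T)).Connected :=
    (SimpleGraph.connected_iff _).2 ⟨fun u v => edgeRel_reachable G T (h u v), inferInstance⟩
  have h1 := hc.card_vert_le_card_edgeSet_add_one
  rw [Nat.card_eq_fintype_card] at h1
  refine h1.trans (Nat.add_le_add_right ?_ 1)
  rw [← Set.ncard_coe_finset T]
  change (SimpleGraph.fromRel (G.edgeRel T)).edgeSet.ncard ≤ _
  refine (Set.ncard_le_ncard (t := (fun e => s(G.st e, G.en e)) '' (T : Set E)) ?_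
    (T.finite_toSet.image _)).trans (Set.ncard_image_le T.finite_toSet)
  intro x
  induction x with
  | h a b =>
    rw [SimpleGraph.mem_edgeSet, SimpleGraph.fromRel_adj]
    rintro ⟨-, ⟨e, he, rfl, rfl⟩ | ⟨e, he, rfl, rfl⟩⟩
    · exact ⟨e, he, rfl⟩
    · exact ⟨e, he, Sym2.eq_swap⟩

/-- The one-edge forest of `e` extends to a tree in the underlying simple graph, which is then
lifted edge by edge. It makes the parametric integrals converge at small `α_e`. -/
theorem exists_spanningTree_mem [Fintype V] [Fintype E] (G : Multidigraph V E)
    (hc : ConnRel (G.edgeRel univ)) (e : E) (he : G.st e ≠ G.en e) :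
    ∃ T, G.IsSpanningTree T ∧ e ∈ T := by
  classical
  have : Nonempty V := ⟨G.st e⟩
  have hS : (SimpleGraph.fromRel (G.edgeRel univ)).Connected :=
    (SimpleGraph.connected_iff _).2 ⟨fun u v => edgeRel_reachable G _ (hc u v), inferInstance⟩
  have hle : SimpleGraph.edge (G.st e) (G.en e) ≤ SimpleGraph.fromRel (G.edgeRel univ) := by
    rw [SimpleGraph.edge_le_iff]
    right
    exact (SimpleGraph.fromRel_adj _ _ _).2 ⟨he, Or.inl ⟨e, mem_univ _, rfl, rfl⟩⟩
  have hac : (SimpleGraph.edge (G.st e) (G.en e)).IsAcyclic := by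
    have := (SimpleGraph.isAcyclic_add_edge_iff_of_not_reachable (G := (⊥ : SimpleGraph V))
      (G.st e) (G.en e) (by simpa using he)).2 SimpleGraph.isAcyclic_bot
    simpa using this
  obtain ⟨T, hT1, hT2, hT⟩ := hS.exists_isTree_le_of_le_of_isAcyclic hle hac
  -- Among parallel edges the lift must be `e` itself over the vertex pair of `e`.
  have hch : ∀ x : Sym2 V, ∃ e', x ∈ T.edgeSet → s(G.st e', G.en e') = x ∧
      (x = s(G.st e, G.en e) → e' = e) := by
    intro x
    by_cases hx : x = s(G.st e, G.en e)
    · exact ⟨e, fun _ => ⟨hx.symm, fun _ => rfl⟩⟩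
    · induction x with
      | h a b =>
        by_cases hab : s(a, b) ∈ T.edgeSet
        · have h1 := hT2 ((SimpleGraph.mem_edgeSet T).1 hab)
          rw [SimpleGraph.fromRel_adj] at h1
          obtain ⟨-, ⟨e', -, rfl, rfl⟩ | ⟨e', -, rfl, rfl⟩⟩ := h1
          · exact ⟨e', fun _ => ⟨rfl, fun h => absurd h hx⟩⟩
          · exact ⟨e', fun _ => ⟨Sym2.eq_swap, fun h => absurd h hx⟩⟩
        · exact ⟨e, fun h => absurd h hab⟩
  choose g hg using hch
  refine ⟨T.edgeFinset.image g, ⟨?_, ?_⟩, ?_⟩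
  · intro u v
    obtain ⟨w⟩ := hT.connected.preconnected u v
    induction w with
    | nil => exact .refl _
    | @cons a b c hab _ ih =>
      refine .trans _ _ _ ?_ ih
      have hm : s(a, b) ∈ T.edgeSet := (SimpleGraph.mem_edgeSet T).2 hab
      have h1 := (hg _ hm).1
      have h2 : g s(a, b) ∈ T.edgeFinset.image g :=
        mem_image_of_mem _ (SimpleGraph.mem_edgeFinset.2 hm)
      rw [Sym2.eq_iff] at h1
      rcases h1 with ⟨h3, h4⟩ | ⟨h3, h4⟩
      · exact .rel _ _ ⟨_, h2, h3, h4⟩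
      · exact .symm _ _ (.rel _ _ ⟨_, h2, h3, h4⟩)
  · rw [card_image_of_injOn, hT.card_edgeFinset]
    intro x hx y hy hxy
    rw [← (hg x (by simpa using hx)).1, ← (hg y (by simpa using hy)).1, hxy]
  · have hm : s(G.st e, G.en e) ∈ T.edgeSet := by
      rw [SimpleGraph.mem_edgeSet]
      exact hT1 (by simpa [SimpleGraph.edge_adj] using he)
    rw [mem_image]
    exact ⟨_, SimpleGraph.mem_edgeFinset.2 hm, (hg _ hm).2 rfl⟩

end Trees

/-! ### The Kirchhoff polynomial under insertions -/

section Kirchhoff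

variable [Fintype V] [Fintype W] [Fintype E] [Fintype E']

-- Summing over all edge sets, with conditional terms and factors, allows the edge `none` to be
-- split off.
open Classical in
theorem kirchhoff_eq (G : Multidigraph V E) (α : E → ℝ) :
    G.kirchhoff α = ∑ T : Finset E, if G.IsSpanningTree T then
      ∏ e, (if e ∈ T then 1 else α e) else 0 := by
  unfold kirchhoff
  rw [sum_filter]
  refine sum_congr rfl fun T _ => ?_
  split_ifs with h
  · rw [prod_filter]
    refine prod_congr rfl fun e _ => ?_
    by_cases h' : e ∈ T <;> simp [h']
  · rfl

theorem kirchhoff_congr (G : Multidigraph V E) (H : Multidigraph W E') (v : V ≃ W) (c : E ≃ E')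
    (h : ∀ e, H.st (c e) = v (G.st e) ∧ H.en (c e) = v (G.en e)) (α : E' → ℝ) :
    H.kirchhoff α = G.kirchhoff (α ∘ c) := by
  classical
  rw [kirchhoff_eq, kirchhoff_eq, ← Equiv.sum_comp c.finsetCongr]
  refine sum_congr rfl fun T _ => ?_
  have h1 : H.IsSpanningTree (c.finsetCongr T) ↔ G.IsSpanningTree T := by
    rw [isSpanningTree_iff, isSpanningTree_iff, Equiv.finsetCongr_apply, card_map,
      Fintype.card_congr v]
    refine and_congr_left fun _ => connRel_congr v fun i j => ?_
    unfold edgeRel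
    simp only [mem_map, Equiv.coe_toEmbedding]
    constructor
    · rintro ⟨_, ⟨e, he, rfl⟩, h2, h3⟩
      rw [(h e).1] at h2
      rw [(h e).2] at h3
      exact ⟨e, he, v.injective h2, v.injective h3⟩
    · rintro ⟨e, he, rfl, rfl⟩
      exact ⟨c e, ⟨e, he, rfl⟩, (h e).1, (h e).2⟩
  refine if_congr h1 ?_ rfl
  rw [← Equiv.prod_comp c]
  simp [Equiv.finsetCongr_apply]

/-- Subsets of `Option E` are subsets of `E` with or without `none`. -/
def finsetOptionEquiv (E : Type) [DecidableEq E] : Finset E ⊕ Finset E ≃ Finset (Option E) where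
  toFun := Sum.elim (fun S => S.map .some) (fun S => insertNone S)
  invFun T := if none ∈ T then Sum.inr (eraseNone T) else Sum.inl (eraseNone T)
  left_inv := by
    rintro (S | S) <;> simp
  right_inv T := by
    by_cases h : none ∈ T
    · ext (_ | x) <;> simp [h]
    · ext (_ | x) <;> simp [h]

theorem sum_finset_option [DecidableEq E] (f : Finset (Option E) → ℝ) :
    ∑ T, f T = ∑ S : Finset E, (f (S.map .some) + f (insertNone S)) := by
  rw [← Equiv.sum_comp (finsetOptionEquiv E), Fintype.sum_sum_type, sum_add_distrib]
  rfl

theorem not_connRel_of_none (G : Multidigraph (Option V) E) (T : Finset E) (a : V)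
    (h : ∀ e ∈ T, G.st e ≠ none ∧ G.en e ≠ none) : ¬ ConnRel (G.edgeRel T) := by
  intro hc
  have := eqvGen_imp (p := fun x : Option V => x = none) (fun i j hij => ?_) (hc none (some a))
  · simp at this
  · obtain ⟨e, he, rfl, rfl⟩ := hij
    simp [h e he]

/-- An edge to a new vertex does not change the polynomial. -/
theorem kirchhoff_pendant (G : Multidigraph V E) (H : Multidigraph (Option V) (Option E)) (a : V)
    (hs : ∀ e, H.st (some e) = some (G.st e)) (he : ∀ e, H.en (some e) = some (G.en e))
    (h0 : H.st none = some a ∧ H.en none = none ∨ H.st none = none ∧ H.en none = some a)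
    (α : Option E → ℝ) : H.kirchhoff α = G.kirchhoff (α ∘ some) := by
  classical
  rw [kirchhoff_eq, kirchhoff_eq, sum_finset_option]
  refine sum_congr rfl fun S _ => ?_
  -- A set without the new edge leaves the vertex `none` isolated, so it contains no spanning tree.
  rw [if_neg, zero_add]
  · have h1 : H.IsSpanningTree (insertNone S) ↔ G.IsSpanningTree S := by
      rw [isSpanningTree_iff, isSpanningTree_iff, card_insertNone, Fintype.card_option,
        Nat.add_right_cancel_iff]
      refine and_congr_left fun _ => connRel_option a ?_ ?_ ?_
      · rintro _ _ ⟨e, he', rfl, rfl⟩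
        exact .rel _ _ ⟨some e, by simpa using he', hs e, he e⟩
      · rcases h0 with ⟨h1, h2⟩ | ⟨h1, h2⟩
        · exact .rel _ _ ⟨none, by simp, h1, h2⟩
        · exact .symm _ _ (.rel _ _ ⟨none, by simp, h1, h2⟩)
      · rintro _ _ ⟨_ | e, he', rfl, rfl⟩
        · rcases h0 with ⟨h1, h2⟩ | ⟨h1, h2⟩ <;> rw [h1, h2] <;> exact .refl _
        · rw [hs, he]
          exact .rel _ _ ⟨e, by simpa using he', rfl, rfl⟩
    refine if_congr h1 ?_ rfl
    rw [Fintype.prod_option]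
    simp
  · rintro ⟨hc, -⟩
    refine not_connRel_of_none H _ a (fun e he' => ?_) hc
    simp only [mem_map, Function.Embedding.some_apply] at he'
    obtain ⟨e, -, rfl⟩ := he'
    simp [hs, he]

/-- The graph in which the edge `none` is subdivided by a new vertex. -/
def subdiv (G : Multidigraph V (Option E)) : Multidigraph (Option V) (Option (Option E)) where
  st e := e.elim none fun e => some (G.st e)
  en e := e.elim (some (G.en none)) fun e => e.elim none fun e => some (G.en (some e))

/-- The series law. A spanning tree contains at least one half of the subdivided edge. Both halves
correspond to a tree through the old edge, and one half to a tree avoiding it; there the absent half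
supplies the factor, so the two parameters add. -/
theorem kirchhoff_subdiv (G : Multidigraph V (Option E)) (α : Option (Option E) → ℝ) :
    G.subdiv.kirchhoff α =
      G.kirchhoff (fun e => e.elim (α none + α (some none)) fun e => α (some (some e))) := by
  classical
  rw [kirchhoff_eq, kirchhoff_eq, sum_finset_option, sum_finset_option, sum_finset_option]
  refine sum_congr rfl fun S _ => ?_
  have t0 : ¬ G.subdiv.IsSpanningTree ((S.map .some).map .some) := by
    rintro ⟨hc, -⟩
    refine not_connRel_of_none _ _ (G.st none) (fun e he' => ?_) hc
    simp only [mem_map, Function.Embedding.some_apply] at he'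
    obtain ⟨_, ⟨e, -, rfl⟩, rfl⟩ := he'
    simp [subdiv]
  have t1 : G.subdiv.IsSpanningTree (insertNone (S.map .some)) ↔
      G.IsSpanningTree (S.map .some) := by
    rw [isSpanningTree_iff, isSpanningTree_iff, card_insertNone, Fintype.card_option,
      Nat.add_right_cancel_iff]
    refine and_congr_left fun _ => connRel_option (G.en none) ?_ ?_ ?_
    · rintro _ _ ⟨_ | e, he', rfl, rfl⟩
      · simp at he'
      · exact .rel _ _ ⟨some (some e), by simpa using he', rfl, rfl⟩
    · exact .symm _ _ (.rel _ _ ⟨none, by simp, rfl, rfl⟩)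
    · rintro _ _ ⟨_ | _ | e, he', rfl, rfl⟩
      · exact .refl _
      · simp at he'
      · exact .rel _ _ ⟨some e, by simpa using he', rfl, rfl⟩
  have t2 : G.subdiv.IsSpanningTree ((insertNone S).map .some) ↔
      G.IsSpanningTree (S.map .some) := by
    rw [isSpanningTree_iff, isSpanningTree_iff, card_map, card_insertNone, Fintype.card_option,
      Nat.add_right_cancel_iff, card_map]
    refine and_congr_left fun _ => connRel_option (G.st none) ?_ ?_ ?_
    · rintro _ _ ⟨_ | e, he', rfl, rfl⟩
      · simp at he'
      · exact .rel _ _ ⟨some (some e), by simpa using he', rfl, rfl⟩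
    · exact .rel _ _ ⟨some none, by simp, rfl, rfl⟩
    · rintro _ _ ⟨_ | _ | e, he', rfl, rfl⟩
      · simp at he'
      · exact .refl _
      · exact .rel _ _ ⟨some e, by simpa using he', rfl, rfl⟩
  have t3 : G.subdiv.IsSpanningTree (insertNone (insertNone S)) ↔
      G.IsSpanningTree (insertNone S) := by
    rw [isSpanningTree_iff, isSpanningTree_iff, card_insertNone, Fintype.card_option,
      Nat.add_right_cancel_iff]
    refine and_congr_left fun _ => connRel_option (G.st none) ?_ ?_ ?_
    · rintro _ _ ⟨_ | e, he', rfl, rfl⟩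
      · exact .trans _ none _ (.rel _ _ ⟨some none, by simp, rfl, rfl⟩)
          (.rel _ _ ⟨none, by simp, rfl, rfl⟩)
      · exact .rel _ _ ⟨some (some e), by simpa using he', rfl, rfl⟩
    · exact .rel _ _ ⟨some none, by simp, rfl, rfl⟩
    · rintro _ _ ⟨_ | _ | e, he', rfl, rfl⟩
      · exact .rel _ _ ⟨none, by simp, rfl, rfl⟩
      · exact .refl _
      · exact .rel _ _ ⟨some e, by simpa using he', rfl, rfl⟩
  simp only [t0, t1, t2, t3, Fintype.prod_option]
  by_cases h1 : G.IsSpanningTree (S.map .some) <;> by_cases h2 : G.IsSpanningTree (insertNone S) <;>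
    simp [h1, h2] <;> ring

/-- An edge that starts and ends at the same vertex is in no spanning tree. -/
theorem kirchhoff_loop (G : Multidigraph V (Option E)) (h : G.st none = G.en none)
    (α : Option E → ℝ) : G.kirchhoff α = α none *
      (⟨G.st ∘ some, G.en ∘ some⟩ : Multidigraph V E).kirchhoff (α ∘ some) := by
  classical
  set H : Multidigraph V E := ⟨G.st ∘ some, G.en ∘ some⟩ with hH
  have : Nonempty V := ⟨G.st none⟩
  rw [kirchhoff_eq, kirchhoff_eq, sum_finset_option, mul_sum]
  refine sum_congr rfl fun S _ => ?_
  have h1 : G.IsSpanningTree (S.map .some) ↔ H.IsSpanningTree S := by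
    rw [isSpanningTree_iff, isSpanningTree_iff, card_map]
    refine and_congr_left fun _ => connRel_congr (Equiv.refl V) fun i j => ?_
    unfold edgeRel
    simp [H]
  -- Without the loop the remaining edges would still connect all vertices, with one edge too few.
  have h2 : ¬ G.IsSpanningTree (insertNone S) := by
    rw [isSpanningTree_iff, card_insertNone]
    rintro ⟨hc, hcard⟩
    have h3 : ConnRel (H.edgeRel S) := by
      intro u v
      refine eqvGen_map id ?_ (hc u v)
      rintro _ _ ⟨_ | e, he, rfl, rfl⟩
      · rw [h]; exact .refl _
      · exact .rel _ _ ⟨e, by simpa using he, rfl, rfl⟩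
    have := H.card_le_of_connRel S h3
    omega
  rw [if_neg h2, add_zero, mul_ite, mul_zero]
  refine if_congr h1 ?_ rfl
  rw [Fintype.prod_option]
  simp

end Kirchhoff

end Multidigraph

end PhiFour

end

/-! ### The parametric integrals -/

noncomputable section

namespace PhiFour

open Finset MeasureTheory

/-- Lebesgue measure on the positive half line. -/
abbrev halfLine : Measure ℝ := volume.restrict (Set.Ioi 0)

/-- Lebesgue measure on the positive orthant. -/
abbrev orthant (E : Type) [Fintype E] : Measure (E → ℝ) := Measure.pi fun _ => halfLine

theorem ae_orthant_pos (E : Type) [Fintype E] : ∀ᵐ α ∂orthant E, ∀ e, 0 < α e := by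
  have : orthant E = (volume : Measure (E → ℝ)).restrict (Set.univ.pi fun _ => Set.Ioi 0) := by
    rw [volume_pi, Measure.restrict_pi_pi]
  rw [this]
  filter_upwards [ae_restrict_mem (MeasurableSet.univ_pi fun _ => measurableSet_Ioi)] with α hα e
  exact hα e (Set.mem_univ e)

/-- Adjoining the value `x` at `none`. -/
def optCons {E : Type} (x : ℝ) (α : E → ℝ) : Option E → ℝ := fun o => o.elim x α

theorem integral_orthant_option {E : Type} [Fintype E] (f : (Option E → ℝ) → ℂ) :
    ∫ α, f α ∂orthant (Option E) =
      ∫ z, f (optCons z.2 z.1) ∂((orthant E).prod halfLine) := by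
  have h := Measure.pi_map_piOptionEquivProd (ι := E) (β := fun _ => ℝ) fun _ => halfLine
  have e : ∀ z : (E → ℝ) × ℝ, (MeasurableEquiv.piOptionEquivProd fun _ : Option E => ℝ).symm z =
      optCons z.2 z.1 := by
    intro z
    ext (_ | x) <;> rfl
  change ∫ α, f α ∂(Measure.pi fun _ => halfLine) = _
  rw [← h, integral_map_equiv]
  simp only [e]

theorem measurable_optCons {E : Type} :
    Measurable fun z : (E → ℝ) × ℝ => optCons z.2 z.1 := by
  refine measurable_pi_lambda _ ?_
  rintro (_ | x)
  · exact measurable_snd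
  · exact (measurable_pi_apply x).comp measurable_fst

/-- The sum of two independent points of the half line has density `x`. -/
theorem map_add_halfLine :
    (halfLine.prod halfLine).map (fun p => p.1 + p.2) =
      halfLine.withDensity fun x => ENNReal.ofReal x := by
  ext s hs
  have hadd : Measurable fun p : ℝ × ℝ => p.1 + p.2 := measurable_fst.add measurable_snd
  rw [Measure.map_apply hadd hs, withDensity_apply _ hs, Measure.prod_apply (hadd hs)]
  have h1 : ∀ x : ℝ, halfLine (Prod.mk x ⁻¹' ((fun p : ℝ × ℝ => p.1 + p.2) ⁻¹' s)) =
      ∫⁻ t, s.indicator 1 t * (Set.Ioi 0).indicator 1 (t - x) := by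
    intro x
    have hm : MeasurableSet (Prod.mk x ⁻¹' ((fun p : ℝ × ℝ => p.1 + p.2) ⁻¹' s)) :=
      measurable_prodMk_left (hadd hs)
    rw [← lintegral_add_left_eq_self _ x, ← lintegral_indicator_one hm,
      ← lintegral_indicator measurableSet_Ioi]
    refine lintegral_congr fun y => ?_
    by_cases h1 : x + y ∈ s <;> by_cases h2 : 0 < y <;> simp [Set.indicator, h1, h2]
  simp only [h1]
  rw [← lintegral_indicator measurableSet_Ioi]
  have h2 : ∀ x : ℝ, (Set.Ioi (0 : ℝ)).indicator (fun x => ∫⁻ t, s.indicator (1 : ℝ → ENNReal) t *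
      (Set.Ioi (0 : ℝ)).indicator 1 (t - x)) x = ∫⁻ t, s.indicator 1 t *
      (Set.Ioo 0 t).indicator 1 x := by
    intro x
    by_cases hx : 0 < x
    · rw [Set.indicator_of_mem (show x ∈ Set.Ioi (0 : ℝ) from hx)]
      refine lintegral_congr fun t => ?_
      by_cases h : x < t <;> simp [Set.indicator, h, hx]
    · rw [Set.indicator_of_notMem (show x ∉ Set.Ioi (0 : ℝ) from hx)]
      simp [Set.indicator, hx]
  simp only [h2]
  -- For a fixed sum `t` the first point ranges over `(0, t)`, an interval of length `t`.
  rw [lintegral_lintegral_swap]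
  · have h3 : ∀ t : ℝ, ∫⁻ x, s.indicator (1 : ℝ → ENNReal) t * (Set.Ioo 0 t).indicator 1 x =
        s.indicator (fun x => ENNReal.ofReal x) t := by
      intro t
      rw [lintegral_const_mul _ (measurable_one.indicator measurableSet_Ioo),
        lintegral_indicator_one measurableSet_Ioo, Real.volume_Ioo, sub_zero]
      by_cases h : t ∈ s <;> simp [h]
    simp only [h3]
    rw [lintegral_indicator hs, Measure.restrict_restrict hs, Set.inter_comm,
      ← Measure.restrict_restrict measurableSet_Ioi, ← lintegral_indicator measurableSet_Ioi]
    refine lintegral_congr fun t => ?_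
    by_cases h : 0 < t
    · rw [Set.indicator_of_mem (show t ∈ Set.Ioi 0 from h)]
    · rw [Set.indicator_of_notMem (show t ∉ Set.Ioi 0 from h),
        ENNReal.ofReal_of_nonpos (not_lt.1 h)]
  · refine Measurable.aemeasurable ?_
    refine ((measurable_one.indicator hs).comp measurable_snd).mul ?_
    have : MeasurableSet {p : ℝ × ℝ | 0 < p.1 ∧ p.1 < p.2} :=
      (measurableSet_lt measurable_const measurable_fst).inter
        (measurableSet_lt measurable_fst measurable_snd)
    exact (measurable_one (α := ENNReal)).indicator this

namespace Multidigraph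

variable {V W E E' : Type} [Fintype V] [Fintype W] [Fintype E] [Fintype E']

theorem continuous_kirchhoff (G : Multidigraph V E) : Continuous G.kirchhoff := by
  unfold kirchhoff
  fun_prop

/-- The integrand of `gammaFun`. -/
def gammaInt (G : Multidigraph V E) (n : ℂ) (α : E → ℝ) : ℂ :=
  Complex.exp (-(∑ e, (α e : ℂ))) * ((G.kirchhoff α : ℝ) : ℂ) ^ (n - 1)

theorem measurable_gammaInt (G : Multidigraph V E) (n : ℂ) : Measurable (G.gammaInt n) := by
  unfold gammaInt
  have := G.continuous_kirchhoff.measurable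
  refine Measurable.mul ?_ ?_
  · fun_prop
  · exact (Complex.measurable_ofReal.comp this).pow_const _

theorem gammaFun_eq (G : Multidigraph V E) (n : ℂ) :
    G.gammaFun n = ∫ α, G.gammaInt n α ∂orthant E := by
  unfold gammaFun orthant
  rw [volume_pi, Measure.restrict_pi_pi]
  rfl

theorem gammaFun_congr (G : Multidigraph V E) (H : Multidigraph W E') (v : V ≃ W) (c : E ≃ E')
    (h : ∀ e, H.st (c e) = v (G.st e) ∧ H.en (c e) = v (G.en e)) (n : ℂ) :
    H.gammaFun n = G.gammaFun n := by
  rw [gammaFun_eq, gammaFun_eq]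
  have hp := measurePreserving_piCongrLeft (fun _ : E' => halfLine) c
  rw [← hp.integral_comp (MeasurableEquiv.measurableEmbedding _)]
  refine integral_congr_ae (Filter.Eventually.of_forall fun α => ?_)
  have e1 : ∀ e, (MeasurableEquiv.piCongrLeft (fun _ : E' => ℝ) c) α (c e) = α e := fun e =>
    Equiv.piCongrLeft_apply_apply (fun _ : E' => ℝ) c α e
  unfold gammaInt
  dsimp only
  rw [kirchhoff_congr G H v c h, ← Equiv.sum_comp c]
  simp only [e1, Function.comp_def]

theorem gammaInt_optCons (G : Multidigraph V (Option E)) (n : ℂ) (x : ℝ) (α : E → ℝ) :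
    G.gammaInt n (optCons x α) = Complex.exp (-x) * (Complex.exp (-∑ e, (α e : ℂ)) *
      ((G.kirchhoff (optCons x α) : ℝ) : ℂ) ^ (n - 1)) := by
  unfold gammaInt
  rw [Fintype.sum_option, neg_add, Complex.exp_add, mul_assoc]
  rfl

/-- The polynomial does not involve the new parameter, whose integral of `exp (-x)` is one. -/
theorem gammaFun_pendant (G : Multidigraph V E) (H : Multidigraph (Option V) (Option E)) (a : V)
    (hs : ∀ e, H.st (some e) = some (G.st e)) (he : ∀ e, H.en (some e) = some (G.en e))
    (h0 : H.st none = some a ∧ H.en none = none ∨ H.st none = none ∧ H.en none = some a)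
    (n : ℂ) : H.gammaFun n = G.gammaFun n := by
  rw [gammaFun_eq, gammaFun_eq, integral_orthant_option]
  simp only [gammaInt_optCons, kirchhoff_pendant G H a hs he h0]
  have : ∫ z : (E → ℝ) × ℝ, Complex.exp (-(z.2 : ℂ)) * (Complex.exp (-∑ e, (z.1 e : ℂ)) *
      ((G.kirchhoff (optCons z.2 z.1 ∘ some) : ℝ) : ℂ) ^ (n - 1)) ∂((orthant E).prod halfLine) =
      ∫ z : (E → ℝ) × ℝ, G.gammaInt n z.1 * Complex.exp (-(z.2 : ℂ))
        ∂((orthant E).prod halfLine) := by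
    refine integral_congr_ae (Filter.Eventually.of_forall fun z => ?_)
    exact mul_comm _ _
  rw [this, integral_prod_mul (G.gammaInt n) fun x : ℝ => Complex.exp (-(x : ℂ))]
  have h1 : ∫ x, Complex.exp (-(x : ℂ)) ∂halfLine = 1 := by
    have := Complex.Gamma_eq_integral (s := 1) (by simp)
    rw [Complex.Gamma_one, Complex.GammaIntegral] at this
    rw [this]
    refine setIntegral_congr_fun measurableSet_Ioi fun x hx => ?_
    simp
  rw [h1, mul_one]

/-- Subdividing the edge `none` amounts to an additional factor `α none`. -/
theorem gammaFun_subdiv (G : Multidigraph V (Option E)) (n : ℂ) :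
    G.subdiv.gammaFun n = ∫ α, (α none : ℂ) * G.gammaInt n α ∂orthant (Option E) := by
  -- The integrand sees the two halves only through their sum, so `map_add_halfLine` turns the
  -- double integral over them into a single one with density `x`.
  have e1 : ∀ z : ((Option E → ℝ) × ℝ), G.subdiv.gammaInt n (optCons z.2 z.1) =
      G.gammaInt n (optCons (z.2 + z.1 none) (z.1 ∘ some)) := by
    intro z
    unfold gammaInt
    rw [kirchhoff_subdiv, Fintype.sum_option, Fintype.sum_option, Fintype.sum_option, ← add_assoc]
    simp only [optCons, Option.elim_none, Option.elim_some, Function.comp_apply,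
      Complex.ofReal_add]
    rfl
  have hm2 : Measurable fun z : (E → ℝ) × ℝ => G.gammaInt n (optCons z.2 z.1) :=
    (G.measurable_gammaInt n).comp measurable_optCons
  rw [gammaFun_eq, integral_orthant_option, integral_orthant_option]
  have hA : ∫ z : (Option E → ℝ) × ℝ, G.subdiv.gammaInt n (optCons z.2 z.1)
      ∂((orthant (Option E)).prod halfLine) =
      ∫ z : (((E → ℝ) × ℝ) × ℝ), G.gammaInt n (optCons (z.1.2 + z.2) z.1.1)
        ∂(((orthant E).prod halfLine).prod halfLine) := by
    have h := Measure.pi_map_piOptionEquivProd (ι := E) (β := fun _ => ℝ) fun _ => halfLine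
    have hmp : MeasurePreserving (MeasurableEquiv.piOptionEquivProd fun _ : Option E => ℝ).symm
        ((orthant E).prod halfLine) (orthant (Option E)) :=
      ⟨(MeasurableEquiv.piOptionEquivProd fun _ : Option E => ℝ).symm.measurable, h⟩
    have hmp2 := hmp.prod (MeasurePreserving.id halfLine)
    rw [← hmp2.integral_comp]
    · refine integral_congr_ae (Filter.Eventually.of_forall fun z => ?_)
      dsimp only
      rw [e1, add_comm]
      rfl
    · exact ((MeasurableEquiv.piOptionEquivProd fun _ : Option E => ℝ).symm.prodCongr
        (MeasurableEquiv.refl ℝ)).measurableEmbedding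
  rw [hA]
  have hB := (measurePreserving_prodAssoc (orthant E) halfLine halfLine).integral_comp
    (MeasurableEquiv.measurableEmbedding _)
    (fun z : (E → ℝ) × (ℝ × ℝ) => G.gammaInt n (optCons (z.2.1 + z.2.2) z.1))
  refine Eq.trans hB ?_
  have hadd : Measurable fun p : ℝ × ℝ => p.1 + p.2 := measurable_fst.add measurable_snd
  have hC : (orthant E).prod (halfLine.withDensity fun x => ENNReal.ofReal x) =
      ((orthant E).prod (halfLine.prod halfLine)).map
        (Prod.map id fun p : ℝ × ℝ => p.1 + p.2) := by
    rw [← Measure.map_prod_map _ _ measurable_id hadd, Measure.map_id, map_add_halfLine]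
  have hD : ∫ z : (E → ℝ) × (ℝ × ℝ), G.gammaInt n (optCons (z.2.1 + z.2.2) z.1)
      ∂((orthant E).prod (halfLine.prod halfLine)) =
      ∫ z, G.gammaInt n (optCons z.2 z.1)
        ∂((orthant E).prod (halfLine.withDensity fun x => ENNReal.ofReal x)) := by
    rw [hC, integral_map (measurable_id.prodMap hadd).aemeasurable hm2.aestronglyMeasurable]
    rfl
  have hm3 : Measurable fun z : (E → ℝ) × ℝ => ENNReal.ofReal z.2 :=
    ENNReal.measurable_ofReal.comp measurable_snd
  rw [hD, prod_withDensity_right ENNReal.measurable_ofReal,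
    integral_withDensity_eq_integral_toReal_smul hm3 (by simp)]
  refine integral_congr_ae ?_
  have hpos : ∀ᵐ z ∂((orthant E).prod halfLine), 0 < z.2 :=
    Measure.quasiMeasurePreserving_snd.ae (ae_restrict_mem measurableSet_Ioi)
  filter_upwards [hpos] with z hz
  rw [ENNReal.toReal_ofReal hz.le]
  rfl

/-- A bubble contributes a factor `Γ(n + 1)`. -/
theorem gammaFun_subdiv_loop (G : Multidigraph V (Option E)) (h : G.st none = G.en none) (n : ℂ)
    (hn : 0 ≤ n.re) : G.subdiv.gammaFun n = Complex.Gamma (n + 1) *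
      (⟨G.st ∘ some, G.en ∘ some⟩ : Multidigraph V E).gammaFun n := by
  set H : Multidigraph V E := ⟨G.st ∘ some, G.en ∘ some⟩ with hH
  rw [gammaFun_subdiv, integral_orthant_option, gammaFun_eq]
  have hG : Complex.Gamma (n + 1) = ∫ x : ℝ, Complex.exp (-(x : ℂ)) * (x : ℂ) ^ n ∂halfLine := by
    rw [Complex.Gamma_eq_integral (by simp; linarith), Complex.GammaIntegral]
    refine setIntegral_congr_fun measurableSet_Ioi fun x hx => ?_
    simp
  rw [hG, mul_comm, ← integral_prod_mul]
  refine integral_congr_ae ?_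
  have hpos : ∀ᵐ z ∂((orthant E).prod halfLine), 0 < z.2 :=
    Measure.quasiMeasurePreserving_snd.ae (ae_restrict_mem measurableSet_Ioi)
  have hpos' : ∀ᵐ z ∂((orthant E).prod halfLine), ∀ e, 0 < z.1 e :=
    Measure.quasiMeasurePreserving_fst.ae (ae_orthant_pos E)
  filter_upwards [hpos, hpos'] with z hz hz'
  have hP : 0 ≤ H.kirchhoff z.1 := by
    unfold kirchhoff
    exact sum_nonneg fun T _ => prod_nonneg fun e _ => (hz' e).le
  have hz0 : (z.2 : ℂ) ≠ 0 := by exact_mod_cast hz.ne'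
  rw [gammaInt_optCons, kirchhoff_loop G h]
  have e1 : optCons z.2 z.1 none = z.2 := rfl
  have e2 : optCons z.2 z.1 ∘ some = z.1 := rfl
  rw [e1, e2, Complex.ofReal_mul, Complex.mul_cpow_ofReal_nonneg hz.le hP]
  -- One factor comes from the subdivision, and the power `n - 1` from the loop parameter that
  -- factors out of the polynomial.
  have e3 : (z.2 : ℂ) ^ n = z.2 * (z.2 : ℂ) ^ (n - 1) := by
    rw [Complex.cpow_sub _ _ hz0, Complex.cpow_one]
    field_simp
  rw [e3]
  unfold gammaInt
  ring

end Multidigraph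

end PhiFour

end

/-! ### Convergence and homogeneity -/

noncomputable section

namespace PhiFour

open Finset MeasureTheory
open scoped Pointwise

namespace Multidigraph

variable {V E : Type} [Fintype V] [Fintype E]

/-- Each monomial omits a tree and so has as many factors as there are loops. Without spanning trees
both sides vanish, whatever the truncated exponent is. -/
theorem kirchhoff_smul (G : Multidigraph V E) (t : ℝ) (α : E → ℝ) :
    G.kirchhoff (t • α) = t ^ (Fintype.card E + 1 - Fintype.card V) * G.kirchhoff α := by
  classical
  unfold kirchhoff
  rw [mul_sum]
  refine sum_congr rfl fun T hT => ?_
  simp only [mem_filter, mem_univ, true_and] at hT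
  simp only [Pi.smul_apply, smul_eq_mul]
  rw [prod_mul_distrib, prod_const]
  congr 2
  have h1 : (univ.filter fun e => e ∉ T).card = Fintype.card E - T.card := by
    rw [← card_compl]
    congr 1
    ext e; simp
  have h2 := hT.2
  rw [h1]
  omega

theorem loops_eq (G : Multidigraph V E) {T : Finset E} (hT : G.IsSpanningTree T) :
    G.loops = ((Fintype.card E + 1 - Fintype.card V : ℕ) : ℤ) := by
  have h1 := hT.2
  have h2 := card_le_univ T
  unfold loops
  omega

theorem kirchhoff_pos (G : Multidigraph V E) {T : Finset E} (hT : G.IsSpanningTree T) (α : E → ℝ)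
    (hα : ∀ e, 0 < α e) : 0 < G.kirchhoff α := by
  classical
  unfold kirchhoff
  exact sum_pos (fun T _ => prod_pos fun e _ => hα e) ⟨T, by simpa using hT⟩

open Classical in
/-- The finite set of spanning trees. -/
def trees (G : Multidigraph V E) : Finset (Finset E) :=
  univ.filter fun T => G.IsSpanningTree T

-- The polynomial dominates each of its monomials; the inequalities are multiplied over all spanning
-- trees. The exponent of `α e` then counts the trees avoiding `e`.
open Classical in
theorem kirchhoff_lower (G : Multidigraph V E) (α : E → ℝ) (hα : ∀ e, 0 < α e) :
    ∏ e, α e ^ (G.trees.filter fun T => e ∉ T).card ≤ G.kirchhoff α ^ G.trees.card := by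
  have h1 : ∀ T ∈ G.trees, ∏ e ∈ univ.filter (fun e => e ∉ T), α e ≤ G.kirchhoff α := by
    intro T hT
    unfold kirchhoff
    exact single_le_sum (f := fun T => ∏ e ∈ univ.filter (fun e => e ∉ T), α e)
      (fun T _ => prod_nonneg fun e _ => (hα e).le) hT
  refine le_trans (le_of_eq ?_) (prod_le_pow_card' G α hα h1)
  simp only [prod_filter]
  rw [prod_comm]
  refine prod_congr rfl fun e _ => ?_
  rw [← prod_filter, prod_const]
where
  prod_le_pow_card' (G : Multidigraph V E) (α : E → ℝ) (hα : ∀ e, 0 < α e)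
      (h1 : ∀ T ∈ G.trees, ∏ e ∈ univ.filter (fun e => e ∉ T), α e ≤ G.kirchhoff α) :
      ∏ T ∈ G.trees, ∏ e ∈ univ.filter (fun e => e ∉ T), α e ≤ G.kirchhoff α ^ G.trees.card := by
    rw [← prod_const]
    exact prod_le_prod (fun T _ => prod_nonneg fun e _ => (hα e).le) h1

/-- Each monomial is at most `∏ (1 + α e)`, and `1 + x ≤ δ⁻¹ exp (δ x)`: polynomial growth is traded
for exponential growth of arbitrarily small rate. -/
theorem kirchhoff_upper (G : Multidigraph V E) (α : E → ℝ) (hα : ∀ e, 0 < α e) {δ : ℝ}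
    (hδ : 0 < δ) (hδ' : δ ≤ 1) : G.kirchhoff α ≤
      G.trees.card * ((δ⁻¹) ^ Fintype.card E * Real.exp (δ * ∑ e, α e)) := by
  classical
  have h0 : ∀ e, 1 + α e ≤ δ⁻¹ * Real.exp (δ * α e) := by
    intro e
    have h1 := Real.add_one_le_exp (δ * α e)
    have h2 : δ * (1 + α e) ≤ Real.exp (δ * α e) := by nlinarith [hα e]
    rw [inv_mul_eq_div, le_div_iff₀ hδ]
    linarith
  unfold kirchhoff
  rw [← nsmul_eq_mul]
  refine sum_le_card_nsmul _ _ _ fun T _ => ?_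
  calc ∏ e ∈ univ.filter (fun e => e ∉ T), α e ≤ ∏ e, (1 + α e) := by
        rw [prod_filter]
        refine prod_le_prod (fun e _ => ?_) fun e _ => ?_
        · split_ifs
          · exact zero_le_one
          · exact (hα e).le
        · have := hα e
          split_ifs <;> linarith
    _ ≤ ∏ e, (δ⁻¹ * Real.exp (δ * α e)) :=
        prod_le_prod (fun e _ => by have := hα e; linarith) fun e _ => h0 e
    _ = _ := by
        rw [prod_mul_distrib, prod_const, ← Real.exp_sum, mul_sum, card_univ]

/-- Connected loopfree graphs: the hypotheses under which the integrals converge. -/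
structure Convergent (G : Multidigraph V E) : Prop where
  loopfree : G.Loopfree
  conn : ConnRel (G.edgeRel univ)
  ne : Nonempty E

theorem Convergent.exists_tree {G : Multidigraph V E} (h : G.Convergent) :
    ∃ T, G.IsSpanningTree T := by
  obtain ⟨e⟩ := h.ne
  obtain ⟨T, hT, -⟩ := G.exists_spanningTree_mem h.conn e (h.loopfree e)
  exact ⟨T, hT⟩

theorem Convergent.card_trees_pos {G : Multidigraph V E} (h : G.Convergent) :
    0 < G.trees.card := by
  classical
  obtain ⟨T, hT⟩ := h.exists_tree
  exact card_pos.2 ⟨T, by simpa [trees] using hT⟩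

/-- For `x ≥ 0` the upper bound suffices. For `x < 0` the power `x / N` of the lower bound, with `N`
the number of trees, gives `α e` the exponent `x` times the fraction of trees avoiding `e`. That
fraction is below one as some tree contains `e`, so the exponent exceeds `-1` even at the endpoint
`x = -1`. -/
theorem Convergent.rpow_bound {G : Multidigraph V E} (h : G.Convergent) {x c : ℝ} (hx : -1 ≤ x)
    (hc : 0 < c) : ∃ (C : ℝ) (a : E → ℝ), (∀ e, -1 < a e) ∧ ∀ α : E → ℝ, (∀ e, 0 < α e) →
      G.kirchhoff α ^ x ≤ C * Real.exp (c * ∑ e, α e) * ∏ e, α e ^ a e := by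
  classical
  obtain ⟨T₀, hT₀⟩ := h.exists_tree
  rcases le_or_gt 0 x with hx0 | hx0
  -- Chosen so that the `x`-th power of `exp (δ S)` grows at rate at most `c`; the shift by one
  -- avoids division by zero at `x = 0`.
  · set δ : ℝ := min 1 (c / (x + 1)) with hδ
    have hδ0 : 0 < δ := lt_min one_pos (by positivity)
    have hδ1 : δ ≤ 1 := min_le_left _ _
    have hδx : δ * x ≤ c := by
      have h1 : δ ≤ c / (x + 1) := min_le_right _ _
      rw [le_div_iff₀ (by linarith)] at h1
      nlinarith
    refine ⟨(G.trees.card * (δ⁻¹) ^ Fintype.card E) ^ x, fun _ => 0, fun _ => by norm_num,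
      fun α hα => ?_⟩
    have hP := (G.kirchhoff_pos hT₀ α hα).le
    have h1 := Real.rpow_le_rpow hP (G.kirchhoff_upper α hα hδ0 hδ1) hx0
    rw [← mul_assoc, Real.mul_rpow (by positivity) (by positivity), ← Real.exp_mul] at h1
    refine h1.trans ?_
    simp only [Real.rpow_zero, prod_const_one, mul_one]
    refine mul_le_mul_of_nonneg_left (Real.exp_le_exp.2 ?_) (by positivity)
    have hS : 0 ≤ ∑ e, α e := sum_nonneg fun e _ => (hα e).le
    nlinarith
  · have hN := h.card_trees_pos
    set N := G.trees.card with hNdef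
    have hN' : (0 : ℝ) < N := by exact_mod_cast hN
    refine ⟨1, fun e => ((G.trees.filter fun T => e ∉ T).card : ℝ) * (x / N), fun e => ?_,
      fun α hα => ?_⟩
    · obtain ⟨T, hT, heT⟩ := G.exists_spanningTree_mem h.conn e (h.loopfree e)
      have hlt : (G.trees.filter fun T => e ∉ T).card < N := by
        refine card_lt_card ⟨filter_subset _ _, fun hsub => ?_⟩
        have := hsub (show T ∈ G.trees by simpa [trees] using hT)
        simp [heT] at this
      have hlt' : ((G.trees.filter fun T => e ∉ T).card : ℝ) < N := by exact_mod_cast hlt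
      dsimp only
      rw [← mul_div_assoc, lt_div_iff₀ hN']
      have h0 : (0 : ℝ) ≤ (G.trees.filter fun T => e ∉ T).card := Nat.cast_nonneg _
      nlinarith
    · have hP := (G.kirchhoff_pos hT₀ α hα)
      have h1 := G.kirchhoff_lower α hα
      have hprod : 0 < ∏ e, α e ^ (G.trees.filter fun T => e ∉ T).card :=
        prod_pos fun e _ => pow_pos (hα e) _
      have hxN : x / N ≤ 0 := div_nonpos_of_nonpos_of_nonneg hx0.le hN'.le
      have h2 := Real.rpow_le_rpow_of_nonpos hprod h1 hxN
      have h3 : (G.kirchhoff α ^ N) ^ (x / N) = G.kirchhoff α ^ x := by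
        rw [← Real.rpow_natCast, ← Real.rpow_mul hP.le, mul_div_cancel₀ _ hN'.ne']
      rw [h3] at h2
      have h4 : (∏ e, α e ^ (G.trees.filter fun T => e ∉ T).card) ^ (x / N) =
          ∏ e, α e ^ (((G.trees.filter fun T => e ∉ T).card : ℝ) * (x / N)) := by
        rw [← Real.finsetProd_rpow _ _ fun e _ => (pow_pos (hα e) _).le]
        refine prod_congr rfl fun e _ => ?_
        rw [← Real.rpow_natCast, ← Real.rpow_mul (hα e).le]
      rw [h4] at h2
      refine h2.trans (le_mul_of_one_le_left (prod_nonneg fun e _ =>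
        Real.rpow_nonneg (hα e).le _) ?_)
      rw [one_mul]
      exact Real.one_le_exp (mul_nonneg hc.le (sum_nonneg fun e _ => (hα e).le))

/-- Half of the exponential decay absorbs the growth of the polynomial; the rest leaves a product of
one-dimensional Gamma integrands. -/
theorem Convergent.integrable_rpow {G : Multidigraph V E} (h : G.Convergent) {x c : ℝ}
    (hx : -1 ≤ x) (hc : 0 < c) :
    Integrable (fun α => Real.exp (-(c * ∑ e, α e)) * G.kirchhoff α ^ x) (orthant E) := by
  obtain ⟨C, a, ha, hb⟩ := h.rpow_bound hx (half_pos hc)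
  obtain ⟨T₀, hT₀⟩ := h.exists_tree
  have h1 : Integrable (fun α : E → ℝ => ∏ e, (α e ^ a e * Real.exp (-(c / 2) * α e ^ (1 : ℝ))))
      (orthant E) :=
    Integrable.fintype_prod (μ := fun _ : E => halfLine)
      (f := fun e (y : ℝ) => y ^ a e * Real.exp (-(c / 2) * y ^ (1 : ℝ))) fun e =>
      integrableOn_rpow_mul_exp_neg_mul_rpow (ha e) one_pos (half_pos hc)
  refine (h1.const_mul C).mono' ?_ ?_
  · refine Measurable.aestronglyMeasurable ?_
    have := G.continuous_kirchhoff.measurable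
    fun_prop
  · filter_upwards [ae_orthant_pos E] with α hα
    have hP := G.kirchhoff_pos hT₀ α hα
    rw [Real.norm_of_nonneg (by positivity)]
    refine (mul_le_mul_of_nonneg_left (hb α hα) (Real.exp_pos _).le).trans (le_of_eq ?_)
    rw [prod_mul_distrib, ← Real.exp_sum]
    simp only [Real.rpow_one]
    rw [← mul_sum]
    have : Real.exp (-(c / 2) * ∑ e, α e) =
        Real.exp (-(c * ∑ e, α e)) * Real.exp (c / 2 * ∑ e, α e) := by
      rw [← Real.exp_add]; ring_nf
    rw [this]
    ring

theorem norm_exp_mul_cpow {s P : ℝ} (hP : 0 < P) (z : ℂ) :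
    ‖Complex.exp (-(s : ℂ)) * (P : ℂ) ^ z‖ = Real.exp (-s) * P ^ z.re := by
  rw [norm_mul, Complex.norm_cpow_eq_rpow_re_of_pos hP, Complex.norm_exp]
  simp

theorem Convergent.integrable_scaled {G : Multidigraph V E} (h : G.Convergent) {n : ℂ}
    (hn : 0 ≤ n.re) {t : ℝ} (ht : 0 < t) :
    Integrable (fun α => Complex.exp (-((t * ∑ e, α e : ℝ) : ℂ)) *
      ((G.kirchhoff α : ℝ) : ℂ) ^ (n - 1)) (orthant E) := by
  obtain ⟨T₀, hT₀⟩ := h.exists_tree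
  refine (h.integrable_rpow (x := (n - 1).re) (c := t) (by simpa using hn) ht).mono' ?_ ?_
  · refine Measurable.aestronglyMeasurable ?_
    have := G.continuous_kirchhoff.measurable
    refine Measurable.mul (by fun_prop) ?_
    exact (Complex.measurable_ofReal.comp this).pow_const _
  · filter_upwards [ae_orthant_pos E] with α hα
    rw [norm_exp_mul_cpow (G.kirchhoff_pos hT₀ α hα)]

theorem ofReal_pow_cpow {t : ℝ} (ht : 0 < t) (k : ℕ) (z : ℂ) :
    ((t ^ k : ℝ) : ℂ) ^ z = ((t : ℂ) ^ z) ^ k := by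
  induction k with
  | zero => simp
  | succ k ih =>
    rw [pow_succ, Complex.ofReal_mul, Complex.mul_cpow_ofReal_nonneg (pow_nonneg ht.le _) ht.le,
      ih, pow_succ]

/-- Substitution of `t • α`: the Jacobian gives the edge count, and homogeneity of the polynomial
gives the loop number times `n - 1`. -/
theorem Convergent.integral_scaled {G : Multidigraph V E} (h : G.Convergent) (n : ℂ) {t : ℝ}
    (ht : 0 < t) :
    ∫ α, Complex.exp (-((t * ∑ e, α e : ℝ) : ℂ)) * ((G.kirchhoff α : ℝ) : ℂ) ^ (n - 1)
      ∂orthant E =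
      (t : ℂ) ^ (-((Fintype.card E : ℂ) + (G.loops : ℂ) * (n - 1))) * G.gammaFun n := by
  obtain ⟨T₀, hT₀⟩ := h.exists_tree
  have hor : orthant E =
      (volume : Measure (E → ℝ)).restrict (Set.univ.pi fun _ => Set.Ioi 0) := by
    rw [volume_pi, Measure.restrict_pi_pi]
  have ht0 : (t : ℂ) ≠ 0 := by exact_mod_cast ht.ne'
  have hs := Measure.setIntegral_comp_smul_of_pos (volume : Measure (E → ℝ)) (G.gammaInt n)
    (Set.univ.pi fun _ : E => Set.Ioi (0 : ℝ)) ht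
  have hset : t • (Set.univ.pi fun _ : E => Set.Ioi (0 : ℝ)) = Set.univ.pi fun _ => Set.Ioi 0 := by
    ext y
    rw [Set.mem_smul_set_iff_inv_smul_mem₀ ht.ne']
    simp [Set.mem_pi, inv_pos, ht, mul_pos_iff_of_pos_left]
  rw [hset, ← hor, ← gammaFun_eq, Module.finrank_fintype_fun_eq_card] at hs
  have hint : ∫ α, G.gammaInt n (t • α) ∂orthant E =
      (t : ℂ) ^ ((G.loops : ℂ) * (n - 1)) * ∫ α, Complex.exp (-((t * ∑ e, α e : ℝ) : ℂ)) *
        ((G.kirchhoff α : ℝ) : ℂ) ^ (n - 1) ∂orthant E := by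
    rw [← integral_const_mul]
    refine integral_congr_ae ?_
    filter_upwards [ae_orthant_pos E] with α hα
    have hP := G.kirchhoff_pos hT₀ α hα
    unfold gammaInt
    rw [kirchhoff_smul, Complex.ofReal_mul,
      Complex.mul_cpow_ofReal_nonneg (pow_nonneg ht.le _) hP.le, G.loops_eq hT₀]
    have e1 : (((t ^ (Fintype.card E + 1 - Fintype.card V) : ℝ)) : ℂ) ^ (n - 1) =
        (t : ℂ) ^ ((((Fintype.card E + 1 - Fintype.card V : ℕ) : ℤ) : ℂ) * (n - 1)) := by
      rw [Int.cast_natCast, Complex.cpow_nat_mul, ofReal_pow_cpow ht]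
    rw [e1]
    have e2 : -∑ e, (((t • α) e : ℝ) : ℂ) = -((t * ∑ e, α e : ℝ) : ℂ) := by
      push_cast
      rw [mul_sum]
      simp
    rw [e2]
    ring
  rw [hint] at hs
  rw [neg_add, Complex.cpow_add _ _ ht0, Complex.cpow_neg, Complex.cpow_neg,
    Complex.cpow_natCast]
  have hne : (t : ℂ) ^ ((G.loops : ℂ) * (n - 1)) ≠ 0 := by
    rw [Complex.cpow_def_of_ne_zero ht0]; exact Complex.exp_ne_zero _
  rw [eq_comm, mul_right_comm, ← div_eq_mul_inv, div_eq_iff hne, mul_comm _ (_ ^ _), hs,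
    Complex.real_smul]
  push_cast
  rfl

/-- Both sides are minus the derivative at `t = 1` of the scaled integral, computed under the
integral sign and from its closed form `t ^ (-k)`. -/
theorem Convergent.integral_sum_mul {G : Multidigraph V E} (h : G.Convergent) {n : ℂ}
    (hn : 0 ≤ n.re) :
    Integrable (fun α => ((∑ e, α e : ℝ) : ℂ) * G.gammaInt n α) (orthant E) ∧
    ∫ α, ((∑ e, α e : ℝ) : ℂ) * G.gammaInt n α ∂orthant E =
      ((Fintype.card E : ℂ) + (G.loops : ℂ) * (n - 1)) * G.gammaFun n := by
  obtain ⟨T₀, hT₀⟩ := h.exists_tree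
  set k : ℂ := (Fintype.card E : ℂ) + (G.loops : ℂ) * (n - 1) with hk
  have hGint : ∀ α : E → ℝ, G.gammaInt n α = Complex.exp (-((1 * ∑ e, α e : ℝ) : ℂ)) *
      ((G.kirchhoff α : ℝ) : ℂ) ^ (n - 1) := by
    intro α
    simp [gammaInt]
  have hPm : Measurable fun α : E → ℝ => ((G.kirchhoff α : ℝ) : ℂ) ^ (n - 1) :=
    (Complex.measurable_ofReal.comp G.continuous_kirchhoff.measurable).pow_const _
  -- On the ball `t ≥ 3/4`, and with `S = ∑ α` one has `S ≤ 4 exp (S/4)`, so `S exp (-t S) ≤ 4 exp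
  -- (-S/2)` is a bound independent of `t`.
  have key := hasDerivAt_integral_of_dominated_loc_of_deriv_le (μ := orthant E) (𝕜 := ℝ)
    (s := Metric.ball 1 (1 / 4))
    (F := fun (t : ℝ) (α : E → ℝ) => Complex.exp (-((t * ∑ e, α e : ℝ) : ℂ)) *
      ((G.kirchhoff α : ℝ) : ℂ) ^ (n - 1))
    (F' := fun (t : ℝ) (α : E → ℝ) => -((∑ e, α e : ℝ) : ℂ) *
      (Complex.exp (-((t * ∑ e, α e : ℝ) : ℂ)) * ((G.kirchhoff α : ℝ) : ℂ) ^ (n - 1)))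
    (x₀ := 1)
    (bound := fun α => 4 * (Real.exp (-(1 / 2 * ∑ e, α e)) * G.kirchhoff α ^ (n - 1).re))
    (Metric.ball_mem_nhds _ (by norm_num)) ?_ ?_ ?_ ?_ ?_ ?_
  · obtain ⟨hi, hd⟩ := key
    have hd2 : HasDerivAt (fun t : ℝ => (t : ℂ) ^ (-k) * G.gammaFun n)
        (∫ α, -((∑ e, α e : ℝ) : ℂ) * (Complex.exp (-((1 * ∑ e, α e : ℝ) : ℂ)) *
          ((G.kirchhoff α : ℝ) : ℂ) ^ (n - 1)) ∂orthant E) 1 := by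
      refine hd.congr_of_eventuallyEq ?_
      filter_upwards [Ioi_mem_nhds (zero_lt_one (α := ℝ))] with t ht
      exact (h.integral_scaled n ht).symm
    have hd3 : HasDerivAt (fun t : ℝ => (t : ℂ) ^ (-k) * G.gammaFun n)
        (-k * G.gammaFun n) 1 := by
      have h1 : HasDerivAt (fun z : ℂ => z ^ (-k)) (-k * (1 : ℂ) ^ (-k - 1) * 1) ((1 : ℝ) : ℂ) := by
        have := (hasDerivAt_id ((1 : ℝ) : ℂ)).cpow_const (c := -k) (by simp)
        simpa using this
      have h2 := (h1.comp_ofReal).mul_const (G.gammaFun n)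
      simpa using h2
    have heq := hd2.unique hd3
    have hneg : ∀ α : E → ℝ, -((∑ e, α e : ℝ) : ℂ) * (Complex.exp (-((1 * ∑ e, α e : ℝ) : ℂ)) *
          ((G.kirchhoff α : ℝ) : ℂ) ^ (n - 1)) = -(((∑ e, α e : ℝ) : ℂ) * G.gammaInt n α) := by
      intro α
      rw [hGint]; ring
    simp only [hneg] at heq hi
    refine ⟨by simpa using hi.neg, ?_⟩
    rw [integral_neg] at heq
    linear_combination -heq
  · refine Filter.Eventually.of_forall fun t => Measurable.aestronglyMeasurable ?_
    exact Measurable.mul (by fun_prop) hPm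
  · exact h.integrable_scaled hn one_pos
  · refine Measurable.aestronglyMeasurable ?_
    exact Measurable.mul (by fun_prop) (Measurable.mul (by fun_prop) hPm)
  · filter_upwards [ae_orthant_pos E] with α hα t ht
    have hP := G.kirchhoff_pos hT₀ α hα
    have hS : 0 ≤ ∑ e, α e := sum_nonneg fun e _ => (hα e).le
    have ht' : 3 / 4 ≤ t := by
      rw [Metric.mem_ball, Real.dist_eq, abs_lt] at ht
      linarith [ht.1]
    rw [norm_mul, norm_exp_mul_cpow hP, norm_neg, Complex.norm_real, Real.norm_of_nonneg hS,
      ← mul_assoc, ← mul_assoc]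
    refine mul_le_mul_of_nonneg_right ?_ (Real.rpow_nonneg hP.le _)
    set S := ∑ e, α e
    have h1 : S ≤ 4 * Real.exp (S / 4) := by
      have := Real.add_one_le_exp (S / 4)
      linarith
    calc S * Real.exp (-(t * S)) ≤ 4 * Real.exp (S / 4) * Real.exp (-(3 / 4 * S)) := by
          refine mul_le_mul h1 (Real.exp_le_exp.2 ?_) (Real.exp_pos _).le (by positivity)
          nlinarith
      _ = 4 * Real.exp (-(1 / 2 * S)) := by
          rw [mul_assoc, ← Real.exp_add]; ring_nf
  · exact (h.integrable_rpow (by simpa using hn) (by norm_num)).const_mul 4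
  · refine Filter.Eventually.of_forall fun α t _ => ?_
    have h1 : HasDerivAt (fun t : ℝ => -((t * ∑ e, α e : ℝ) : ℂ)) (-((∑ e, α e : ℝ) : ℂ)) t := by
      have h2 := (((hasDerivAt_id t).mul_const (∑ e, α e)).ofReal_comp).neg
      exact h2.congr_deriv (by simp)
    have h3 := (h1.cexp).mul_const (((G.kirchhoff α : ℝ) : ℂ) ^ (n - 1))
    refine h3.congr_deriv ?_
    ring

/-- Homogeneity of the Kirchhoff polynomial, integrated. -/
theorem Convergent.sum_integral {G : Multidigraph V E} (h : G.Convergent) {n : ℂ}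
    (hn : 0 ≤ n.re) : ∑ e, ∫ α, (α e : ℂ) * G.gammaInt n α ∂orthant E =
      ((Fintype.card E : ℂ) + (G.loops : ℂ) * (n - 1)) * G.gammaFun n := by
  obtain ⟨hi, hd⟩ := h.integral_sum_mul hn
  rw [← hd, ← integral_finsetSum]
  · refine integral_congr_ae (Filter.Eventually.of_forall fun α => ?_)
    dsimp only
    rw [← sum_mul, Complex.ofReal_sum]
  · intro e _
    refine hi.mono ?_ ?_
    · refine Measurable.aestronglyMeasurable ?_
      exact Measurable.mul (by fun_prop) (G.measurable_gammaInt n)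
    · filter_upwards [ae_orthant_pos E] with α hα
      rw [norm_mul, norm_mul]
      refine mul_le_mul_of_nonneg_right ?_ (norm_nonneg _)
      rw [Complex.norm_real, Complex.norm_real, Real.norm_of_nonneg (hα e).le,
        Real.norm_of_nonneg (sum_nonneg fun e _ => (hα e).le)]
      exact single_le_sum (f := fun e => α e) (fun e _ => (hα e).le) (mem_univ e)

end Multidigraph

end PhiFour

end

/-! ### Amplitudes and their derivative in the mass parameter -/

noncomputable section

namespace PhiFour

open Finset MeasureTheory

namespace Multidigraph

variable {V W E E' : Type} [Fintype V] [Fintype W] [Fintype E] [Fintype E']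
  [DecidableEq V] [DecidableEq W] [DecidableEq E] [DecidableEq E']

/-- The product of the mass factor and the Feynman integral. -/
def amplitude (G : Multidigraph V E) (logb : ℂ → ℂ) (d lam : ℂ) : ℂ :=
  G.massFactor logb d lam * G.feynman d

theorem amplitude_congr (G : Multidigraph V E) (H : Multidigraph W E') (v : V ≃ W)
    (h : ∀ i j, H.adj (v i) (v j) = G.adj i j) (logb : ℂ → ℂ) (d lam : ℂ) :
    H.amplitude logb d lam = G.amplitude logb d lam := by
  obtain ⟨c, hc⟩ := exists_edge_equiv G H v h
  have h1 : H.loops = G.loops := by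
    unfold loops
    rw [Fintype.card_congr v, Fintype.card_congr c]
  unfold amplitude massFactor feynman
  rw [h1, gammaFun_congr G H v c hc, Fintype.card_congr c]

/-- One more edge at the same loop number: only the mass factor changes. -/
theorem amplitude_pendant (G : Multidigraph V E) (H : Multidigraph (Option V) (Option E)) (a : V)
    (hs : ∀ e, H.st (some e) = some (G.st e)) (he : ∀ e, H.en (some e) = some (G.en e))
    (h0 : H.st none = some a ∧ H.en none = none ∨ H.st none = none ∧ H.en none = some a)
    (logb : ℂ → ℂ) (d lam : ℂ) : H.amplitude logb d lam = lam⁻¹ * G.amplitude logb d lam := by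
  have h1 : H.loops = G.loops := by
    unfold loops
    rw [Fintype.card_option, Fintype.card_option]
    push_cast
    ring
  unfold amplitude massFactor feynman
  rw [h1, gammaFun_pendant G H a hs he h0, Fintype.card_option, pow_succ, div_mul_eq_div_div]
  ring

/-- The factor of a bubble. -/
def bubble (logb : ℂ → ℂ) (d lam : ℂ) : ℂ :=
  Complex.exp ((d / 2 - 2) * logb lam) * (Complex.Gamma (2 - d / 2) / (4 * (Real.pi : ℂ)) ^ (d / 2))

/-- A bubble adds one loop and two edges, whence the exponent `d/2 - 2` of the mass parameter. -/
theorem amplitude_subdiv_loop (G : Multidigraph V (Option E)) (h : G.st none = G.en none)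
    (logb : ℂ → ℂ) (d lam : ℂ) (hd : 0 ≤ (1 - d / 2).re) (hl : Complex.exp (logb lam) = lam) :
    G.subdiv.amplitude logb d lam = bubble logb d lam *
      (⟨G.st ∘ some, G.en ∘ some⟩ : Multidigraph V E).amplitude logb d lam := by
  set H : Multidigraph V E := ⟨G.st ∘ some, G.en ∘ some⟩ with hH
  have h1 : G.subdiv.loops = H.loops + 1 := by
    unfold loops
    rw [Fintype.card_option, Fintype.card_option, Fintype.card_option]
    push_cast
    ring
  have hpi : (4 * (Real.pi : ℂ)) ≠ 0 := by simp [Real.pi_ne_zero]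
  have e1 : (1 - d / 2) + 1 = 2 - d / 2 := by ring
  have e2 : ((H.loops + 1 : ℤ) : ℂ) * (d / 2) = (H.loops : ℂ) * (d / 2) + d / 2 := by
    push_cast; ring
  have e3 : ((H.loops : ℂ) * (d / 2) + d / 2) * logb lam =
      (H.loops : ℂ) * (d / 2) * logb lam + (d / 2 - 2) * logb lam + (2 : ℕ) * logb lam := by
    push_cast; ring
  have hl0 : lam ≠ 0 := by rw [← hl]; exact Complex.exp_ne_zero _
  have e4 : Complex.exp ((2 : ℕ) * logb lam) = lam ^ 2 := by
    rw [Complex.exp_nat_mul, hl]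
  unfold amplitude massFactor feynman bubble
  rw [h1, G.gammaFun_subdiv_loop h _ hd, e1, e2, Complex.cpow_add _ _ hpi, e3, Complex.exp_add,
    Complex.exp_add, e4, Fintype.card_option, Fintype.card_option,
    ← hH]
  field_simp
  ring

theorem adj_subdiv (G : Multidigraph V (Option E)) :
    G.subdiv.adj = extMat (G.st none) (G.en none)
      (⟨G.st ∘ some, G.en ∘ some⟩ : Multidigraph V E).adj := by
  ext (_ | i) (_ | j)
  · unfold adj
    rw [card_filter_option, card_filter_option]
    simp [subdiv, extMat]
  · unfold adj
    rw [card_filter_option, card_filter_option]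
    simp [subdiv, extMat, eq_comm]
  · unfold adj
    rw [card_filter_option, card_filter_option]
    simp [subdiv, extMat, eq_comm]
  · unfold adj
    rw [card_filter_option, card_filter_option]
    simp [subdiv, extMat]

theorem adj_option (G : Multidigraph V (Option E)) :
    G.adj = addEdge (G.st none) (G.en none)
      (⟨G.st ∘ some, G.en ∘ some⟩ : Multidigraph V E).adj := by
  ext i j
  unfold adj
  rw [card_filter_option, add_comm]
  simp [addEdge, eq_comm]

/-- The graph with its edges relabelled such that the edge `e` becomes `none`. -/
def pointed (G : Multidigraph V E) (e : E) : Multidigraph V (Option {x // x ≠ e}) where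
  st x := G.st (Equiv.optionSubtypeNe e x)
  en x := G.en (Equiv.optionSubtypeNe e x)

theorem integral_pointed (G : Multidigraph V E) (e : E) (n : ℂ) :
    ∫ α, (α none : ℂ) * (G.pointed e).gammaInt n α ∂orthant (Option {x // x ≠ e}) =
      ∫ α, (α e : ℂ) * G.gammaInt n α ∂orthant E := by
  set c := Equiv.optionSubtypeNe e
  have hp := measurePreserving_piCongrLeft (fun _ : E => halfLine) c
  rw [← hp.integral_comp (MeasurableEquiv.measurableEmbedding _)]
  refine integral_congr_ae (Filter.Eventually.of_forall fun α => ?_)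
  have e1 : ∀ x, (MeasurableEquiv.piCongrLeft (fun _ : E => ℝ) c) α (c x) = α x := fun x =>
    Equiv.piCongrLeft_apply_apply (fun _ : E => ℝ) c α x
  have e2 : (MeasurableEquiv.piCongrLeft (fun _ : E => ℝ) c) α e = α none := by
    rw [← e1 none, Equiv.optionSubtypeNe_none]
  unfold gammaInt
  dsimp only
  rw [kirchhoff_congr (G.pointed e) G (Equiv.refl V) c (fun x => ⟨rfl, rfl⟩), ← Equiv.sum_comp c,
    e2]
  simp only [e1, Function.comp_def]

/-- Subdividing `e` keeps the loop number, adds one edge and inserts `α e` into the integral, so the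
sum over `e` is the homogeneity identity at `n - 1 = -d/2`. -/
theorem Convergent.sum_amplitude {G : Multidigraph V E} (h : G.Convergent) (logb : ℂ → ℂ)
    (d lam : ℂ) (hd : 0 ≤ (1 - d / 2).re) :
    ∑ e, (G.pointed e).subdiv.amplitude logb d lam =
      ((Fintype.card E : ℂ) - (G.loops : ℂ) * (d / 2)) / lam * G.amplitude logb d lam := by
  have hcard : ∀ e : E, Fintype.card (Option {x // x ≠ e}) = Fintype.card E := fun e =>
    Fintype.card_congr (Equiv.optionSubtypeNe e)
  have h1 : ∀ e, (G.pointed e).subdiv.loops = G.loops := by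
    intro e
    unfold loops
    rw [Fintype.card_option, Fintype.card_option (α := V), hcard]
    push_cast
    ring
  have h2 : ∀ e, (G.pointed e).subdiv.amplitude logb d lam =
      G.massFactor logb d lam / lam * (1 / (4 * (Real.pi : ℂ)) ^ ((G.loops : ℂ) * (d / 2))) *
        ∫ α, (α e : ℂ) * G.gammaInt (1 - d / 2) α ∂orthant E := by
    intro e
    unfold amplitude massFactor feynman
    rw [h1, gammaFun_subdiv, integral_pointed, Fintype.card_option, hcard, pow_succ,
      div_mul_eq_div_div]
    ring
  simp only [h2]
  rw [← mul_sum, h.sum_integral hd]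
  unfold amplitude feynman
  ring

/-- The amplitude is a constant times `lam` to the power `L d/2 - #E`. The derivative is written as
minus the right side of `Convergent.sum_amplitude`. -/
theorem hasDerivAt_amplitude (G : Multidigraph V E) (logb : ℂ → ℂ) (d lam : ℂ)
    (hl : HasDerivAt logb lam⁻¹ lam) (hl0 : lam ≠ 0) :
    HasDerivAt (fun z => G.amplitude logb d z)
      (-(((Fintype.card E : ℂ) - (G.loops : ℂ) * (d / 2)) / lam * G.amplitude logb d lam)) lam := by
  unfold amplitude massFactor
  have h1 := (((hl.const_mul ((G.loops : ℂ) * (d / 2))).cexp).div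
    (hasDerivAt_pow (Fintype.card E) lam) (pow_ne_zero _ hl0)).mul_const (G.feynman d)
  refine h1.congr_deriv ?_
  have h2 : (Fintype.card E : ℂ) * lam ^ (Fintype.card E - 1) =
      (Fintype.card E : ℂ) * lam ^ Fintype.card E / lam := by
    rcases Nat.eq_zero_or_pos (Fintype.card E) with h | h
    · simp [h]
    · rw [eq_div_iff hl0, mul_assoc, ← pow_succ, Nat.sub_add_cancel h]
  rw [h2]
  field_simp
  ring

end Multidigraph

/-! ### Amplitudes in terms of matrices -/

section MatrixAmplitude

open Multidigraph

variable {V W : Type} [Fintype V] [Fintype W] [DecidableEq V] [DecidableEq W]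

/-- The amplitude of the graph of a matrix. -/
def matAmp (logb : ℂ → ℂ) (d lam : ℂ) (F : Matrix V V ℕ) : ℂ :=
  (ofMatrix F).amplitude logb d lam

theorem amplitude_eq_matAmp {E : Type} [Fintype E] [DecidableEq E] (G : Multidigraph V E)
    (logb : ℂ → ℂ) (d lam : ℂ) : G.amplitude logb d lam = matAmp logb d lam G.adj :=
  amplitude_congr (ofMatrix G.adj) G (Equiv.refl V)
    (fun i j => by rw [adj_ofMatrix]; rfl) logb d lam

theorem matAmp_congr (v : V ≃ W) (logb : ℂ → ℂ) (d lam : ℂ) (F : Matrix V V ℕ)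
    (F' : Matrix W W ℕ) (hF : ∀ i j, F' (v i) (v j) = F i j) :
    matAmp logb d lam F' = matAmp logb d lam F :=
  amplitude_congr (ofMatrix F) (ofMatrix F') v
    (fun i j => by rw [adj_ofMatrix, adj_ofMatrix, hF]) logb d lam

theorem matAmp_extMat_self (logb : ℂ → ℂ) (d lam : ℂ) (hd : 0 ≤ (1 - d / 2).re)
    (hl : Complex.exp (logb lam) = lam) (a : V) (H : Matrix V V ℕ) :
    matAmp logb d lam (extMat a a H) = bubble logb d lam * matAmp logb d lam H := by
  let G : Multidigraph V (Option (Σ ij : V × V, Fin (H ij.1 ij.2))) :=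
    { st := fun e => e.elim a (ofMatrix H).st
      en := fun e => e.elim a (ofMatrix H).en }
  have hG : (⟨G.st ∘ some, G.en ∘ some⟩ : Multidigraph V (Σ ij : V × V, Fin (H ij.1 ij.2))) =
      ofMatrix H := rfl
  have h1 := G.amplitude_subdiv_loop rfl logb d lam hd hl
  rw [amplitude_eq_matAmp, adj_subdiv, hG, adj_ofMatrix] at h1
  exact h1

/-- The matrix with one edge from `a` to `b` removed. -/
def remEdge (a b : V) (F : Matrix V V ℕ) : Matrix V V ℕ :=
  fun i j => F i j - if i = a ∧ j = b then 1 else 0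

theorem remEdge_addEdge (a b : V) (H : Matrix V V ℕ) : remEdge a b (addEdge a b H) = H := by
  ext i j
  simp [remEdge, addEdge]

theorem addEdge_remEdge (a b : V) (F : Matrix V V ℕ) (h : F a b ≠ 0) :
    addEdge a b (remEdge a b F) = F := by
  ext i j
  by_cases hij : i = a ∧ j = b
  · obtain ⟨rfl, rfl⟩ := hij
    simp only [addEdge, remEdge, and_self, if_true]
    omega
  · simp [addEdge, remEdge, hij]

/-- The sum over subdivided edges is grouped by end vertices into `F a b` equal terms. Where `F a b
= 0` the truncated `remEdge` is irrelevant, because its coefficient vanishes. -/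
theorem hasDerivAt_matAmp (logb : ℂ → ℂ) (d lam : ℂ) (hd : 0 ≤ (1 - d / 2).re)
    (hl : HasDerivAt logb lam⁻¹ lam) (hl0 : lam ≠ 0) (F : Matrix V V ℕ) (hF : IsVac F)
    (h0 : F ≠ 0) : HasDerivAt (fun z => matAmp logb d z F)
      (-∑ a, ∑ b, (F a b : ℂ) * matAmp logb d lam (extMat a b (remEdge a b F))) lam := by
  have hconv : (ofMatrix F).Convergent := by
    refine ⟨?_, ?_, ?_⟩
    · rintro ⟨⟨i, j⟩, k⟩ hij
      change i = j at hij
      subst hij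
      have := hF.diag i
      change Fin (F i i) at k
      rw [this] at k
      exact k.elim0
    · have := hF.conn
      rw [← adj_ofMatrix F, connMat_adj] at this
      unfold edgeRel
      simpa using this
    · by_contra hne
      apply h0
      ext i j
      by_contra hij
      exact hne ⟨⟨(i, j), ⟨0, Nat.pos_of_ne_zero hij⟩⟩⟩
  have h1 := (ofMatrix F).hasDerivAt_amplitude logb d lam hl hl0
  rw [← hconv.sum_amplitude logb d lam hd] at h1
  have h2 : ∀ e, ((ofMatrix F).pointed e).subdiv.amplitude logb d lam =
      matAmp logb d lam (extMat e.1.1 e.1.2 (remEdge e.1.1 e.1.2 F)) := by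
    intro e
    rw [amplitude_eq_matAmp, adj_subdiv]
    have e1 : ((ofMatrix F).pointed e).adj = F := by
      have : ((ofMatrix F).pointed e).adj = (ofMatrix F).adj := by
        ext i j
        exact card_equiv (Equiv.optionSubtypeNe e) fun x => by simp [pointed]
      rw [this, adj_ofMatrix]
    have e2 := adj_option ((ofMatrix F).pointed e)
    have e3 : ((ofMatrix F).pointed e).st none = e.1.1 := by
      simp [pointed, ofMatrix]
    have e4 : ((ofMatrix F).pointed e).en none = e.1.2 := by
      simp [pointed, ofMatrix]
    rw [e3, e4, e1] at e2
    rw [e3, e4]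
    have e5 := congrArg (remEdge e.1.1 e.1.2) e2
    rw [remEdge_addEdge] at e5
    rw [← e5]
  rw [sum_congr rfl fun e _ => h2 e, Fintype.sum_sigma, Fintype.sum_prod_type] at h1
  simp only [sum_const, card_univ, Fintype.card_fin, nsmul_eq_mul] at h1
  exact h1

end MatrixAmplitude

end PhiFour

end

noncomputable section

namespace PhiFour

open Finset Multidigraph

variable {V W : Type} [Fintype V] [Fintype W] [DecidableEq V] [DecidableEq W]

/-! ### Degree functions and monomials -/

/-- The exponents of the monomials in `λ₂, λ₃, …`. -/
abbrev Expo : Type := {j : ℕ // 2 ≤ j} →₀ ℕ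

/-- All values of `t` are at least `2`, and `∏ λ_{t k}` is the monomial with exponents `μ`. -/
def HasType (t : V → ℕ) (μ : Expo) : Prop :=
  (∀ k, 2 ≤ t k) ∧ ∀ j : {j : ℕ // 2 ≤ j}, (univ.filter fun k => t k = j.1).card = μ j

theorem HasType.congr (v : V ≃ W) {t : V → ℕ} {t' : W → ℕ} (h : ∀ i, t' (v i) = t i) (μ : Expo) :
    HasType t' μ ↔ HasType t μ := by
  unfold HasType
  refine and_congr ⟨fun h' k => h k ▸ h' (v k), fun h' k => ?_⟩ (forall_congr' fun j => ?_)
  · obtain ⟨k, rfl⟩ := v.surjective k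
    rw [h]; exact h' k
  · rw [← card_equiv v (s := univ.filter fun k => t k = j.1) fun k => by simp [h]]

theorem HasType.le_sup {t : V → ℕ} {μ : Expo} (h : HasType t μ) (k : V) :
    t k ≤ μ.support.sup fun j => j.1 := by
  have h1 := h.2 ⟨t k, h.1 k⟩
  have h2 : (⟨t k, h.1 k⟩ : {j : ℕ // 2 ≤ j}) ∈ μ.support := by
    rw [Finsupp.mem_support_iff, ← h1, ← Nat.pos_iff_ne_zero, card_pos]
    exact ⟨k, by simp⟩
  exact Finset.le_sup (f := fun j : {j : ℕ // 2 ≤ j} => j.1) h2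

/-- The index of `λ₂`. -/
abbrev two : {j : ℕ // 2 ≤ j} := ⟨2, le_rfl⟩

/-- The vertex `none` accounts for exactly one factor `λ₂`. The bound on `μ two` makes the truncated
subtraction of exponents faithful. -/
theorem hasType_option (t : Option V → ℕ) (h : t none = 2) (μ : Expo) :
    HasType t μ ↔ 1 ≤ μ two ∧ HasType (fun i => t (some i)) (μ - Finsupp.single two 1) := by
  have hc : ∀ j : {j : ℕ // 2 ≤ j}, (univ.filter fun k => t k = j.1).card =
      (Finsupp.single two 1 : Expo) j + (univ.filter fun i => t (some i) = j.1).card := by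
    intro j
    rw [card_filter_option, h, Finsupp.single_apply]
    congr 1
    exact if_congr (by rw [Subtype.ext_iff]) rfl rfl
  unfold HasType
  simp only [hc, Finsupp.coe_tsub, Pi.sub_apply]
  constructor
  · rintro ⟨h1, h2⟩
    have h3 := h2 two
    rw [Finsupp.single_eq_same] at h3
    exact ⟨by omega, fun i => h1 _, fun j => by have := h2 j; omega⟩
  · rintro ⟨h0, h1, h2⟩
    refine ⟨?_, fun j => ?_⟩
    · rintro (_ | i)
      · exact h.ge
      · exact h1 i
    · have h3 := h2 j
      by_cases hj : j = two
      · subst hj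
        rw [Finsupp.single_eq_same] at h3 ⊢
        omega
      · rw [Finsupp.single_eq_of_ne hj] at h3 ⊢
        omega

theorem card_filter_bump (t : V → ℕ) (k : V) (l : ℕ) :
    (univ.filter fun i => (t + Pi.single k 1 : V → ℕ) i = l).card + (if l = t k then 1 else 0) =
      (univ.filter fun i => t i = l).card + if l = t k + 1 then 1 else 0 := by
  simp only [Finset.card_filter]
  rw [← add_sum_erase _ _ (mem_univ k),
    ← add_sum_erase (a := k) _ (fun i => if t i = l then 1 else 0) (mem_univ k)]
  have h1 : ∑ i ∈ univ.erase k, (if (t + Pi.single k 1 : V → ℕ) i = l then 1 else 0) =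
      ∑ i ∈ univ.erase k, if t i = l then 1 else 0 := by
    refine sum_congr rfl fun i hi => ?_
    have : i ≠ k := (mem_erase.1 hi).1
    simp [this]
  rw [h1]
  have h2 : (t + Pi.single k 1 : V → ℕ) k = t k + 1 := by simp
  rw [h2]
  simp only [eq_comm (b := l)]
  omega

/-- Raising a degree from `j` to `j + 1` replaces one factor `λ_j` by `λ_{j+1}`, as `λ_{j+1} ∂/∂λ_j`
does. -/
theorem hasType_bump (t : V → ℕ) (k : V) (j : ℕ) (hj : 2 ≤ j) (hk : t k = j) (μ : Expo) :
    HasType (t + Pi.single k 1) μ ↔ 1 ≤ μ ⟨j + 1, by omega⟩ ∧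
      HasType t (μ - Finsupp.single ⟨j + 1, by omega⟩ 1 + Finsupp.single ⟨j, hj⟩ 1) := by
  subst hk
  have hs : ∀ (a : ℕ) (ha : 2 ≤ a) (l : {j : ℕ // 2 ≤ j}),
      (Finsupp.single ⟨a, ha⟩ 1 : Expo) l = if l.1 = a then 1 else 0 := by
    intro a ha l
    rw [Finsupp.single_apply]
    exact if_congr (by rw [Subtype.ext_iff, eq_comm]) rfl rfl
  have hc := fun l : {j : ℕ // 2 ≤ j} => card_filter_bump t k l.1
  unfold HasType
  simp only [Finsupp.add_apply, Finsupp.coe_tsub, Pi.sub_apply, hs]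
  constructor
  · rintro ⟨h1, h2⟩
    have h0 : 1 ≤ μ ⟨t k + 1, by omega⟩ := by
      rw [← h2, Nat.one_le_iff_ne_zero, ← Nat.pos_iff_ne_zero, card_pos]
      exact ⟨k, by simp⟩
    refine ⟨h0, fun i => ?_, fun l => ?_⟩
    · by_cases hi : i = k
      · subst hi; exact hj
      · have := h1 i
        simpa [hi] using this
    · have h3 := hc l
      rw [h2] at h3
      by_cases hl : l = ⟨t k + 1, by omega⟩
      · have hl' : l.1 = t k + 1 := by rw [hl]
        rw [← hl] at h0
        simp only [hl', if_true] at h3 ⊢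
        omega
      · have : ¬ l.1 = t k + 1 := fun h => hl (Subtype.ext h)
        simp only [this, if_false] at h3 ⊢
        omega
  · rintro ⟨h0, h1, h2⟩
    refine ⟨fun i => (h1 i).trans (by simp), fun l => ?_⟩
    have h3 := hc l
    rw [h2] at h3
    by_cases hl : l = ⟨t k + 1, by omega⟩
    · have hl' : l.1 = t k + 1 := by rw [hl]
      rw [← hl] at h0
      simp only [hl', if_true] at h3 ⊢
      omega
    · have : ¬ l.1 = t k + 1 := fun h => hl (Subtype.ext h)
      simp only [this, if_false] at h3 ⊢
      omega

/-! ### The sums over matrices -/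

theorem finite_matrix_bound (N : ℕ) : {F : Matrix V V ℕ | ∀ i, dias F i ≤ N}.Finite := by
  have hfin : (Set.univ.pi fun _ : V => Set.univ.pi fun _ : V => Set.Iic N).Finite :=
    Set.Finite.pi fun _ => Set.Finite.pi fun _ => Set.finite_Iic N
  refine hfin.subset fun F hF i _ j _ => ?_
  exact (single_le_sum (f := fun j => F i j) (fun _ _ => Nat.zero_le _) (mem_univ j)).trans (hF i)

theorem finite_vac (μ : Expo) : {F : Matrix V V ℕ | IsVac F ∧ HasType (dias F) μ}.Finite :=
  (finite_matrix_bound (μ.support.sup fun j => j.1)).subset fun _ hF i => hF.2.le_sup i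

theorem finite_bump (μ : Expo) :
    {p : V × Matrix V V ℕ | IsVac p.2 ∧ HasType (dias p.2 + Pi.single p.1 1) μ}.Finite :=
  (Set.finite_univ.prod (finite_matrix_bound (μ.support.sup fun j => j.1))).subset
    fun p hp => ⟨Set.mem_univ _, fun i => le_trans (by simp) (hp.2.le_sup i)⟩

theorem finite_pend (μ : Expo) : {F : Matrix (Option V) (Option V) ℕ | IsVac F ∧
    dias F none = 1 ∧ HasType (fun i => dias F (some i)) μ}.Finite := by
  refine (finite_matrix_bound (max 1 (μ.support.sup fun j => j.1))).subset fun F hF => ?_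
  rintro (_ | i)
  · exact hF.2.1.le.trans (le_max_left _ _)
  · exact (hF.2.2.le_sup i).trans (le_max_right _ _)

/-- The matrices of vacuum graphs that contribute to the monomial `μ`. -/
def vacFin (V : Type) [Fintype V] [DecidableEq V] (μ : Expo) : Finset (Matrix V V ℕ) :=
  (finite_vac μ).toFinset

/-- Vacuum graphs with a chosen vertex that contribute to `μ` when the degree of the chosen vertex
is raised by one. -/
def bumpFin (V : Type) [Fintype V] [DecidableEq V] (μ : Expo) : Finset (V × Matrix V V ℕ) :=
  (finite_bump μ).toFinset

/-- Vacuum graphs in which `none` has degree one and the other vertices contribute to `μ`. -/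
def pendFin (V : Type) [Fintype V] [DecidableEq V] (μ : Expo) :
    Finset (Matrix (Option V) (Option V) ℕ) :=
  (finite_pend μ).toFinset

theorem mem_vacFin {μ : Expo} {F : Matrix V V ℕ} :
    F ∈ vacFin V μ ↔ IsVac F ∧ HasType (dias F) μ := by simp [vacFin]

theorem mem_bumpFin {μ : Expo} {p : V × Matrix V V ℕ} :
    p ∈ bumpFin V μ ↔ IsVac p.2 ∧ HasType (dias p.2 + Pi.single p.1 1) μ := by simp [bumpFin]

theorem mem_pendFin {μ : Expo} {F : Matrix (Option V) (Option V) ℕ} :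
    F ∈ pendFin V μ ↔ IsVac F ∧ dias F none = 1 ∧ HasType (fun i => dias F (some i)) μ := by
  simp [pendFin]

variable (m : ℂ) (logb : ℂ → ℂ) (d lam : ℂ)

/-- Weight times amplitude. -/
def contrib (F : Matrix V V ℕ) : ℂ := matWeight m F * matAmp logb d lam F

theorem contrib_congr (v : V ≃ W) (F : Matrix V V ℕ) (F' : Matrix W W ℕ)
    (hF : ∀ i j, F' (v i) (v j) = F i j) :
    contrib m logb d lam F' = contrib m logb d lam F := by
  rw [contrib, matWeight_congr v m F F' hF, matAmp_congr v logb d lam F F' hF, contrib]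

/-- The sum over all vacuum graphs of type `μ`. -/
def vacSum (V : Type) [Fintype V] [DecidableEq V] (μ : Expo) : ℂ :=
  ∑ F ∈ vacFin V μ, contrib m logb d lam F

/-- The weight of raising the degree of a vertex. -/
def bumpTerm (p : V × Matrix V V ℕ) : ℂ :=
  ((dias p.2 p.1 : ℂ) + 1) * ((dias p.2 p.1 : ℂ) + m) * contrib m logb d lam p.2

def bumpSum (V : Type) [Fintype V] [DecidableEq V] (μ : Expo) : ℂ :=
  ∑ p ∈ bumpFin V μ, bumpTerm m logb d lam p

def pendSum (V : Type) [Fintype V] [DecidableEq V] (μ : Expo) : ℂ :=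
  ∑ F ∈ pendFin V μ, contrib m logb d lam F

/-- The sum over all ways to insert a vertex into an edge of a vacuum graph. -/
def insertSum (V : Type) [Fintype V] [DecidableEq V] (μ : Expo) : ℂ :=
  ∑ F ∈ vacFin V μ, matWeight m F *
    ∑ a, ∑ b, (F a b : ℂ) * matAmp logb d lam (extMat a b (remEdge a b F))

theorem extMat_injective {a b a' b' : V} {H H' : Matrix V V ℕ}
    (h : extMat a b H = extMat a' b' H') : a = a' ∧ b = b' ∧ H = H' := by
  refine ⟨?_, ?_, ?_⟩
  · have := congrFun (congrFun h (some a)) none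
    by_contra hne
    simp [extMat, hne] at this
  · have := congrFun (congrFun h none) (some b)
    by_contra hne
    simp [extMat, hne] at this
  · ext i j
    exact congrFun (congrFun h (some i)) (some j)

/-- Removing the vertex of degree one joins its two edges to one from `a` to `b`. For `a ≠ b` this
yields a vacuum graph with a marked edge, and the weight supplies the factor `F a b`. For `a = b` a
bubble splits off and leaves a vacuum graph with the marked vertex `a`. -/
theorem pendSum_eq (hd : 0 ≤ (1 - d / 2).re) (hl : Complex.exp (logb lam) = lam) (μ : Expo) :
    pendSum m logb d lam V μ =
      insertSum m logb d lam V μ + bubble logb d lam * bumpSum m logb d lam V μ := by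
  classical
  unfold pendSum
  rw [← sum_filter_not_add_sum_filter _
    (fun F : Matrix (Option V) (Option V) ℕ => ∃ a H, F = extMat a a H)]
  congr 1
  · unfold insertSum
    simp only [mul_sum]
    -- Only pairs joined by an edge are kept: there `remEdge` can be undone, so the insertion map
    -- becomes a bijection.
    have h1 : ∀ F ∈ vacFin V μ, ∑ a, ∑ b, matWeight m F * ((F a b : ℂ) *
        matAmp logb d lam (extMat a b (remEdge a b F))) =
        ∑ q ∈ univ.filter (fun q : V × V => F q.1 q.2 ≠ 0), matWeight m F * ((F q.1 q.2 : ℂ) *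
          matAmp logb d lam (extMat q.1 q.2 (remEdge q.1 q.2 F))) := by
      intro F _
      rw [← Fintype.sum_prod_type', sum_filter_of_ne]
      intro q _ hq h0
      simp [h0] at hq
    rw [sum_congr rfl h1, sum_sigma']
    symm
    refine sum_bij (fun x _ => extMat x.2.1 x.2.2 (remEdge x.2.1 x.2.2 x.1)) ?_ ?_ ?_ ?_
    · rintro ⟨F, a, b⟩ hx
      simp only [mem_sigma, mem_vacFin, mem_filter, mem_univ, true_and] at hx
      obtain ⟨⟨hF, ht⟩, h0⟩ := hx
      have hab : a ≠ b := by
        rintro rfl; exact h0 (hF.diag a)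
      have he := addEdge_remEdge a b F h0
      simp only [mem_filter, mem_pendFin]
      refine ⟨⟨?_, dias_extMat_none _ _ _, ?_⟩, ?_⟩
      · rw [isVac_extMat a b hab, he]; exact hF
      · simp only [dias_extMat_some]
        convert ht using 2 with i
        rw [← dias_addEdge a b, he]
      · rintro ⟨c, H, hH⟩
        obtain ⟨h1, h2, -⟩ := extMat_injective hH
        exact hab (h1.trans h2.symm)
    · rintro ⟨F, a, b⟩ hx ⟨F', a', b'⟩ hx' heq
      simp only [mem_sigma, mem_filter, mem_univ, true_and] at hx hx'
      obtain ⟨rfl, rfl, h3⟩ := extMat_injective heq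
      have : F = F' := by
        rw [← addEdge_remEdge _ _ F hx.2, h3, addEdge_remEdge _ _ F' hx'.2]
      subst this
      rfl
    · intro F hF
      simp only [mem_filter, mem_pendFin] at hF
      obtain ⟨⟨hF, h1, ht⟩, hne⟩ := hF
      obtain ⟨a, b, H, rfl⟩ := exists_eq_extMat (hF.diag none) hF.bal h1
      have hne' : a ≠ b := by
        rintro rfl; exact hne ⟨a, H, rfl⟩
      refine ⟨⟨addEdge a b H, a, b⟩, ?_, ?_⟩
      · simp only [mem_sigma, mem_vacFin, mem_filter, mem_univ, true_and]
        refine ⟨⟨(isVac_extMat a b hne' H).1 hF, ?_⟩, by simp [addEdge]⟩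
        convert ht using 2 with i
        rw [dias_extMat_some, dias_addEdge]
      · simp only [remEdge_addEdge]
    · rintro ⟨F, a, b⟩ hx
      simp only [mem_sigma, mem_vacFin, mem_filter, mem_univ, true_and] at hx
      have he := addEdge_remEdge a b F hx.2
      simp only [contrib]
      rw [matWeight_extMat_eq, he]
      have : remEdge a b F a b + 1 = F a b := by
        conv_rhs => rw [← he]
        simp [addEdge]
      rw [this]
      ring
  · unfold bumpSum
    rw [mul_sum]
    symm
    refine sum_bij (fun p _ => extMat p.1 p.1 p.2) ?_ ?_ ?_ ?_
    · rintro ⟨a, H⟩ hp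
      simp only [mem_bumpFin] at hp
      simp only [mem_filter, mem_pendFin]
      refine ⟨⟨(isVac_extMat_self a H).2 hp.1, dias_extMat_none _ _ _, ?_⟩, a, H, rfl⟩
      convert hp.2 using 2 with i
      rw [dias_extMat_some, Pi.add_apply, Pi.single_apply]
    · rintro ⟨a, H⟩ - ⟨a', H'⟩ - heq
      obtain ⟨h1, -, h3⟩ := extMat_injective heq
      exact Prod.ext h1 h3
    · intro F hF
      simp only [mem_filter, mem_pendFin] at hF
      obtain ⟨⟨hF, -, ht⟩, a, H, rfl⟩ := hF
      refine ⟨(a, H), ?_, rfl⟩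
      rw [mem_bumpFin]
      refine ⟨(isVac_extMat_self a H).1 hF, ?_⟩
      convert ht using 2 with i
      rw [dias_extMat_some, Pi.add_apply, Pi.single_apply]
    · rintro ⟨a, H⟩ hp
      simp only [mem_bumpFin] at hp
      simp only [contrib, bumpTerm]
      rw [matWeight_extMat_self m H a (hp.1.diag a), matAmp_extMat_self logb d lam hd hl]
      ring

theorem hasDerivAt_vacSum (hd : 0 ≤ (1 - d / 2).re) (hl : HasDerivAt logb lam⁻¹ lam)
    (hl0 : lam ≠ 0) (μ : Expo) :
    HasDerivAt (fun z => vacSum m logb d z V μ) (-insertSum m logb d lam V μ) lam := by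
  unfold vacSum insertSum contrib
  rw [← sum_neg_distrib]
  refine HasDerivAt.fun_sum fun F hF => ?_
  rw [mem_vacFin] at hF
  have h0 : F ≠ 0 := by
    rintro rfl
    obtain ⟨i⟩ := hF.1.ne
    have := hF.2.1 i
    simp [dias] at this
  have := (hasDerivAt_matAmp logb d lam hd hl hl0 F hF.1 h0).const_mul (matWeight m F)
  refine this.congr_deriv ?_
  ring

/-- The part of `bumpSum` in which the chosen vertex has degree one. -/
theorem bumpSum_one (r : ℕ) (μ : Expo) :
    ∑ p ∈ (bumpFin (Fin (r + 1)) μ).filter (fun p => dias p.2 p.1 = 1), bumpTerm m logb d lam p =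
      (r + 1 : ℕ) * if 1 ≤ μ two then 2 * (1 + m) *
        pendSum m logb d lam (Fin r) (μ - Finsupp.single two 1) else 0 := by
  classical
  have hfib : ∀ k : Fin (r + 1),
      ∑ p ∈ (bumpFin (Fin (r + 1)) μ).filter (fun p => dias p.2 p.1 = 1 ∧ p.1 = k),
        bumpTerm m logb d lam p = if 1 ≤ μ two then 2 * (1 + m) *
        pendSum m logb d lam (Fin r) (μ - Finsupp.single two 1) else 0 := by
    intro k
    -- The chosen vertex `k` is renamed `none`; each of the `r + 1` choices contributes the same
    -- amount. Its degree rises from one to two, which gives `λ₂` and the factor `(1+1)(1+m)`.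
    let v : Fin (r + 1) ≃ Option (Fin r) := finSuccEquiv' k
    have hvk : v.symm none = k := by
      rw [Equiv.symm_apply_eq]; exact (finSuccEquiv'_at k).symm
    have hkey : ∀ F : Matrix (Option (Fin r)) (Option (Fin r)) ℕ,
        (k, F.submatrix v v) ∈ bumpFin (Fin (r + 1)) μ ∧ dias (F.submatrix v v) k = 1 ↔
          1 ≤ μ two ∧ F ∈ pendFin (Fin r) (μ - Finsupp.single two 1) := by
      intro F
      have hF : ∀ i j, F (v i) (v j) = F.submatrix v v i j := fun _ _ => rfl
      have hF' : ∀ i j, F.submatrix v v (v.symm i) (v.symm j) = F i j := fun i j => by simp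
      have hdk : dias (F.submatrix v v) k = dias F none := by
        rw [← hvk]; exact dias_congr v.symm F _ hF' none
      have hvac : IsVac (F.submatrix v v) ↔ IsVac F :=
        ⟨fun h => h.congr v hF, fun h => h.congr v.symm hF'⟩
      have ht : dias F none = 1 → (HasType (dias (F.submatrix v v) + Pi.single k 1) μ ↔
          1 ≤ μ two ∧ HasType (fun i => dias F (some i)) (μ - Finsupp.single two 1)) := by
        intro h1
        rw [← HasType.congr v (t' := dias F + Pi.single none 1), hasType_option]
        · simp
        · simp [h1]
        · intro i
          rw [Pi.add_apply, Pi.add_apply, dias_congr v _ F hF]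
          congr 1
          rw [Pi.single_apply, Pi.single_apply]
          refine if_congr ?_ rfl rfl
          rw [← hvk, Equiv.eq_symm_apply]
      rw [mem_bumpFin, mem_pendFin, hdk]
      simp only
      rw [hvac]
      constructor
      · rintro ⟨⟨h1, h2⟩, h3⟩
        have := (ht h3).1 h2
        exact ⟨this.1, h1, h3, this.2⟩
      · rintro ⟨h0, h1, h3, h2⟩
        exact ⟨⟨h1, (ht h3).2 ⟨h0, h2⟩⟩, h3⟩
    have hback : ∀ F : Matrix (Fin (r + 1)) (Fin (r + 1)) ℕ,
        (F.submatrix v.symm v.symm).submatrix v v = F := by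
      intro F
      ext i j
      simp
    split_ifs with hμ
    · unfold pendSum
      rw [mul_sum]
      symm
      refine sum_bij (fun F _ => (k, F.submatrix v v)) ?_ ?_ ?_ ?_
      · intro F hF
        have := (hkey F).2 ⟨hμ, hF⟩
        rw [mem_filter]
        exact ⟨this.1, this.2, rfl⟩
      · intro F _ F' _ h
        have h1 := (Prod.ext_iff.1 h).2
        ext i j
        have := congrFun (congrFun h1 (v.symm i)) (v.symm j)
        simpa using this
      · rintro ⟨k', F⟩ hp
        rw [mem_filter] at hp
        obtain ⟨h1, h2, rfl⟩ := hp
        refine ⟨F.submatrix v.symm v.symm, ?_, by rw [hback]⟩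
        refine ((hkey _).1 ?_).2
        rw [hback]
        exact ⟨h1, h2⟩
      · intro F hF
        have := (hkey F).2 ⟨hμ, hF⟩
        simp only [bumpTerm, this.2]
        rw [contrib_congr m logb d lam v (F.submatrix v v) F fun _ _ => rfl]
        push_cast
        ring
    · refine sum_eq_zero ?_
      rintro ⟨k', F⟩ hp
      exfalso
      rw [mem_filter] at hp
      obtain ⟨h1, h2, rfl⟩ := hp
      refine hμ ((hkey (F.submatrix v.symm v.symm)).1 ?_).1
      rw [hback]
      exact ⟨h1, h2⟩
  rw [← sum_fiberwise (g := fun p => p.1)]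
  simp only [filter_filter, hfib]
  rw [sum_const, card_univ, Fintype.card_fin, nsmul_eq_mul]

/-- The part of `bumpSum` in which the chosen vertex has degree `j ≥ 2`. -/
theorem bumpSum_ge (j : ℕ) (hj : 2 ≤ j) (μ : Expo) :
    ∑ p ∈ (bumpFin V μ).filter (fun p => dias p.2 p.1 = j), bumpTerm m logb d lam p =
      if 1 ≤ μ ⟨j + 1, by omega⟩ then ((j : ℂ) + 1) * ((j : ℂ) + m) *
        (((μ - Finsupp.single ⟨j + 1, by omega⟩ 1 : Expo) ⟨j, hj⟩ + 1 : ℕ) *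
          vacSum m logb d lam V
            (μ - Finsupp.single ⟨j + 1, by omega⟩ 1 + Finsupp.single ⟨j, hj⟩ 1)) else 0 := by
  classical
  have hkey : ∀ (k : V) (F : Matrix V V ℕ), ((k, F) ∈ bumpFin V μ ∧ dias F k = j) ↔
      1 ≤ μ ⟨j + 1, by omega⟩ ∧ F ∈ vacFin V
        (μ - Finsupp.single ⟨j + 1, by omega⟩ 1 + Finsupp.single ⟨j, hj⟩ 1) ∧ dias F k = j := by
    intro k F
    rw [mem_bumpFin, mem_vacFin]
    constructor
    · rintro ⟨⟨h1, h2⟩, h3⟩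
      have := (hasType_bump (dias F) k j hj h3 μ).1 h2
      exact ⟨this.1, ⟨h1, this.2⟩, h3⟩
    · rintro ⟨h0, ⟨h1, h2⟩, h3⟩
      exact ⟨⟨h1, (hasType_bump (dias F) k j hj h3 μ).2 ⟨h0, h2⟩⟩, h3⟩
  split_ifs with hμ
  · set ν := μ - Finsupp.single ⟨j + 1, by omega⟩ 1 + Finsupp.single ⟨j, hj⟩ 1 with hν
    unfold vacSum
    -- The exponent of `λ_j` in the monomial `ν` is the number of vertices of degree `j`, so the
    -- factor from `∂/∂λ_j` is a choice of such a vertex.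
    have h1 : ∀ F ∈ vacFin V ν, (((μ - Finsupp.single ⟨j + 1, by omega⟩ 1 : Expo) ⟨j, hj⟩ + 1 : ℕ) :
        ℂ) * contrib m logb d lam F =
        ∑ k ∈ univ.filter (fun k => dias F k = j), contrib m logb d lam F := by
      intro F hF
      rw [mem_vacFin] at hF
      rw [sum_const, nsmul_eq_mul, hF.2.2 ⟨j, hj⟩, hν, Finsupp.add_apply, Finsupp.single_eq_same]
    rw [mul_sum, sum_congr rfl h1, mul_sum, sum_congr rfl fun F _ => mul_sum _ _ _, sum_sigma']
    refine sum_bij' (fun p _ => ⟨p.2, p.1⟩) (fun x _ => (x.2, x.1)) ?_ ?_ ?_ ?_ ?_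
    · rintro ⟨k, F⟩ hp
      rw [mem_filter] at hp
      have := ((hkey k F).1 hp).2
      simpa using this
    · rintro ⟨F, k⟩ hx
      simp only [mem_sigma, mem_filter, mem_univ, true_and] at hx
      rw [mem_filter]
      exact (hkey k F).2 ⟨hμ, hx⟩
    · intros; rfl
    · intros; rfl
    · rintro ⟨k, F⟩ hp
      rw [mem_filter] at hp
      simp only [bumpTerm]
      rw [hp.2]
  · refine sum_eq_zero ?_
    rintro ⟨k, F⟩ hp
    rw [mem_filter] at hp
    exact absurd ((hkey k F).1 hp).1 hμ

end PhiFour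

end

noncomputable section

namespace PhiFour

open Finset Multidigraph

/-! ### Coefficients of the contributions -/

theorem coeff_vertexFactor {r : ℕ} (t : Fin r → ℕ) (μ : Expo) [Decidable (HasType t μ)] :
    MvPowerSeries.coeff μ (vertexFactor t) = if HasType t μ then (-1) ^ r else 0 := by
  classical
  by_cases h2 : ∀ k, 2 ≤ t k
  · have e1 : vertexFactor t = MvPowerSeries.monomial
        (∑ k, Finsupp.single (⟨t k, h2 k⟩ : {j : ℕ // 2 ≤ j}) 1) ((-1 : ℂ) ^ r) := by
      have e2 : vertexFactor t = ∏ k, MvPowerSeries.monomial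
          (Finsupp.single (⟨t k, h2 k⟩ : {j : ℕ // 2 ≤ j}) 1) (-1 : ℂ) := by
        refine prod_congr rfl fun k _ => ?_
        simp [coupling, h2 k, MvPowerSeries.X]
      rw [e2, MvPowerSeries.prod_monomial]
      simp
    rw [e1, MvPowerSeries.coeff_monomial]
    refine if_congr ?_ rfl rfl
    have hv : ∀ j : {j : ℕ // 2 ≤ j}, (∑ k, Finsupp.single (⟨t k, h2 k⟩ : {j : ℕ // 2 ≤ j}) 1) j =
        (univ.filter fun k => t k = j.1).card := by
      intro j
      rw [Finsupp.finsetSum_apply, card_filter]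
      refine sum_congr rfl fun k _ => ?_
      rw [Finsupp.single_apply]
      exact if_congr (by rw [Subtype.ext_iff]) rfl rfl
    constructor
    · rintro rfl
      exact ⟨h2, fun j => (hv j).symm⟩
    · intro h
      ext j
      rw [hv, h.2]
  · rw [if_neg fun h => h2 h.1]
    push Not at h2
    obtain ⟨k, hk⟩ := h2
    have : vertexFactor t = 0 :=
      prod_eq_zero (mem_univ k) (by simp [coupling, Nat.not_le.mpr hk])
    simp [this]

theorem card_qa_fiber {r p : ℕ} (t : Fin r → ℕ) (i : Fin r ⊕ Fin p) :
    (univ.filter fun s : Slot t p => qa s = i).card = Sum.elim t (fun _ => 1) i := by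
  rcases i with k | k
  · rw [Sum.elim_inl, ← card_slot_fiber t k, card_filter, card_filter, Fintype.sum_sum_type]
    simp [qa]
  · rw [Sum.elim_inr, card_filter, Fintype.sum_sum_type]
    simp [qa]

/-- The zero diagonal of `F` makes the permutation loopfree, so it moves the outer slot; with at
most one outer slot the condition on different cycles is vacuous. -/
theorem mem_WS_iff {r p : ℕ} (hp : p ≤ 1) {F : Matrix (Fin r ⊕ Fin p) (Fin r ⊕ Fin p) ℕ}
    (hF : F ∈ MF r p 1) (σ : Equiv.Perm (Slot (dia F) p)) : σ ∈ WS F ↔ pAdj qa σ = F := by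
  constructor
  · exact fun h => h.2
  · intro h
    have hdiag : ∀ s, qa s ≠ qa (σ s) := by
      intro s hs
      have h1 : pAdj qa σ (qa s) (qa s) = 0 :=
        (congrFun (congrFun h (qa s)) (qa s)).trans (hF.1.1 (qa s))
      rw [pAdj, card_eq_zero] at h1
      have : s ∈ univ.filter (fun s' => qa s' = qa s ∧ qa (σ s') = qa s) := by
        simp [hs.symm]
      rw [h1] at this
      simp at this
    refine ⟨⟨hdiag, ⟨fun k hk => hdiag (Sum.inr k) (by rw [hk]), fun k l hkl => ?_⟩, ?_⟩, h⟩
    · have := k.2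
      have := l.2
      exact absurd (Fin.ext (by omega)) hkl
    · change pAdj qa σ ∈ MF r p 1
      rw [h]; exact hF

theorem permWeight_qa {r p : ℕ} (m : ℂ) {F : Matrix (Fin r ⊕ Fin p) (Fin r ⊕ Fin p) ℕ}
    (hF : F ∈ MF r p 1) : permWeight (X := Slot (dia F) p) qa m F = matWeight m F := by
  refine permWeight_eq_matWeight _ m F fun i => ?_
  rw [card_qa_fiber]
  rcases i with k | k
  · rfl
  · exact (hF.2.2.1 k).symm

theorem wei_zero {r : ℕ} (m : ℂ) {F : Matrix (Fin r ⊕ Fin 0) (Fin r ⊕ Fin 0) ℕ}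
    (hF : F ∈ MF r 0 1) : wei F m = matWeight m F := by
  rw [← permWeight_qa m hF]
  unfold wei permWeight
  refine sum_congr ?_ fun σ _ => by simp
  ext σ
  simp only [mem_filter, mem_univ, true_and]
  exact mem_WS_iff zero_le_one hF σ

/-- This is why the theorem concerns `m` times the series. The outer slot guarantees a cycle, so the
truncated exponent `cycn σ - 1` is exact. -/
theorem wei_one {r : ℕ} (m : ℂ) {F : Matrix (Fin r ⊕ Fin 1) (Fin r ⊕ Fin 1) ℕ}
    (hF : F ∈ MF r 1 1) : m * wei F m = matWeight m F := by
  rw [← permWeight_qa m hF]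
  unfold wei permWeight
  rw [mul_sum]
  refine sum_congr ?_ fun σ _ => ?_
  · ext σ
    simp only [mem_filter, mem_univ, true_and]
    exact mem_WS_iff le_rfl hF σ
  have : 0 < cycn σ := by
    unfold cycn
    have : Nonempty (Quotient (Equiv.Perm.SameCycle.setoid σ)) := ⟨Quotient.mk _ (Sum.inr 0)⟩
    exact Nat.card_pos
  rw [← pow_succ', Nat.sub_add_cancel this]

/-! ### Splitting outer vertices -/

section Pr

variable {I O E : Type} [Fintype I] [Fintype O] [Fintype E] [DecidableEq I] [DecidableEq O]
  [DecidableEq E]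

theorem adj_pr_inl (G : Multidigraph (I ⊕ O) E) (i : I ⊕ O) (j : I) :
    G.pr.adj (Sum.inl i) (Sum.inl (Sum.inl j)) = G.adj i (Sum.inl j) := by
  unfold adj
  congr 1
  ext e
  rcases h : G.en e with k | k <;> simp [pr, h]

theorem adj_pr_inr (G : Multidigraph (I ⊕ O) E) (i : I ⊕ O) (o : O) :
    G.pr.adj (Sum.inl i) (Sum.inr o) = G.adj i (Sum.inr o) := by
  unfold adj
  congr 1
  ext e
  rcases h : G.en e with k | k <;> simp [pr, h]

theorem adj_pr_out (G : Multidigraph (I ⊕ O) E) (i : I ⊕ O) (o : O) :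
    G.pr.adj (Sum.inl i) (Sum.inl (Sum.inr o)) = 0 := by
  unfold adj
  rw [card_eq_zero, filter_eq_empty_iff]
  intro e _
  rcases h : G.en e with k | k <;> simp [pr, h]

theorem adj_pr_in (G : Multidigraph (I ⊕ O) E) (o : O) (x : (I ⊕ O) ⊕ O) :
    G.pr.adj (Sum.inr o) x = 0 := by
  unfold adj
  rw [card_eq_zero, filter_eq_empty_iff]
  intro e _
  simp [pr]

end Pr

theorem amplitude_pr_zero {r : ℕ} (logb : ℂ → ℂ) (d lam : ℂ)
    (F : Matrix (Fin r ⊕ Fin 0) (Fin r ⊕ Fin 0) ℕ) :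
    (ofMatrix F).pr.amplitude logb d lam = matAmp logb d lam F := by
  refine amplitude_congr (ofMatrix F) (ofMatrix F).pr (Equiv.sumEmpty _ _).symm ?_ logb d lam
  rintro i (j | j)
  · exact adj_pr_inl _ i j
  · exact j.elim0

/-- The vertices of a graph with one outer vertex. -/
def outerEquiv (r : ℕ) : Option (Fin r) ≃ Fin r ⊕ Fin 1 :=
  (Equiv.optionEquivSumPUnit.{0} (Fin r)).trans
    (Equiv.sumCongr (Equiv.refl _) (Equiv.ofUnique _ _))

@[simp] theorem outerEquiv_none (r : ℕ) : outerEquiv r none = Sum.inr 0 := rfl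

@[simp] theorem outerEquiv_some (r : ℕ) (i : Fin r) : outerEquiv r (some i) = Sum.inl i := rfl

/-- The matrix of the unclosable graph in which the outer vertex is attached to `p.1`. -/
def unclMat {r : ℕ} (p : Fin r × Matrix (Fin r) (Fin r) ℕ) :
    Matrix (Fin r ⊕ Fin 1) (Fin r ⊕ Fin 1) ℕ :=
  (extMat p.1 p.1 p.2).submatrix (outerEquiv r).symm (outerEquiv r).symm

theorem unclMat_apply {r : ℕ} (p : Fin r × Matrix (Fin r) (Fin r) ℕ) (i j : Option (Fin r)) :
    unclMat p (outerEquiv r i) (outerEquiv r j) = extMat p.1 p.1 p.2 i j := by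
  simp [unclMat]

theorem unclMat_injective {r : ℕ} : Function.Injective (unclMat (r := r)) := by
  intro p p' h
  have : extMat p.1 p.1 p.2 = extMat p'.1 p'.1 p'.2 := by
    ext i j
    rw [← unclMat_apply, h, unclMat_apply]
  obtain ⟨h1, -, h2⟩ := extMat_injective this
  exact Prod.ext h1 h2

/-- After the splitting, the two copies of the outer vertex hang on pendant edges at the same inner
vertex. Each edge contributes `lam⁻¹`. -/
theorem amplitude_pr_one {r : ℕ} (logb : ℂ → ℂ) (d lam : ℂ) (hl0 : lam ≠ 0) {E : Type} [Fintype E]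
    [DecidableEq E] (G : Multidigraph (Fin r ⊕ Fin 1) E) (p : Fin r × Matrix (Fin r) (Fin r) ℕ)
    (hG : G.adj = unclMat p) :
    lam ^ 2 * G.pr.amplitude logb d lam = matAmp logb d lam p.2 := by
  obtain ⟨k, H⟩ := p
  -- First the edge from the outgoing copy to `k` is added, then in `Gpend` the edge from `k` to the
  -- ingoing copy.
  let Gout : Multidigraph (Option (Fin r)) (Option (Σ ij : Fin r × Fin r, Fin (H ij.1 ij.2))) :=
    { st := fun e => e.elim none fun e => some ((ofMatrix H).st e)
      en := fun e => e.elim (some k) fun e => some ((ofMatrix H).en e) }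
  let Gpend : Multidigraph (Option (Option (Fin r)))
      (Option (Option (Σ ij : Fin r × Fin r, Fin (H ij.1 ij.2)))) :=
    { st := fun e => e.elim (some (some k)) fun e => some (Gout.st e)
      en := fun e => e.elim none fun e => some (Gout.en e) }
  have h1 : Gout.amplitude logb d lam = lam⁻¹ * matAmp logb d lam H :=
    amplitude_pendant (ofMatrix H) Gout k (fun _ => rfl) (fun _ => rfl) (Or.inr ⟨rfl, rfl⟩) _ _ _
  have h2 : Gpend.amplitude logb d lam = lam⁻¹ * Gout.amplitude logb d lam :=
    amplitude_pendant Gout Gpend (some k) (fun _ => rfl) (fun _ => rfl) (Or.inl ⟨rfl, rfl⟩) _ _ _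
  let v : Option (Option (Fin r)) ≃ (Fin r ⊕ Fin 1) ⊕ Fin 1 :=
    (Equiv.optionCongr (outerEquiv r)).trans ((Equiv.optionEquivSumPUnit.{0} (Fin r ⊕ Fin 1)).trans
      (Equiv.sumCongr (Equiv.refl _) (Equiv.ofUnique _ _)))
  have v0 : v none = Sum.inr 0 := rfl
  have v1 : ∀ i, v (some i) = Sum.inl (outerEquiv r i) := fun _ => rfl
  have hadjH : ∀ i j, (univ.filter fun e => (ofMatrix H).st e = i ∧ (ofMatrix H).en e = j).card =
      H i j := fun i j => congrFun (congrFun (adj_ofMatrix H) i) j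
  have hP : ∀ x y, Gpend.adj x y = (if some (some k) = x ∧ none = y then 1 else 0) +
      ((if some none = x ∧ some (some k) = y then 1 else 0) +
      (univ.filter fun e => some (some ((ofMatrix H).st e)) = x ∧
        some (some ((ofMatrix H).en e)) = y).card) := by
    intro x y
    unfold adj
    rw [card_filter_option, card_filter_option]
    rfl
  have h3 : G.pr.amplitude logb d lam = Gpend.amplitude logb d lam := by
    refine amplitude_congr Gpend G.pr v ?_ logb d lam
    rintro (_ | x) y
    · rw [v0, adj_pr_in, hP]
      simp
    · rcases y with _ | _ | j
      · rw [v1, v0, adj_pr_inr, hG, ← outerEquiv_none, unclMat_apply, hP]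
        rcases x with _ | i <;> simp [extMat, eq_comm]
      · rw [v1, v1, outerEquiv_none, adj_pr_out, hP]
        simp
      · rw [v1, v1, outerEquiv_some, adj_pr_inl, hG, ← outerEquiv_some, unclMat_apply, hP]
        rcases x with _ | i
        · simp [extMat, eq_comm]
        · simp [extMat, hadjH]
  rw [h3, h2, h1]
  field_simp

end PhiFour

end

noncomputable section

namespace PhiFour

open Finset Multidigraph

/-! ### The vacuum series -/

theorem vacSum_congr {V W : Type} [Fintype V] [Fintype W] [DecidableEq V] [DecidableEq W]
    (m : ℂ) (logb : ℂ → ℂ) (d lam : ℂ) (v : V ≃ W) (μ : Expo) :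
    vacSum m logb d lam W μ = vacSum m logb d lam V μ := by
  unfold vacSum
  refine (sum_bij' (fun F _ => F.submatrix v.symm v.symm) (fun F _ => F.submatrix v v)
    ?_ ?_ ?_ ?_ ?_).symm
  · intro F hF
    have h : ∀ i j, F.submatrix v.symm v.symm (v i) (v j) = F i j := by simp
    rw [mem_vacFin] at hF ⊢
    exact ⟨hF.1.congr v h, (HasType.congr v (dias_congr v _ _ h) μ).2 hF.2⟩
  · intro F hF
    have h : ∀ i j, F.submatrix v v (v.symm i) (v.symm j) = F i j := by simp
    rw [mem_vacFin] at hF ⊢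
    exact ⟨hF.1.congr v.symm h, (HasType.congr v.symm (dias_congr v.symm _ _ h) μ).2 hF.2⟩
  · intro F _; simp
  · intro F _; simp
  · intro F _
    exact (contrib_congr m logb d lam v F _ (by simp)).symm

theorem MF_mono {r p w w' : ℕ} (h : w ≤ w') : MF r p w' ⊆ MF r p w :=
  fun _ hF => ⟨hF.1, fun k => h.trans (hF.2.1 k), hF.2.2⟩

theorem hasType_dia {r : ℕ} (F : Matrix (Fin r ⊕ Fin 0) (Fin r ⊕ Fin 0) ℕ) (μ : Expo) :
    HasType (dias F) μ ↔ HasType (dia F) μ :=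
  HasType.congr (Equiv.sumEmpty (Fin r) (Fin 0)).symm (t := dia F) (t' := dias F)
    (fun _ => rfl) μ

open Classical in
theorem coeff_FCmat {r : ℕ} (m : ℂ) (logb : ℂ → ℂ) (d lam : ℂ)
    {F : Matrix (Fin r ⊕ Fin 0) (Fin r ⊕ Fin 0) ℕ} (hF : F ∈ MF r 0 1) (μ : Expo) :
    MvPowerSeries.coeff μ (FCmat logb m d lam F) =
      if HasType (dias F) μ then (-1) ^ r * contrib m logb d lam F else 0 := by
  rw [FCmat, MvPowerSeries.coeff_C_mul, coeff_vertexFactor, wei_zero m hF,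
    if_congr (hasType_dia F μ) rfl rfl, contrib, ← amplitude_pr_zero]
  unfold Multidigraph.amplitude
  split_ifs <;> ring

theorem coeff_formalSum_FCmat (m : ℂ) (logb : ℂ → ℂ) (d lam : ℂ) (r : ℕ) (μ : Expo) :
    MvPowerSeries.coeff μ (formalSum fun F : MF r 0 2 => FCmat logb m d lam F.1) =
      (-1) ^ r * vacSum m logb d lam (Fin r) μ := by
  classical
  rw [vacSum_congr m logb d lam (Equiv.sumEmpty (Fin r) (Fin 0)), vacSum, mul_sum]
  change ∑ᶠ F : MF r 0 2, MvPowerSeries.coeff μ (FCmat logb m d lam F.1) = _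
  rw [finsum_set_coe_eq_finsum_mem (MF r 0 2)
    (f := fun F => MvPowerSeries.coeff μ (FCmat logb m d lam F)),
    finsum_cond_eq_sum_of_cond_iff (p := fun F => F ∈ MF r 0 2)
      (t := vacFin (Fin r ⊕ Fin 0) μ)]
  · refine sum_congr rfl fun F hF => ?_
    rw [mem_vacFin] at hF
    rw [coeff_FCmat m logb d lam ((mem_MF_iff le_rfl F).2
      ⟨hF.1, fun k => one_le_two.trans (hF.2.1 _), fun k => k.elim0⟩), if_pos hF.2]
  · intro F hne
    rw [mem_vacFin]
    constructor
    · intro hF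
      refine ⟨((mem_MF_iff one_le_two F).1 hF).1, ?_⟩
      by_contra hT
      exact hne (by rw [coeff_FCmat m logb d lam (MF_mono one_le_two hF), if_neg hT])
    · rintro ⟨h1, h2⟩
      exact (mem_MF_iff one_le_two F).2 ⟨h1, fun k => h2.1 _, fun k => k.elim0⟩

/-- A loopfree graph on one vertex has no edge, against degree at least two. The restriction `2 ≤ r`
in `gammaZero` therefore loses nothing. -/
theorem vacSum_eq_zero (m : ℂ) (logb : ℂ → ℂ) (d lam : ℂ) {r : ℕ} (hr : r < 2) (μ : Expo) :
    vacSum m logb d lam (Fin r) μ = 0 := by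
  rw [vacSum, sum_eq_zero]
  intro F hF
  rw [mem_vacFin] at hF
  obtain ⟨i⟩ := hF.1.ne
  have h1 := hF.2.1 i
  have : dias F i = 0 := by
    refine sum_eq_zero fun j _ => ?_
    have : j = i := Fin.ext (by omega)
    rw [this, hF.1.diag]
  omega

theorem coeff_gammaZero (m : ℂ) (logb : ℂ → ℂ) (d lam : ℂ) (μ : Expo) :
    MvPowerSeries.coeff μ (gammaZero logb m d lam) =
      1 / (μ.degree.factorial : ℂ) * (-1) ^ μ.degree *
        vacSum m logb d lam (Fin μ.degree) μ := by
  have hc : ∀ r, MvPowerSeries.coeff μ (gammaZeroOrder logb m d lam r) =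
      1 / (r.factorial : ℂ) * (-1) ^ r * vacSum m logb d lam (Fin r) μ := by
    intro r
    rw [gammaZeroOrder, MvPowerSeries.coeff_C_mul, coeff_formalSum_FCmat, mul_assoc]
  change ∑ᶠ r : {r : ℕ // 2 ≤ r}, MvPowerSeries.coeff μ (gammaZeroOrder logb m d lam r.1) = _
  rw [finsum_subtype_eq_finsum_cond (fun r : ℕ => 2 ≤ r)
    (f := fun r => MvPowerSeries.coeff μ (gammaZeroOrder logb m d lam r)),
    finsum_cond_eq_sum_of_cond_iff (p := fun r : ℕ => 2 ≤ r)
      (t := ({μ.degree} : Finset ℕ).filter fun r => 2 ≤ r), sum_filter, sum_singleton]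
  · split_ifs with h
    · exact hc _
    · rw [vacSum_eq_zero m logb d lam (not_le.1 h), mul_zero]
  · intro r hr
    obtain ⟨F, hF⟩ := coeff_order_ne hr
    simp [(coeff_vertexFactor_ne _ _ _ hF).1]

/-! ### Unclosable graphs -/

variable {r : ℕ}

theorem iso_iff_adj {r p : ℕ} {G H : PGraph r p} :
    Iso G H ↔ ∃ (a : Equiv.Perm (Fin r)) (b : Equiv.Perm (Fin p)),
      ∀ i j, H.2.adj (Sum.map a b i) (Sum.map a b j) = G.2.adj i j := by
  constructor
  · rintro ⟨a, b, c, hc⟩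
    refine ⟨a, b, fun i j => (card_equiv c fun e => ?_).symm⟩
    have hinj : Function.Injective (Sum.map a b) := (Equiv.sumCongr a b).injective
    simp [(hc e).1, (hc e).2, hinj.eq_iff]
  · rintro ⟨a, b, h⟩
    obtain ⟨c, hc⟩ := exists_edge_equiv G.2 H.2 (Equiv.sumCongr a b) h
    exact ⟨a, b, c, hc⟩

/-- Renumbering the vertices of a matrix with a chosen vertex. -/
def permPt (a : Equiv.Perm (Fin r)) (p : Fin r × Matrix (Fin r) (Fin r) ℕ) :
    Fin r × Matrix (Fin r) (Fin r) ℕ := (a.symm p.1, p.2.submatrix a a)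

theorem unclMat_permPt (a : Equiv.Perm (Fin r)) (b : Equiv.Perm (Fin 1))
    (p : Fin r × Matrix (Fin r) (Fin r) ℕ) :
    unclMat (permPt a p) = fun i j => unclMat p (Sum.map a b i) (Sum.map a b j) := by
  have hb : ∀ i, Sum.map a b (outerEquiv r i) = outerEquiv r (i.map a) := by
    rintro (_ | i)
    · simp [Subsingleton.elim (b 0) 0]
    · simp
  ext i j
  obtain ⟨i, rfl⟩ := (outerEquiv r).surjective i
  obtain ⟨j, rfl⟩ := (outerEquiv r).surjective j
  rw [hb, hb, unclMat_apply, unclMat_apply]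
  rcases i with _ | i <;> rcases j with _ | j <;>
    simp [extMat, permPt, Equiv.eq_symm_apply]

theorem isVac_unclMat (p : Fin r × Matrix (Fin r) (Fin r) ℕ) :
    IsVac (unclMat p) ↔ IsVac p.2 := by
  rw [← isVac_extMat_self p.1]
  exact ⟨fun h => h.congr (outerEquiv r).symm (by simp [unclMat]),
    fun h => h.congr (outerEquiv r) (unclMat_apply p)⟩

theorem dias_unclMat_inl (p : Fin r × Matrix (Fin r) (Fin r) ℕ) (k : Fin r) :
    dias (unclMat p) (Sum.inl k) = (dias p.2 + Pi.single p.1 1 : Fin r → ℕ) k := by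
  rw [← outerEquiv_some, dias_congr (outerEquiv r) _ _ (unclMat_apply p), dias_extMat_some,
    Pi.add_apply, Pi.single_apply]

theorem dias_unclMat_inr (p : Fin r × Matrix (Fin r) (Fin r) ℕ) (k : Fin 1) :
    dias (unclMat p) (Sum.inr k) = 1 := by
  rw [Subsingleton.elim k 0, ← outerEquiv_none,
    dias_congr (outerEquiv r) _ _ (unclMat_apply p), dias_extMat_none]

theorem unclMat_mem_MF {w : ℕ} (hw : 1 ≤ w) (p : Fin r × Matrix (Fin r) (Fin r) ℕ) :
    unclMat p ∈ MF r 1 w ↔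
      IsVac p.2 ∧ ∀ k, w ≤ (dias p.2 + Pi.single p.1 1 : Fin r → ℕ) k := by
  rw [mem_MF_iff hw, isVac_unclMat]
  simp only [dias_unclMat_inl, dias_unclMat_inr, implies_true, and_true]

/-- The neighbours of the outer vertex along its incoming and outgoing edges coincide precisely when
the matrix is `extMat a b H` with `a = b`. -/
theorem isUnclosable_iff {G : PGraph r 1} (hG : IsGF 2 G) :
    IsUnclosable G ↔ ∃ p, G.2.adj = unclMat p := by
  have hM := (mem_MF_iff one_le_two _).1 ((isGF_iff one_le_two ⟨Sum.inr 0⟩ G).1 hG)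
  constructor
  · rintro ⟨x, y, hx, hy, hxy⟩
    let F := G.2.adj.submatrix (outerEquiv r) (outerEquiv r)
    have hF : ∀ i j, F ((outerEquiv r).symm i) ((outerEquiv r).symm j) = G.2.adj i j := by
      simp [F]
    have hV : IsVac F := hM.1.congr (outerEquiv r).symm hF
    obtain ⟨a, b, H, h⟩ := exists_eq_extMat (hV.diag none) hV.bal
      ((dias_congr (outerEquiv r).symm _ _ hF (Sum.inr 0)).trans (hM.2.2 0))
    obtain ⟨k, hk⟩ := (outerEquiv r).surjective (G.2.en x)
    have h1 : F none k ≠ 0 := (adj_ne_zero_iff G.2 _ _).2 ⟨x, hx, hk.symm⟩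
    have h2 : F k none ≠ 0 := (adj_ne_zero_iff G.2 _ _).2 ⟨y, hxy.symm.trans hk.symm, hy⟩
    rw [h] at h1 h2
    rcases k with _ | k
    · exact absurd rfl h1
    · have hb : k = b := by
        by_contra hne
        exact h1 (if_neg hne)
      have ha : k = a := by
        by_contra hne
        exact h2 (if_neg hne)
      refine ⟨(k, H), ?_⟩
      rw [← ha, ← hb] at h
      ext i j
      rw [← hF, h]
      rfl
  · rintro ⟨p, hp⟩
    obtain ⟨x, hx, hx'⟩ := (adj_ne_zero_iff G.2 (Sum.inr 0) (Sum.inl p.1)).1 (by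
      rw [hp, ← outerEquiv_none, ← outerEquiv_some, unclMat_apply]
      simp [extMat])
    obtain ⟨y, hy, hy'⟩ := (adj_ne_zero_iff G.2 (Sum.inl p.1) (Sum.inr 0)).1 (by
      rw [hp, ← outerEquiv_none, ← outerEquiv_some, unclMat_apply]
      simp [extMat])
    exact ⟨x, y, hx, hy', hx'.trans hy.symm⟩

/-- A graph with prescribed adjacency matrix. -/
def graphOf {r p : ℕ} (F : Matrix (Fin r ⊕ Fin p) (Fin r ⊕ Fin p) ℕ) : PGraph r p :=
  ⟨_, { st := fun e => (ofMatrix F).st ((Fintype.equivFin _).symm e)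
        en := fun e => (ofMatrix F).en ((Fintype.equivFin _).symm e) }⟩

theorem adj_graphOf {r p : ℕ} (F : Matrix (Fin r ⊕ Fin p) (Fin r ⊕ Fin p) ℕ) :
    (graphOf F).2.adj = F := by
  refine Eq.trans ?_ (adj_ofMatrix F)
  ext i j
  refine card_equiv (Fintype.equivFin _).symm fun e => ?_
  constructor <;> exact fun h => mem_filter.2 ⟨mem_univ _, (mem_filter.1 h).2⟩

/-- The isomorphism class of the unclosable graph obtained by attaching an outer vertex. -/
def unclClass (p : Fin r × Matrix (Fin r) (Fin r) ℕ) : Quotient (graphSetoid r 1) :=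
  Quotient.mk _ (graphOf (unclMat p))

theorem unclClass_eq_iff (p : Fin r × Matrix (Fin r) (Fin r) ℕ) (G : PGraph r 1) :
    unclClass p = Quotient.mk _ G ↔ ∃ (a : Equiv.Perm (Fin r)) (b : Equiv.Perm (Fin 1)),
      unclMat p = fun i j => G.2.adj (Sum.map a b i) (Sum.map a b j) := by
  refine Quotient.eq.trans (iso_iff_adj.trans ?_)
  simp only [adj_graphOf]
  refine exists_congr fun a => exists_congr fun b => ⟨fun h => ?_, fun h i j => ?_⟩
  · ext i j; rw [h]
  · rw [h]

theorem adj_eq_of_unclClass_eq {p : Fin r × Matrix (Fin r) (Fin r) ℕ} {G : PGraph r 1}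
    (h : unclClass p = Quotient.mk _ G) : ∃ a, G.2.adj = unclMat (permPt a p) := by
  obtain ⟨a, b, h⟩ := (unclClass_eq_iff p G).1 h
  refine ⟨a.symm, ?_⟩
  rw [unclMat_permPt _ b.symm, h]
  ext i j
  simp [Sum.map_map]

theorem permPt_mem_bumpFin {a : Equiv.Perm (Fin r)} {p : Fin r × Matrix (Fin r) (Fin r) ℕ}
    {μ : Expo} (h : p ∈ bumpFin (Fin r) μ) : permPt a p ∈ bumpFin (Fin r) μ := by
  rw [mem_bumpFin] at h ⊢
  have hF : ∀ i j, (permPt a p).2 (a.symm i) (a.symm j) = p.2 i j := by simp [permPt]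
  refine ⟨h.1.congr a.symm hF, (HasType.congr a.symm (fun i => ?_) μ).2 h.2⟩
  rw [Pi.add_apply, dias_congr a.symm _ _ hF, Pi.add_apply]
  simp [permPt, Pi.single_apply]

theorem bumpTerm_permPt (m : ℂ) (logb : ℂ → ℂ) (d lam : ℂ) (a : Equiv.Perm (Fin r))
    (p : Fin r × Matrix (Fin r) (Fin r) ℕ) :
    bumpTerm m logb d lam (permPt a p) = bumpTerm m logb d lam p := by
  have hF : ∀ i j, (permPt a p).2 (a.symm i) (a.symm j) = p.2 i j := by simp [permPt]
  rw [bumpTerm, contrib_congr m logb d lam a.symm _ _ hF]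
  change ((dias (permPt a p).2 (a.symm p.1) : ℂ) + 1) *
    ((dias (permPt a p).2 (a.symm p.1) : ℂ) + m) * _ = _
  rw [dias_congr a.symm _ _ hF, bumpTerm]

theorem ind_of_adj_eq {G : PGraph r 1} {p : Fin r × Matrix (Fin r) (Fin r) ℕ}
    (hG : G.2.adj = unclMat p) (hp : IsVac p.2) :
    (fun k => G.2.ind (Sum.inl k)) = (dias p.2 + Pi.single p.1 1 : Fin r → ℕ) := by
  ext k
  rw [← sum_adj_col, hG, ((isVac_unclMat p).2 hp).bal (Sum.inl k)]
  exact dias_unclMat_inl p k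

-- The factor `m` completes the weight to a count of all cycles, and the truncation cancels the
-- external edges; what is left is the `bumpTerm` of the vacuum graph.
open Classical in
theorem coeff_FCT (m : ℂ) (logb : ℂ → ℂ) (d lam : ℂ) (hl0 : lam ≠ 0) {G : PGraph r 1}
    {p : Fin r × Matrix (Fin r) (Fin r) ℕ} (hG : G.2.adj = unclMat p) (hp : IsVac p.2)
    (μ : Expo) :
    m * MvPowerSeries.coeff μ (FCT logb m d lam G) =
      if HasType (dias p.2 + Pi.single p.1 1) μ then
        (-1) ^ r * (gr G.2.adj * bumpTerm m logb d lam p) else 0 := by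
  rw [FCT, FCgraph, MvPowerSeries.coeff_C_mul, MvPowerSeries.coeff_C_mul, coeff_vertexFactor,
    ind_of_adj_eq hG hp]
  split_ifs with h
  · have h1 : m * wei G.2.adj m = matWeight m (unclMat p) := by
      rw [hG]
      exact wei_one m ((unclMat_mem_MF le_rfl p).2 ⟨hp, fun k => one_le_two.trans (h.1 k)⟩)
    rw [matWeight_congr (outerEquiv r) m _ _ (unclMat_apply p),
      matWeight_extMat_self m p.2 p.1 (hp.diag _)] at h1
    have h2 := amplitude_pr_one logb d lam hl0 G.2 p hG
    calc _ = (-1) ^ r * (gr G.2.adj * ((m * wei G.2.adj m) *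
          (lam ^ 2 * G.2.pr.amplitude logb d lam))) := by
          unfold Multidigraph.amplitude
          ring
      _ = _ := by
          rw [h1, h2, bumpTerm, contrib]
          ring
  · simp

/-- The matrices obtained by renumbering are those of the graphs in the isomorphism class. All are
unclosable and of the same type, so `gr` counts labelled pairs. -/
theorem gr_eq_card {p : Fin r × Matrix (Fin r) (Fin r) ℕ} {μ : Expo}
    (hp : p ∈ bumpFin (Fin r) μ) {G : PGraph r 1} (hG : G.2.adj = unclMat p)
    [DecidablePred fun p' : Fin r × Matrix (Fin r) (Fin r) ℕ =>
      unclClass p' = Quotient.mk (graphSetoid r 1) G] :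
    gr G.2.adj = ((bumpFin (Fin r) μ).filter fun p' =>
      unclClass p' = Quotient.mk (graphSetoid r 1) G).card := by
  rw [← Set.ncard_coe_finset, ← Set.ncard_image_of_injective _ unclMat_injective, gr]
  congr 1
  ext F
  constructor
  · rintro ⟨a, b, rfl⟩
    have h := unclMat_permPt a b p
    rw [← hG] at h
    exact ⟨permPt a p, mem_coe.2 (mem_filter.2
      ⟨permPt_mem_bumpFin hp, (unclClass_eq_iff _ _).2 ⟨a, b, h⟩⟩), h⟩
  · rintro ⟨p', hp', rfl⟩
    exact (unclClass_eq_iff _ _).1 (mem_filter.1 (mem_coe.1 hp')).2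

/-- Summing `bumpTerm` over labelled pairs, grouped by isomorphism class, gives `gr` equal terms per
class. -/
theorem coeff_formalSum_FCT (m : ℂ) (logb : ℂ → ℂ) (d lam : ℂ) (hl0 : lam ≠ 0) (r : ℕ)
    (μ : Expo) :
    m * MvPowerSeries.coeff μ (formalSum fun q : GFU r 2 => FCT logb m d lam q.1.out) =
      (-1) ^ r * bumpSum m logb d lam (Fin r) μ := by
  classical
  have hout : ∀ q : Quotient (graphSetoid r 1), Quotient.mk _ q.out = q := Quotient.out_eq
  change m * (∑ᶠ q : GFU r 2, MvPowerSeries.coeff μ (FCT logb m d lam q.1.out)) = _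
  rw [finsum_set_coe_eq_finsum_mem (GFU r 2)
    (f := fun q => MvPowerSeries.coeff μ (FCT logb m d lam q.out)),
    finsum_cond_eq_sum_of_cond_iff (p := fun q => q ∈ GFU r 2)
      (t := (bumpFin (Fin r) μ).image unclClass)]
  · rw [bumpSum, ← sum_fiberwise_of_maps_to
      (fun p (hp : p ∈ bumpFin (Fin r) μ) => mem_image_of_mem unclClass hp), mul_sum, mul_sum]
    refine sum_congr rfl fun q hq => ?_
    obtain ⟨p, hp, rfl⟩ := mem_image.1 hq
    -- The representative `out` is arbitrary; its matrix is known only up to a renumbering of `p`.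
    obtain ⟨a, ha⟩ := adj_eq_of_unclClass_eq (hout (unclClass p)).symm
    have hpa : permPt a p ∈ bumpFin (Fin r) μ := permPt_mem_bumpFin hp
    have hpa' := mem_bumpFin.1 hpa
    rw [coeff_FCT m logb d lam hl0 ha hpa'.1, if_pos hpa'.2, gr_eq_card hpa ha, hout,
      ← nsmul_eq_mul, ← sum_const]
    congr 1
    refine sum_congr rfl fun p' hp' => ?_
    have h1 := (mem_filter.1 hp').2
    obtain ⟨a', ha'⟩ := adj_eq_of_unclClass_eq (h1.trans (hout (unclClass p)).symm)
    rw [unclMat_injective (ha.symm.trans ha'), bumpTerm_permPt]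
  · intro q hne
    constructor
    · rintro ⟨G, hG, hU, rfl⟩
      obtain ⟨p, hp⟩ := (isUnclosable_iff hG).1 hU
      have hc : unclClass p = Quotient.mk (graphSetoid r 1) G :=
        (unclClass_eq_iff p G).2 ⟨1, 1, by rw [← hp]; ext i j; simp⟩
      have hM := (isGF_iff one_le_two ⟨Sum.inr 0⟩ G).1 hG
      rw [hp, unclMat_mem_MF one_le_two] at hM
      obtain ⟨a, ha⟩ := adj_eq_of_unclClass_eq (hc.trans (hout _).symm)
      refine mem_image.2 ⟨p, ?_, hc⟩
      rw [mem_bumpFin]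
      refine ⟨hM.1, ?_⟩
      have hV : IsVac (permPt a p).2 :=
        hM.1.congr a.symm (by simp [permPt])
      have hF : ∀ i j, (permPt a p).2 (a.symm i) (a.symm j) = p.2 i j := by simp [permPt]
      have hT : HasType (dias (permPt a p).2 + Pi.single (permPt a p).1 1) μ := by
        by_contra hT
        refine hne ?_
        rw [FCT, FCgraph, MvPowerSeries.coeff_C_mul, MvPowerSeries.coeff_C_mul,
          coeff_vertexFactor, ind_of_adj_eq ha hV, if_neg hT]
        simp
      refine (HasType.congr a.symm (fun i => ?_) μ).1 hT
      rw [Pi.add_apply, dias_congr a.symm _ _ hF, Pi.add_apply]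
      simp [permPt, Pi.single_apply]
    · intro hq
      obtain ⟨p, hp, rfl⟩ := mem_image.1 hq
      rw [mem_bumpFin] at hp
      have hG : IsGF 2 (graphOf (unclMat p)) := by
        rw [isGF_iff one_le_two ⟨Sum.inr 0⟩, adj_graphOf, unclMat_mem_MF one_le_two]
        exact ⟨hp.1, hp.2.1⟩
      exact ⟨_, hG, (isUnclosable_iff hG).2 ⟨p, adj_graphOf _⟩, rfl⟩

theorem coeff_sigmaU (m : ℂ) (logb : ℂ → ℂ) (d lam : ℂ) (hl0 : lam ≠ 0) (μ : Expo) :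
    m * MvPowerSeries.coeff μ (sigmaU logb m d lam) =
      1 / (μ.degree.factorial : ℂ) * (-1) ^ μ.degree *
        bumpSum m logb d lam (Fin μ.degree) μ := by
  change m * (∑ᶠ r : ℕ, MvPowerSeries.coeff μ (sigmaUOrder logb m d lam r)) = _
  rw [finsum_eq_single _ μ.degree]
  · rw [sigmaUOrder]
    split_ifs with h
    · rw [bumpSum, sum_eq_zero, mul_zero, map_zero, mul_zero]
      intro p _
      rw [h] at p
      exact p.1.elim0
    · rw [MvPowerSeries.coeff_C_mul, mul_left_comm, coeff_formalSum_FCT m logb d lam hl0,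
        mul_assoc]
  · intro r hr
    by_contra hne
    unfold sigmaUOrder at hne
    split_ifs at hne with h0
    · exact hne (map_zero _)
    · obtain ⟨q, hq⟩ := coeff_order_ne hne
      unfold FCT FCgraph at hq
      rw [← mul_assoc, ← map_mul] at hq
      exact hr (coeff_vertexFactor_ne _ _ _ hq).1.symm

end PhiFour

end

noncomputable section

namespace PhiFour

open Finset Multidigraph

/-! ### The operator `D` and the comparison of coefficients -/

theorem hasDerivAt_logBranch {U : Set ℂ} (hU : IsOpen U) {logb : ℂ → ℂ}
    (hlog : DifferentiableOn ℂ logb U) (hexp : ∀ z ∈ U, Complex.exp (logb z) = z) {lam : ℂ}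
    (hlam : lam ∈ U) : HasDerivAt logb lam⁻¹ lam := by
  have h1 := (hlog.differentiableAt (hU.mem_nhds hlam)).hasDerivAt
  have h2 : HasDerivAt (fun z => Complex.exp (logb z)) 1 lam :=
    (hasDerivAt_id lam).congr_of_eventuallyEq
      (Filter.eventually_of_mem (hU.mem_nhds hlam) hexp)
  have h3 := h1.cexp.unique h2
  rw [hexp lam hlam] at h3
  rwa [← eq_inv_of_mul_eq_one_right h3]

theorem coeff_coupling_mul (j : ℕ) (hj : 2 ≤ j) (f : FormalSeries) (μ : Expo) :
    MvPowerSeries.coeff μ (coupling j * f) =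
      if 1 ≤ μ ⟨j, hj⟩ then
        MvPowerSeries.coeff (μ - Finsupp.single ⟨j, hj⟩ 1) f else 0 := by
  classical
  rw [coupling, dif_pos hj, MvPowerSeries.X, MvPowerSeries.coeff_monomial_mul]
  simp only [one_mul, Finsupp.single_le_iff]

theorem degree_sub_single {i : {j : ℕ // 2 ≤ j}} {μ : Expo} (h : 1 ≤ μ i) :
    (μ - Finsupp.single i 1).degree + 1 = μ.degree := by
  have h1 : μ - Finsupp.single i 1 + Finsupp.single i 1 = μ :=
    tsub_add_cancel_of_le (Finsupp.single_le_iff.2 h)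
  conv_rhs => rw [← h1]
  simp

/-- The common prefactor of the contributions of order `r`. -/
def orderFactor (r : ℕ) : ℂ := 1 / (r.factorial : ℂ) * (-1) ^ r

/-- The `r + 1` choices of the removed vertex reduce the factorial; the sign belongs to its vertex
factor `-λ₂`. -/
theorem orderFactor_succ (r : ℕ) : orderFactor (r + 1) * (r + 1 : ℕ) = -orderFactor r := by
  have h1 : ((r + 1 : ℕ) : ℂ) ≠ 0 := Nat.cast_ne_zero.2 r.succ_ne_zero
  have h2 : (r.factorial : ℂ) ≠ 0 := Nat.cast_ne_zero.2 r.factorial_ne_zero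
  rw [orderFactor, orderFactor, Nat.factorial_succ, Nat.cast_mul, pow_succ]
  field_simp

variable (m : ℂ) (logb : ℂ → ℂ) (d lam : ℂ)

/-- The contribution of `∂/∂λ_j` to `D Γ`. -/
def dTerm (μ : Expo) (j : ℕ) : ℂ :=
  MvPowerSeries.coeff μ (MvPowerSeries.C (((j : ℂ) + 1) * ((j : ℂ) + m)) * coupling (j + 1) *
    partialD j (gammaZero logb m d) lam)

theorem dTerm_eq (μ : Expo) (j : ℕ) (hj : 2 ≤ j + 1) :
    dTerm m logb d lam μ j = ((j : ℂ) + 1) * ((j : ℂ) + m) *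
      if 1 ≤ μ ⟨j + 1, hj⟩ then MvPowerSeries.coeff (μ - Finsupp.single ⟨j + 1, hj⟩ 1)
        (partialD j (gammaZero logb m d) lam) else 0 := by
  rw [dTerm, mul_assoc, MvPowerSeries.coeff_C_mul, coeff_coupling_mul]

theorem dTerm_ge (μ : Expo) (j : ℕ) (hj : 2 ≤ j) :
    dTerm m logb d lam μ j = orderFactor μ.degree *
      ∑ p ∈ (bumpFin (Fin μ.degree) μ).filter (fun p => dias p.2 p.1 = j),
        bumpTerm m logb d lam p := by
  rw [dTerm_eq m logb d lam μ j (by omega), bumpSum_ge m logb d lam j hj]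
  split_ifs with h
  · have hdeg : (μ - Finsupp.single ⟨j + 1, by omega⟩ 1 + Finsupp.single ⟨j, hj⟩ 1 :
        Expo).degree = μ.degree := by
      rw [← degree_sub_single h]
      simp
    have hp : partialD j (gammaZero logb m d) lam =
        MvPowerSeries.pderiv ℂ ⟨j, hj⟩ (gammaZero logb m d lam) := dif_pos hj
    rw [hp, MvPowerSeries.coeff_pderiv, coeff_gammaZero, hdeg, orderFactor]
    push_cast
    ring
  · simp

variable {logb d lam}

/-- The `λ₁`-derivative yields `insertSum`, which is `pendSum` minus the bubble part. The former is
the degree-one part of `bumpSum`; the latter is `m * Σ` at a monomial with one `λ₂` less. -/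
theorem dTerm_one (hd : 0 ≤ (1 - d / 2).re) (hl : Complex.exp (logb lam) = lam)
    (hl' : HasDerivAt logb lam⁻¹ lam) (hl0 : lam ≠ 0) (μ : Expo) :
    dTerm m logb d lam μ 1 = orderFactor μ.degree *
      ∑ p ∈ (bumpFin (Fin μ.degree) μ).filter (fun p => dias p.2 p.1 = 1),
        bumpTerm m logb d lam p +
      2 * (1 + m) * bubble logb d lam * (if 1 ≤ μ two then
        m * MvPowerSeries.coeff (μ - Finsupp.single two 1) (sigmaU logb m d lam) else 0) := by
  rw [dTerm_eq m logb d lam μ 1 le_rfl]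
  change _ * (if 1 ≤ μ two then MvPowerSeries.coeff (μ - Finsupp.single two 1) _ else 0) = _
  split_ifs with h
  · have hder : MvPowerSeries.coeff (μ - Finsupp.single two 1)
        (partialD 1 (gammaZero logb m d) lam) =
        orderFactor (μ - Finsupp.single two 1).degree *
          -insertSum m logb d lam (Fin (μ - Finsupp.single two 1).degree)
            (μ - Finsupp.single two 1) := by
      have hp : partialD 1 (gammaZero logb m d) lam =
          ((fun ν => deriv (fun z => MvPowerSeries.coeff ν (gammaZero logb m d z)) lam :) :
            FormalSeries) := dif_neg (by norm_num)
      rw [hp]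
      change deriv (fun z => MvPowerSeries.coeff (μ - Finsupp.single two 1)
        (gammaZero logb m d z)) lam = _
      simp only [coeff_gammaZero]
      exact ((hasDerivAt_vacSum m logb d lam hd hl' hl0 _).const_mul _).deriv
    have hdeg := degree_sub_single h
    rw [hder, coeff_sigmaU m logb d lam hl0, ← hdeg, bumpSum_one, if_pos h,
      pendSum_eq m logb d lam hd hl, ← mul_assoc (orderFactor (_ + 1)),
      orderFactor_succ, ← orderFactor]
    push_cast
    ring
  · rcases h0 : μ.degree with _ | r
    · rw [sum_eq_zero]
      · simp
      · intro p _
        exact p.1.elim0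
    · rw [bumpSum_one, if_neg h]
      simp

/-- The index `j` of `D` is the degree of the chosen vertex in `bumpSum`. The terms match for every
`j` except for the bubble correction at `j = 1`. -/
theorem coeff_opD (hd : 0 ≤ (1 - d / 2).re) (hl : Complex.exp (logb lam) = lam)
    (hl' : HasDerivAt logb lam⁻¹ lam) (hl0 : lam ≠ 0) (μ : Expo) :
    MvPowerSeries.coeff μ (opD m (gammaZero logb m d) lam) =
      m * MvPowerSeries.coeff μ (sigmaU logb m d lam) +
      2 * (1 + m) * bubble logb d lam * (if 1 ≤ μ two then
        m * MvPowerSeries.coeff (μ - Finsupp.single two 1) (sigmaU logb m d lam) else 0) := by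
  -- Raised degrees are at most `N`, so `j < N`. The range up to `N + 1` is used because it contains
  -- `1` even when `N = 0`.
  set N := μ.support.sup fun j => j.1 with hN
  change ∑ᶠ j : {j : ℕ // 1 ≤ j}, dTerm m logb d lam μ j.1 = _
  rw [finsum_subtype_eq_finsum_cond (fun j : ℕ => 1 ≤ j) (f := dTerm m logb d lam μ),
    finsum_cond_eq_sum_of_cond_iff (p := fun j : ℕ => 1 ≤ j) (t := Icc 1 (N + 1))]
  · rw [coeff_sigmaU m logb d lam hl0, ← orderFactor, bumpSum,
      ← sum_fiberwise_of_maps_to (t := Icc 1 (N + 1)) (g := fun p : Fin μ.degree × Matrix (Fin μ.degree) (Fin μ.degree) ℕ => dias p.2 p.1), mul_sum,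
      ← add_sum_erase _ _ (left_mem_Icc.2 (by omega : 1 ≤ N + 1)),
      ← add_sum_erase (a := 1) (Icc 1 (N + 1)) (fun j => orderFactor μ.degree * _)
        (left_mem_Icc.2 (by omega : 1 ≤ N + 1)),
      dTerm_one m hd hl hl' hl0, add_right_comm]
    · congr 2
      refine sum_congr rfl fun j hj => ?_
      rw [mem_erase, mem_Icc] at hj
      exact dTerm_ge m logb d lam μ j (by omega)
    · intro p hp
      rw [mem_bumpFin] at hp
      have h1 := hp.2.1 p.1
      have h2 := hp.2.le_sup p.1
      rw [Pi.add_apply, Pi.single_eq_same] at h1 h2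
      rw [mem_Icc]
      omega
  · intro j hj
    rw [mem_Icc]
    refine ⟨fun h => ⟨h, ?_⟩, fun h => h.1⟩
    rw [dTerm_eq m logb d lam μ j (by omega)] at hj
    have h1 : 1 ≤ μ ⟨j + 1, by omega⟩ := by
      by_contra hc
      exact hj (by rw [if_neg hc, mul_zero])
    have h2 : j + 1 ≤ N := Finset.le_sup (f := fun j : {j : ℕ // 2 ≤ j} => j.1)
      (Finsupp.mem_support_iff.2 (Nat.one_le_iff_ne_zero.1 h1))
    omega

end PhiFour

end

theorem mainTheorem3 (m d : ℂ) (hd : 0 ≤ (1 - d / 2).re)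
    (U : Set ℂ) (hU : IsOpen U) (logb : ℂ → ℂ) (hlog : DifferentiableOn ℂ logb U)
    (hexp : ∀ z ∈ U, Complex.exp (logb z) = z) (lam : ℂ) (hlam : lam ∈ U) :
    MvPowerSeries.C m * PhiFour.sigmaU logb m d lam =
      (1 + MvPowerSeries.C (Complex.exp ((d / 2 - 2) * logb lam)) * PhiFour.coupling 2 *
          MvPowerSeries.C (2 * (1 + m) * Complex.Gamma (2 - d / 2) /
            (4 * (Real.pi : ℂ)) ^ (d / 2)))⁻¹ *
        PhiFour.opD m (PhiFour.gammaZero logb m d) lam := by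
  have hl := hexp lam hlam
  have hl0 : lam ≠ 0 := hl ▸ Complex.exp_ne_zero _
  have hl' := PhiFour.hasDerivAt_logBranch hU hlog hexp hlam
  -- The inverse is a genuine one, since `λ₂` has no constant term and the bracket has constant term
  -- one.
  rw [mul_comm _ (PhiFour.opD _ _ _), MvPowerSeries.eq_mul_inv_iff_mul_eq]
  · ext μ
    rw [PhiFour.coeff_opD m hd hl hl' hl0, mul_comm, add_mul, one_mul, map_add,
      MvPowerSeries.coeff_C_mul, mul_assoc, mul_assoc, MvPowerSeries.coeff_C_mul,
      PhiFour.coeff_coupling_mul 2 le_rfl, MvPowerSeries.coeff_C_mul, MvPowerSeries.coeff_C_mul,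
      PhiFour.Multidigraph.bubble]
    split_ifs <;> ring
  · have : MvPowerSeries.constantCoeff (PhiFour.coupling 2) = (0 : ℂ) := by
      simp [PhiFour.coupling]
    simp [this]
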